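/- **Model.** All words have $O(\log n)$ bits on inputs of size $n$: numbers that a program writes are at most $(n+2)^{\kappa}$ for a constant $\kappa$ depending on the program. A *classical algorithm* is a program for a random-access machine with unit-cost arithmetic, memory access and tests; it runs in time $O(T(n))$ if, for some time-constructible $t(n)=O(T(n))$ (that is, $t(n)$ can be computed from $n$ within $t(n)$ steps), it halts within $t(n)$ steps on every input of size $n$. A *quantum algorithm* is a uniform family of circuits acting on a memory of quantum words: a classical program which, given only $n$, writes the circuit for inputs of size $n$; the circuit is applied to the basis state that holds the input, and then all words are measured. The unit-cost gates are reversible modular word arithmetic, quantum random-access read and write (the address may be in superposition), the Hadamard gate, and the phase gates $\mathrm{diag}(1,e^{\pm 2\pi i/2^k})$. Its running time is the time to write the circuit plus the number of gates. It computes a function *exactly* if the measured output is correct with probability $1$ on every input, and *with bounded error* if it is correct with probability at least $2/3$ on every input. **Theorem.** For every constant $c$ there is a constant $c'$, depending only on $c$, such that the following holds for every $T:\mathbb N\to[0,\infty)$. Suppose that there is a classical algorithm, or an exact quantum algorithm, that, given a symmetric $\mathbf A\in\mathbb Z^{n\times n}$ with entries of magnitude at most $n^{c'}$, computes $\mathrm{tr}(\mathbf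 A^3)$ in time $O(T(n))$. Then there is an exact quantum algorithm that, given $\mathbf A,\mathbf B\in\mathbb Z^{n\times n}$ with entries of magnitude at most $n^{c}$, computes $\mathbf A\mathbf B$ in time $O(T(n))+\tilde O(n^2)$, that is, in time $O\big(T(n)+n^2(\log n)^k\big)$ for some constant $k$. Likewise, if there is a bounded-error quantum algorithm for the first problem that runs in time $O(T(n))$, then there is a bounded-error quantum algorithm for the second problem that runs in time $O(T(n))+\tilde O(n^2)$. -/

import Mathlib

/-!
# Classical and quantum random-access machines

*Classical machine.*  A random-access machine in structured form: a program is a finite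
command built from assignments, conditionals and loops, acting on finitely many arrays of
words.  On inputs of size `n` every word that is written, and every address that is written
to, is at most `(n + 2) ^ κ` for a constant `κ`, so words have `O(log n)` bits.  Arithmetic,
memory access and tests have unit cost.

*Quantum machine.*  The memory consists of cells, each of which is a quantum register holding a
word.  Unit-cost gates are reversible word arithmetic, read and write of the cell whose address
is held, possibly in superposition, in another cell (quantum random-access memory), the Hadamard
gate, and the phase gates `diag (1, exp (± 2 π i / 2 ^ k))`.  A quantum algorithm is a uniform
family of circuits of such gates: one classical program that, given only `n`, writes the
circuit for inputs of size `n`.  Its running time is the time to write the circuit plus the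
number of gates.
-/

namespace QRAM

/-! ## The classical random-access machine -/

/-- The content of the arrays: `σ a i` is the word at index `i` of array number `a`. -/
abbrev Store : Type := ℕ → ℕ → ℕ

/-- Word expressions.  An expression is a part of the program, so its size is a constant. -/
inductive Expr : Type
  | lit (k : ℕ)
  | read (a : ℕ) (i : Expr)
  | add (x y : Expr)
  | sub (x y : Expr)
  | mul (x y : Expr)
  | div (x y : Expr)

/-- The value of an expression; subtraction is truncated at zero, and division is rounded down,
with quotient zero for divisor zero. -/
def Expr.eval (σ : Store) : Expr → ℕ
  | .lit k => k
  | .read a i => σ a (i.eval σ)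
  | .add x y => x.eval σ + y.eval σ
  | .sub x y => x.eval σ - y.eval σ
  | .mul x y => x.eval σ * y.eval σ
  | .div x y => x.eval σ / y.eval σ

/-- Programs of the classical machine. -/
inductive Com : Type
  | skip
  | assign (a : ℕ) (i e : Expr)
  | seq (c₁ c₂ : Com)
  | cond (e : Expr) (c₁ c₂ : Com)
  | loop (e : Expr) (c : Com)

/-- Write the word `v` at index `i` of array `a`. -/
def Store.write (σ : Store) (a i v : ℕ) : Store :=
  Function.update σ a (Function.update (σ a) i v)

/-- `Exec B c σ t τ`: started on `σ`, the program `c` halts after exactly `t` steps with the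
store `τ`, and no word written and no address written to exceeds `B`.  A condition holds if
its value is nonzero. -/
inductive Exec (B : ℕ) : Com → Store → ℕ → Store → Prop
  | skip (σ : Store) : Exec B .skip σ 1 σ
  | assign (σ : Store) (a : ℕ) (i e : Expr) (hi : i.eval σ ≤ B) (he : e.eval σ ≤ B) :
      Exec B (.assign a i e) σ 1 (σ.write a (i.eval σ) (e.eval σ))
  | seq {c₁ c₂ : Com} {σ₁ σ₂ σ₃ : Store} {s t : ℕ}
      (h₁ : Exec B c₁ σ₁ s σ₂) (h₂ : Exec B c₂ σ₂ t σ₃) :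
      Exec B (.seq c₁ c₂) σ₁ (s + t) σ₃
  | condTrue {e : Expr} {c₁ c₂ : Com} {σ τ : Store} {t : ℕ}
      (he : e.eval σ ≠ 0) (h : Exec B c₁ σ t τ) : Exec B (.cond e c₁ c₂) σ (t + 1) τ
  | condFalse {e : Expr} {c₁ c₂ : Com} {σ τ : Store} {t : ℕ}
      (he : e.eval σ = 0) (h : Exec B c₂ σ t τ) : Exec B (.cond e c₁ c₂) σ (t + 1) τ
  | loopStop {e : Expr} {c : Com} {σ : Store} (he : e.eval σ = 0) : Exec B (.loop e c) σ 1 σ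
  | loopStep {e : Expr} {c : Com} {σ₁ σ₂ σ₃ : Store} {s t : ℕ}
      (he : e.eval σ₁ ≠ 0) (h₁ : Exec B c σ₁ s σ₂) (h₂ : Exec B (.loop e c) σ₂ t σ₃) :
      Exec B (.loop e c) σ₁ (s + t + 1) σ₃

/-- The store that holds the number `n` at index `0` of array `0`, the words `w` in array `1`,
and zero elsewhere. -/
def initStore (n : ℕ) (w : ℕ → ℕ) : Store := fun a i =>
  if a = 0 ∧ i = 0 then n else if a = 1 then w i else 0

/-! ## Quantum memory and gates -/

/-- A classical content of the cells of the quantum memory, that is, a basis state. -/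
abbrev Mem : Type := ℕ → ℕ

/-- A superposition of finitely many basis states. -/
abbrev QState : Type := Mem →₀ ℂ

/-- The words that the arithmetic gates add to a cell or subtract from it; `load base a` is the
content of the cell whose address is `base` plus the content of cell `a`. -/
inductive Operand : Type
  | const (k : ℕ)
  | copy (a : ℕ)
  | monus (a b : ℕ)
  | mul (a b : ℕ)
  | div (a b : ℕ)
  | load (base a : ℕ)

/-- The value of an operand in a basis state. -/
def Operand.eval (m : Mem) : Operand → ℕ
  | .const k => k
  | .copy a => m a
  | .monus a b => m a - m b
  | .mul a b => m a * m b
  | .div a b => m a / m b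
  | .load base a => m (base + m a)

/-- Quantum gates.  All parameters are classical numbers. -/
inductive Gate : Type
  /-- add the operand to cell `d` modulo `N` -/
  | add (d N : ℕ) (f : Operand)
  /-- subtract the operand from cell `d` modulo `N` -/
  | sub (d N : ℕ) (f : Operand)
  /-- exchange cell `d` with the cell whose address is `base` plus the content of cell `a` -/
  | swap (d base a : ℕ)
  /-- Hadamard gate on the least significant qubit of cell `d` -/
  | had (d : ℕ)
  /-- phase `exp (2 π i / 2 ^ k)` if the least significant qubit of cell `d` is `1` -/
  | phase (d k : ℕ)
  /-- phase `exp (- 2 π i / 2 ^ k)` if the least significant qubit of cell `d` is `1` -/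
  | phaseInv (d k : ℕ)
  | idle

/-- The action of a gate on a basis state.  So that arithmetic gates are reversible, the operand
is evaluated with cell `d` cleared and contents of cell `d` that are not below `N` are left
alone; for the same reason an exchange that would change its own address cell does nothing. -/
noncomputable def Gate.onBasis (m : Mem) : Gate → QState
  | .add d N f =>
      Finsupp.single
        (if m d < N then
          Function.update m d ((m d + f.eval (Function.update m d 0)) % N) else m) 1
  | .sub d N f =>
      Finsupp.single
        (if m d < N then
          Function.update m d ((m d + (N - f.eval (Function.update m d 0) % N)) % N) else m) 1
  | .swap d base a =>
      Finsupp.single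
        (if a ≠ d ∧ base + m a ≠ a then m ∘ Equiv.swap d (base + m a) else m) 1
  | .had d =>
      Finsupp.single (Function.update m d (2 * (m d / 2))) ((Real.sqrt 2 : ℂ)⁻¹) +
      Finsupp.single (Function.update m d (2 * (m d / 2) + 1))
        ((-1) ^ (m d) * (Real.sqrt 2 : ℂ)⁻¹)
  | .phase d k =>
      Finsupp.single m (Complex.exp (2 * Real.pi * Complex.I * (m d % 2 : ℕ) / 2 ^ k))
  | .phaseInv d k =>
      Finsupp.single m (Complex.exp (-(2 * Real.pi * Complex.I * (m d % 2 : ℕ) / 2 ^ k)))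
  | .idle => Finsupp.single m 1

/-- The linear action of a gate on superpositions. -/
noncomputable def Gate.apply (g : Gate) : QState →ₗ[ℂ] QState :=
  Finsupp.linearCombination ℂ fun m => g.onBasis m

/-- The action of a circuit, its first gate being applied first. -/
noncomputable def runCircuit (C : List Gate) (ψ : QState) : QState :=
  C.foldl (fun φ g => g.apply φ) ψ

open Classical in
/-- The probability that a measurement of all cells in the state `ψ` has a result in `S`. -/
noncomputable def prob (ψ : QState) (S : Set Mem) : ℝ :=
  ∑ m ∈ ψ.support, if m ∈ S then ‖ψ m‖ ^ 2 else 0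

/-- The gate that is described by five words. -/
def Gate.decode (op d N x y : ℕ) : Gate :=
  match op with
  | 0 => .add d N (.const x)
  | 1 => .add d N (.copy x)
  | 2 => .add d N (.monus x y)
  | 3 => .add d N (.mul x y)
  | 4 => .add d N (.div x y)
  | 5 => .add d N (.load x y)
  | 6 => .sub d N (.const x)
  | 7 => .sub d N (.copy x)
  | 8 => .sub d N (.monus x y)
  | 9 => .sub d N (.mul x y)
  | 10 => .sub d N (.div x y)
  | 11 => .sub d N (.load x y)
  | 12 => .swap d x y
  | 13 => .had d
  | 14 => .phase d x
  | 15 => .phaseInv d x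
  | _ => .idle

/-- The circuit that a classical program has written when it halts: the number of gates is at
index `0` of array `0`, and gate number `i` is described by the words at index `i` of the
arrays `1` to `5`. -/
def circuitOf (σ : Store) : List Gate :=
  (List.range (σ 0 0)).map fun i => Gate.decode (σ 1 i) (σ 2 i) (σ 3 i) (σ 4 i) (σ 5 i)

/-! ## Computational problems and running times -/

/-- A computational problem: for each size `n` its instances, the number of input words and of
output words, and for each instance the input words and the correct output words. -/
structure Problem where
  Inst : ℕ → Type
  inputLen : ℕ → ℕ
  outputLen : ℕ → ℕ
  input : (n : ℕ) → Inst n → ℕ → ℕ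
  output : (n : ℕ) → Inst n → ℕ → ℕ

/-- The input words of an instance, followed by zeros. -/
def Problem.inputWords (P : Problem) (n : ℕ) (x : P.Inst n) : ℕ → ℕ := fun k =>
  if k < P.inputLen n then P.input n x k else 0

/-- The measurement results that show the correct output directly behind the input cells. -/
def Problem.correct (P : Problem) (n : ℕ) (x : P.Inst n) : Set Mem :=
  {m | ∀ k < P.outputLen n, m (P.inputLen n + k) = P.output n x k}

/-- `P` is solved in time `O(T(n))` by a deterministic classical algorithm.  The program `A`
gets `n` and the input words, leaves the output in array `2`, and halts within `t n` steps on all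
inputs of size `n`, where the bound `t = O(T)` is time-constructible: the program `clock` computes
`t n` from `n` within `t n` steps. -/
def ClassicalTime (P : Problem) (T : ℕ → ℝ) : Prop :=
  ∃ (A clock : Com) (κ : ℕ) (t : ℕ → ℕ),
    (fun n => (t n : ℝ)) =O[Filter.atTop] T ∧
    (∀ n, ∃ s ≤ t n, ∃ τ,
      Exec ((n + 2) ^ κ) clock (initStore n fun _ => 0) s τ ∧ τ 0 0 = t n) ∧
    ∀ n (x : P.Inst n), ∃ s ≤ t n, ∃ τ,
      Exec ((n + 2) ^ κ) A (initStore n (P.inputWords n x)) s τ ∧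
      ∀ k < P.outputLen n, τ 2 k = P.output n x k

/-- `P` is solved in time `O(T(n))`, with probability at least `p` on every input, by a quantum
algorithm: a classical program `A` that, given `n`, writes a circuit, which is then applied
to the basis state that holds the input words, and followed by a measurement. -/
def QuantumTime (p : ℝ) (P : Problem) (T : ℕ → ℝ) : Prop :=
  ∃ (A : Com) (κ : ℕ) (t : ℕ → ℕ),
    (fun n => (t n : ℝ)) =O[Filter.atTop] T ∧
    ∀ n, ∃ s τ,
      Exec ((n + 2) ^ κ) A (initStore n fun _ => 0) s τ ∧
      s + (circuitOf τ).length ≤ t n ∧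
      ∀ x : P.Inst n,
        p ≤ prob (runCircuit (circuitOf τ) (Finsupp.single (P.inputWords n x) 1))
          (P.correct n x)

/-! ## The two matrix problems -/

/-- An integer is represented by two words, its positive part and its negative part. -/
def intWord (z : ℤ) (k : ℕ) : ℕ := if k % 2 = 0 then z.toNat else (-z).toNat

/-- The entry number `k` of a square matrix in row-major order. -/
def entry {n : ℕ} (A : Matrix (Fin n) (Fin n) ℤ) (k : ℕ) : ℤ :=
  if h : k / n < n then A ⟨k / n, h⟩ ⟨k % n, Nat.mod_lt k (Nat.zero_lt_of_lt h)⟩ else 0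

/-- The words that represent a square matrix. -/
def matWord {n : ℕ} (A : Matrix (Fin n) (Fin n) ℤ) (k : ℕ) : ℕ := intWord (entry A (k / 2)) k

/-- All entries are at most `n ^ c` in magnitude. -/
def EntriesBounded {n : ℕ} (c : ℕ) (A : Matrix (Fin n) (Fin n) ℤ) : Prop :=
  ∀ i j, |A i j| ≤ (n : ℤ) ^ c

/-- Given a symmetric integer matrix `A` with entries at most `n ^ c` in magnitude, compute the
trace of `A ^ 3`. -/
def traceCube (c : ℕ) : Problem where
  Inst n := {A : Matrix (Fin n) (Fin n) ℤ // A.IsSymm ∧ EntriesBounded c A}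
  inputLen n := 2 * n ^ 2
  outputLen _ := 2
  input _ A k := matWord A.1 k
  output _ A k := intWord (A.1 ^ 3).trace k

/-- Given integer matrices `A` and `B` with entries at most `n ^ c` in magnitude, compute the
product `A * B`. -/
def matMul (c : ℕ) : Problem where
  Inst n := {M : Matrix (Fin n) (Fin n) ℤ × Matrix (Fin n) (Fin n) ℤ //
    EntriesBounded c M.1 ∧ EntriesBounded c M.2}
  inputLen n := 4 * n ^ 2
  outputLen n := 2 * n ^ 2
  input n M k := if k < 2 * n ^ 2 then matWord M.1.1 k else matWord M.1.2 (k - 2 * n ^ 2)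
  output _ M k := matWord (M.1.1 * M.1.2) k

end QRAM

/-! Put three blocks α, β, γ above the diagonal of a symmetric tripartite matrix. A closed walk of
length three in it must visit each of the three index classes once, and every such triangle is
walked in six ways, so the trace of the cube is six times the sum of α a b * β b c * γ a c
(`trace_triMatrix`). With α and β cut out of A and B, one sixth of the trace is a linear functional
of γ, namely the pairing ⟨AB, γ⟩.

A linear functional over ℤ/N with N = 2 ^ K can be learnt by evaluating it in superposition, as in
the Bernstein-Vazirani algorithm. Take the uniform superposition of all γ with entries in ℤ/N and
give γ the phase exp (2 π i ⟨AB, γ⟩ / N). The result is the Fourier transform of the basis state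
that holds AB modulo N, so the inverse transform shows all entries of AB at once. Since N is more
than twice the largest possible magnitude of an entry, the residues determine the entries.

The given algorithm is called for matrices of size s = max n 3, so the blocks have size m = s / 3,
and n ≤ 5 m. Each of the three index ranges is cut into five pieces, and the functional is a sum of
125 block functionals (`sum_gain`), each of which costs one query. The rest is loading the queries,
reading the output, and the Fourier transform on n ^ 2 registers of K = O(log n) qubits, which takes
O(n ^ 2 K ^ 2) gates.

A phase query runs the subroutine, turns its output into a phase, and runs everything backwards. If
the subroutine errs with probability at most ε, the squared distance from the ideal phase is at most
4 ε (`nsq_conj_sub_le`). Distances add up over the 125 queries (`nsq_iterate_sub_le`), so the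
product is found with probability at least (1 - 250 √ε) ^ 2 (`Params.prob_circuit`). For an exact
subroutine ε = 0. A bounded-error subroutine is first improved to ε = 10 ^ (-8) by taking a majority
of three a constant number of times (`quantumTime_amplified`). A classical program is first unrolled
into a circuit for as many steps as its clock announces (`quantumTime_of_classicalTime`); it becomes
reversible because every overwritten word is exchanged with a fresh work cell.

The circuits have to be written by random-access programs with polynomially bounded words. They are
described in a small language of writing programs, which is compiled once and for all
(`Writer.exec`) and whose words are always polynomially bounded (`Writer.exists_pow_bound`). For
each circuit there then remain an identity of gate lists and a bound on the cost
(`quantumTime_of_writer`). -/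

namespace QRAM

/-! ## Circuits as linear maps -/

/-- The gate that undoes a gate. -/
def Gate.inv : Gate → Gate
  | .add d N f => .sub d N f
  | .sub d N f => .add d N f
  | .swap d b a => .swap d b a
  | .had d => .had d
  | .phase d k => .phaseInv d k
  | .phaseInv d k => .phase d k
  | .idle => .idle

/-- Gates that permute the basis states. -/
def Gate.IsClassical : Gate → Prop
  | .had _ => False
  | .phase _ _ => False
  | .phaseInv _ _ => False
  | _ => True

/-- The action of a classical gate on basis states. -/
def Gate.act (m : Mem) : Gate → Mem
  | .add d N f =>
      if m d < N then
          Function.update m d ((m d + f.eval (Function.update m d 0)) % N) else m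
  | .sub d N f =>
      if m d < N then
          Function.update m d ((m d + (N - f.eval (Function.update m d 0) % N)) % N) else m
  | .swap d base a => if a ≠ d ∧ base + m a ≠ a then m ∘ Equiv.swap d (base + m a) else m
  | _ => m

theorem Gate.IsClassical.onBasis {g : Gate} (hg : g.IsClassical) (m : Mem) :
    g.onBasis m = Finsupp.single (g.act m) 1 := by
  cases g
  case had => exact hg.elim
  case phase => exact hg.elim
  case phaseInv => exact hg.elim
  all_goals rfl

theorem Gate.apply_single (g : Gate) (m : Mem) (z : ℂ) :
    g.apply (Finsupp.single m z) = z • g.onBasis m := by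
  simp [Gate.apply, Finsupp.linearCombination_single]

theorem Gate.IsClassical.inv {g : Gate} (hg : g.IsClassical) : g.inv.IsClassical := by
  cases g <;> trivial

theorem Gate.inv_inv (g : Gate) : g.inv.inv = g := by cases g <;> rfl

/-- An arithmetic gate evaluates its operand with cell `d` cleared, so the inverse gate sees the
same operand. The guard of `swap` keeps the address cell out of the exchange, so both applications
use the same address. -/
theorem Gate.act_inv_act {g : Gate} (hg : g.IsClassical) (m : Mem) :
    g.inv.act (g.act m) = m := by
  cases g with
  | add d N f =>
    by_cases h : m d < N
    · have hN : 0 < N := by omega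
      simp only [Gate.inv, Gate.act, h, if_true, Function.update_self, Function.update_idem,
        Nat.mod_lt _ hN]
      generalize f.eval (Function.update m d 0) = x
      have : ((m d + x) % N + (N - x % N)) % N = m d := by
        have hx := Nat.mod_lt x hN
        rw [Nat.mod_add_mod, Nat.add_assoc]
        have : x + (N - x % N) = N * (x / N + 1) := by
          have := Nat.div_add_mod x N
          rw [Nat.mul_add]; omega
        rw [this, Nat.add_mul_mod_self_left, Nat.mod_eq_of_lt h]
      rw [this, Function.update_eq_self]
    · simp [Gate.inv, Gate.act, h]
  | sub d N f =>
    by_cases h : m d < N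
    · have hN : 0 < N := by omega
      simp only [Gate.inv, Gate.act, h, if_true, Function.update_self, Function.update_idem,
        Nat.mod_lt _ hN]
      generalize f.eval (Function.update m d 0) = x
      have : ((m d + (N - x % N)) % N + x) % N = m d := by
        have hx := Nat.mod_lt x hN
        rw [Nat.mod_add_mod, Nat.add_assoc]
        have : (N - x % N) + x = N * (x / N + 1) := by
          have := Nat.div_add_mod x N
          rw [Nat.mul_add]; omega
        rw [this, Nat.add_mul_mod_self_left, Nat.mod_eq_of_lt h]
      rw [this, Function.update_eq_self]
    · simp [Gate.inv, Gate.act, h]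
  | swap d b a =>
    by_cases h : a ≠ d ∧ b + m a ≠ a
    · have ha : (m ∘ Equiv.swap d (b + m a)) a = m a := by
        simp only [Function.comp_apply]
        rw [Equiv.swap_apply_of_ne_of_ne h.1 h.2.symm]
      have h1 : (Gate.swap d b a).act m = m ∘ Equiv.swap d (b + m a) := if_pos h
      rw [h1]
      refine (if_pos (by rw [ha]; exact h)).trans ?_
      rw [ha]
      funext i; simp
    · have h1 : (Gate.swap d b a).act m = m := if_neg h
      rw [Gate.inv, h1, h1]
  | idle => rfl
  | _ => exact hg.elim

-- This form of the matrix coefficient is symmetric in `m` and `m'`, which shows that the Hadamard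
-- gate is self-adjoint.
open scoped Classical in
theorem had_onBasis_apply (d : ℕ) (m m' : Mem) :
    (Gate.had d).onBasis m m' =
      if (∀ i, i ≠ d → m' i = m i) ∧ m' d / 2 = m d / 2
      then (-1) ^ (m d * m' d) * (Real.sqrt 2 : ℂ)⁻¹ else 0 := by
  have key : ∀ x, Function.update m d x = m' ↔ (∀ i, i ≠ d → m' i = m i) ∧ m' d = x := by
    intro x
    constructor
    · rintro rfl
      exact ⟨fun i hi => by simp [hi], by simp⟩
    · rintro ⟨h1, h2⟩
      funext i
      by_cases hi : i = d
      · subst hi; simp [h2]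
      · simp [hi, h1 i hi]
  simp only [Gate.onBasis, Finsupp.add_apply, Finsupp.single_apply, key]
  by_cases h : ∀ i, i ≠ d → m' i = m i
  · simp only [and_iff_right h]
    by_cases h2 : m' d / 2 = m d / 2
    · rw [if_pos h2]
      rcases Nat.mod_two_eq_zero_or_one (m' d) with h3 | h3
      · have e : m' d = 2 * (m d / 2) := by omega
        rw [if_pos e, if_neg (by omega), add_zero]
        have : Even (m d * m' d) := by rw [e]; simp
        rw [this.neg_one_pow, one_mul]
      · have e : m' d = 2 * (m d / 2) + 1 := by omega
        rw [if_neg (by omega), if_pos e, zero_add, e, mul_add, mul_one, pow_add,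
          Even.neg_one_pow (n := m d * (2 * (m d / 2))) (by simp), one_mul]
    · rw [if_neg (by omega), if_neg (by omega), if_neg h2, add_zero]
  · simp [h]

/-- The inverse gate is the adjoint: a permutation matrix is inverted by transposition, the Hadamard
matrix is real and symmetric, and phases are inverted by conjugation. -/
theorem Gate.inv_onBasis_apply (g : Gate) (m m' : Mem) :
    g.inv.onBasis m m' = (starRingEnd ℂ) (g.onBasis m' m) := by
  classical
  have cl : ∀ g : Gate, g.IsClassical → g.inv.onBasis m m' = (starRingEnd ℂ) (g.onBasis m' m) := by
    intro g hg
    rw [hg.onBasis, hg.inv.onBasis, Finsupp.single_apply, Finsupp.single_apply]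
    have : g.inv.act m = m' ↔ g.act m' = m := by
      constructor
      · rintro rfl
        have := Gate.act_inv_act hg.inv m
        rwa [Gate.inv_inv] at this
      · rintro rfl; exact Gate.act_inv_act hg m'
    simp only [this]; split_ifs <;> simp
  cases g with
  | had d =>
    simp only [Gate.inv, had_onBasis_apply]
    have : ((∀ i, i ≠ d → m' i = m i) ∧ m' d / 2 = m d / 2) ↔
        ((∀ i, i ≠ d → m i = m' i) ∧ m d / 2 = m' d / 2) := by
      simp only [eq_comm]
    simp only [this, mul_comm (m d)]
    split_ifs <;> simp
  | phase d k =>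
    simp only [Gate.inv, Gate.onBasis, Finsupp.single_apply]
    by_cases h : m = m'
    · subst h; simp only [if_true, ← Complex.exp_conj]; simp [Complex.conj_ofNat, neg_div]
    · rw [if_neg h, if_neg (fun e => h e.symm)]; simp
  | phaseInv d k =>
    simp only [Gate.inv, Gate.onBasis, Finsupp.single_apply]
    by_cases h : m = m'
    · subst h; simp only [if_true, ← Complex.exp_conj]; simp [Complex.conj_ofNat, neg_div]
    · rw [if_neg h, if_neg (fun e => h e.symm)]; simp
  | _ => exact cl _ trivial

theorem Gate.inv_apply_apply (g : Gate) (ψ : QState) : g.inv.apply (g.apply ψ) = ψ := by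
  have : g.inv.apply ∘ₗ g.apply = LinearMap.id := by
    refine Finsupp.lhom_ext fun m z => ?_
    simp only [LinearMap.comp_apply, LinearMap.id_apply, Gate.apply_single, map_smul]
    have h : g.inv.apply (g.onBasis m) = Finsupp.single m 1 := by
      have cl : ∀ g : Gate, g.IsClassical → g.inv.apply (g.onBasis m) = Finsupp.single m 1 := by
        intro g hg
        rw [hg.onBasis, Gate.apply_single, hg.inv.onBasis, Gate.act_inv_act hg, one_smul]
      cases g with
      | had d =>
        -- Of the four terms of the double Hadamard gate, two with coefficient 1/2 meet in `m`, and
        -- two with opposite signs cancel.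
        have h2 : (Real.sqrt 2 : ℂ)⁻¹ * (Real.sqrt 2 : ℂ)⁻¹ = 1 / 2 := by
          rw [← mul_inv, ← Complex.ofReal_mul, Real.mul_self_sqrt (by norm_num)]; norm_num
        have e1 : ∀ x : ℕ, 2 * (2 * x / 2) = 2 * x := by intro x; omega
        have e2 : ∀ x : ℕ, 2 * ((2 * x + 1) / 2) = 2 * x := by intro x; omega
        have e3 : ∀ x : ℕ, (-1 : ℂ) ^ (2 * x) = 1 := by intro x; simp
        have e4 : ∀ x : ℕ, (-1 : ℂ) ^ (2 * x + 1) = -1 := by intro x; simp [pow_add]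
        simp only [Gate.inv, Gate.onBasis, map_add, Gate.apply_single, Function.update_self,
          Function.update_idem, e1, e2, e3, e4, smul_add, Finsupp.smul_single, smul_eq_mul, one_mul]
        rcases Nat.even_or_odd' (m d) with ⟨x, hx | hx⟩
        · have hd : m d / 2 = x := by omega
          have hm : Function.update m d (2 * x) = m := by rw [← hx]; simp
          rw [hd, hm, hx, e3, one_mul, h2]
          have : (Real.sqrt 2 : ℂ)⁻¹ * (-1 * (Real.sqrt 2 : ℂ)⁻¹) = - (1/2) := by
            rw [← h2]; ring
          rw [this]
          rw [add_add_add_comm, ← Finsupp.single_add, ← Finsupp.single_add]; norm_num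
        · have hd : m d / 2 = x := by omega
          have hm : Function.update m d (2 * x + 1) = m := by rw [← hx]; simp
          rw [hd, hm, hx, e4]
          have : -1 * (Real.sqrt 2 : ℂ)⁻¹ * (-1 * (Real.sqrt 2 : ℂ)⁻¹) = 1/2 := by
            rw [← h2]; ring
          have h3 : -1 * (Real.sqrt 2 : ℂ)⁻¹ * ((Real.sqrt 2 : ℂ)⁻¹) = -(1/2) := by
            rw [← h2]; ring
          rw [this, h3, h2]
          rw [add_add_add_comm, ← Finsupp.single_add, ← Finsupp.single_add]; norm_num
      | phase d k =>
        simp only [Gate.inv, Gate.onBasis, Gate.apply_single, Finsupp.smul_single, smul_eq_mul,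
          ← Complex.exp_add, add_neg_cancel, Complex.exp_zero]
      | phaseInv d k =>
        simp only [Gate.inv, Gate.onBasis, Gate.apply_single, Finsupp.smul_single, smul_eq_mul,
          ← Complex.exp_add, neg_add_cancel, Complex.exp_zero]
      | _ => exact cl _ trivial
    rw [h, Finsupp.smul_single, smul_eq_mul, mul_one]
  exact LinearMap.congr_fun this ψ

/-- The linear map of a circuit. -/
noncomputable def circ : List Gate → QState →ₗ[ℂ] QState
  | [] => LinearMap.id
  | g :: C => circ C ∘ₗ g.apply

theorem runCircuit_eq_circ (C : List Gate) (ψ : QState) : runCircuit C ψ = circ C ψ := by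
  induction C generalizing ψ with
  | nil => rfl
  | cons g C ih => exact ih _

@[simp] theorem circ_nil (ψ : QState) : circ [] ψ = ψ := rfl

theorem circ_cons (g : Gate) (C : List Gate) (ψ : QState) :
    circ (g :: C) ψ = circ C (g.apply ψ) := rfl

theorem circ_append (C D : List Gate) (ψ : QState) : circ (C ++ D) ψ = circ D (circ C ψ) := by
  induction C generalizing ψ with
  | nil => rfl
  | cons g C ih => exact ih _

/-- The circuit that undoes a circuit. -/
def invCircuit (C : List Gate) : List Gate := (C.map Gate.inv).reverse

theorem circ_invCircuit (C : List Gate) (ψ : QState) : circ (invCircuit C) (circ C ψ) = ψ := by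
  induction C generalizing ψ with
  | nil => rfl
  | cons g C ih =>
    rw [circ_cons, invCircuit, List.map_cons, List.reverse_cons, circ_append]
    change circ [g.inv] (circ (invCircuit C) (circ C (g.apply ψ))) = ψ
    rw [ih]
    exact Gate.inv_apply_apply g ψ

/-- The action of a classical circuit on basis states. -/
def actCircuit : List Gate → Mem → Mem
  | [], m => m
  | g :: C, m => actCircuit C (g.act m)

@[simp] theorem actCircuit_nil (m : Mem) : actCircuit [] m = m := rfl

theorem actCircuit_cons (g : Gate) (C : List Gate) (m : Mem) :
    actCircuit (g :: C) m = actCircuit C (g.act m) := rfl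

theorem actCircuit_append (C D : List Gate) (m : Mem) :
    actCircuit (C ++ D) m = actCircuit D (actCircuit C m) := by
  induction C generalizing m with
  | nil => rfl
  | cons g C ih => exact ih _

def ClassicalCircuit (C : List Gate) : Prop := ∀ g ∈ C, g.IsClassical

theorem circ_single {C : List Gate} (hC : ClassicalCircuit C) (m : Mem) (z : ℂ) :
    circ C (Finsupp.single m z) = Finsupp.single (actCircuit C m) z := by
  induction C generalizing m with
  | nil => rfl
  | cons g C ih =>
    rw [circ_cons, Gate.apply_single, (hC g (by simp)).onBasis, Finsupp.smul_single, smul_eq_mul,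
      mul_one, ih (fun g hg => hC g (by simp [hg]))]
    rfl

theorem circ_inv_single {C : List Gate} (hC : ClassicalCircuit C) (m : Mem) (z : ℂ) :
    circ (invCircuit C) (Finsupp.single (actCircuit C m) z) = Finsupp.single m z := by
  rw [← circ_single hC, circ_invCircuit]

/-- Distinct branches of a superposition stay distinct under a classical circuit, so their
amplitudes do not interfere and probabilities can be summed branch by branch. -/
theorem actCircuit_injective {C : List Gate} (hC : ClassicalCircuit C) :
    Function.Injective (actCircuit C) := by
  intro m m' h
  have h1 := circ_inv_single hC m 1
  rw [h, circ_inv_single hC m' 1] at h1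
  exact ((Finsupp.single_eq_single_iff _ _ _ _).1 h1.symm).elim (fun h => h.1)
    (fun h => absurd h.1 one_ne_zero)

theorem classicalCircuit_append {C D : List Gate} :
    ClassicalCircuit (C ++ D) ↔ ClassicalCircuit C ∧ ClassicalCircuit D := by
  simp only [ClassicalCircuit, List.mem_append]
  exact ⟨fun h => ⟨fun g hg => h g (.inl hg), fun g hg => h g (.inr hg)⟩,
    fun h g hg => hg.elim (h.1 g) (h.2 g)⟩

theorem ClassicalCircuit.inv {C : List Gate} (hC : ClassicalCircuit C) :
    ClassicalCircuit (invCircuit C) := by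
  intro g hg
  simp only [invCircuit, List.mem_reverse, List.mem_map] at hg
  obtain ⟨g', h, rfl⟩ := hg
  exact (hC g' h).inv

theorem actCircuit_invCircuit {C : List Gate} (hC : ClassicalCircuit C) (m : Mem) :
    actCircuit (invCircuit C) (actCircuit C m) = m := by
  have h := circ_inv_single hC m 1
  rw [circ_single hC.inv] at h
  exact ((Finsupp.single_eq_single_iff _ _ _ _).1 h).elim (fun h => h.1)
    (fun h => absurd h.1 one_ne_zero)

/-! ## Norms and probabilities -/

/-- The square of the norm of a superposition. -/
noncomputable def nsq (ψ : QState) : ℝ := ψ.sum fun _ z => ‖z‖ ^ 2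

/-- The inner product of superpositions. -/
noncomputable def ip (ψ φ : QState) : ℂ := ψ.sum fun m z => (starRingEnd ℂ) z * φ m

theorem ip_self (ψ : QState) : ip ψ ψ = (nsq ψ : ℂ) := by
  simp only [ip, nsq, Finsupp.sum]
  push_cast
  refine Finset.sum_congr rfl fun m _ => ?_
  rw [mul_comm, Complex.mul_conj, Complex.normSq_eq_norm_sq]; norm_cast

theorem ip_add_left (ψ ψ' φ : QState) : ip (ψ + ψ') φ = ip ψ φ + ip ψ' φ := by
  refine Finsupp.sum_add_index' (by simp) fun m a b => by simp [add_mul]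

theorem ip_add_right (ψ φ φ' : QState) : ip ψ (φ + φ') = ip ψ φ + ip ψ φ' := by
  simp [ip, mul_add]

theorem ip_single (m : Mem) (z : ℂ) (φ : QState) :
    ip (Finsupp.single m z) φ = (starRingEnd ℂ) z * φ m := by
  simp [ip]

/-- Since the inverse of a gate is also its adjoint, gates are unitary; preservation of norms
follows. -/
theorem ip_gate (g : Gate) (ψ φ : QState) : ip (g.apply ψ) φ = ip ψ (g.inv.apply φ) := by
  classical
  induction ψ using Finsupp.induction_linear with
  | zero => simp [ip]
  | add f f' h h' => rw [map_add, ip_add_left, ip_add_left, h, h']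
  | single m z =>
    induction φ using Finsupp.induction_linear with
    | zero => simp [ip]
    | add f f' h h' => rw [map_add, ip_add_right, ip_add_right, h, h']
    | single m' w =>
      rw [ip_single, Gate.apply_single, Gate.apply_single, Finsupp.smul_apply,
        Gate.inv_onBasis_apply]
      simp only [ip, smul_eq_mul]
      rw [Finsupp.sum_smul_index (by simp)]
      simp only [Finsupp.sum, Finsupp.single_apply, map_mul]
      rw [Finset.sum_eq_single m']
      · simp; ring
      · intro b _ hb; simp [hb.symm]
      · intro h; simp [Finsupp.notMem_support_iff.1 h]

theorem nsq_gate (g : Gate) (ψ : QState) : nsq (g.apply ψ) = nsq ψ := by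
  have := ip_self (g.apply ψ)
  rw [ip_gate, Gate.inv_apply_apply, ip_self] at this
  exact_mod_cast this.symm

theorem nsq_circ (C : List Gate) (ψ : QState) : nsq (circ C ψ) = nsq ψ := by
  induction C generalizing ψ with
  | nil => rfl
  | cons g C ih => rw [circ_cons, ih, nsq_gate]

theorem nsq_single (m : Mem) (z : ℂ) : nsq (Finsupp.single m z) = ‖z‖ ^ 2 := by
  simp [nsq]

theorem nsq_eq_sum (ψ : QState) {s : Finset Mem} (hs : ψ.support ⊆ s) :
    nsq ψ = ∑ m ∈ s, ‖ψ m‖ ^ 2 :=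
  Finsupp.sum_of_support_subset _ hs _ (by simp)

theorem nsq_nonneg (ψ : QState) : 0 ≤ nsq ψ := Finset.sum_nonneg fun _ _ => by positivity

theorem norm_sq_le_nsq (ψ : QState) (m : Mem) : ‖ψ m‖ ^ 2 ≤ nsq ψ := by
  classical
  rw [nsq_eq_sum ψ (Finset.subset_insert m _)]
  exact Finset.single_le_sum (f := fun m => ‖ψ m‖ ^ 2) (fun _ _ => by positivity)
    (Finset.mem_insert_self _ _)

/-- The triangle inequality k √δ + √δ = (k + 1) √δ, in squared form for use in an induction on `k`.
-/
theorem nsq_add_le {ψ φ : QState} {k : ℕ} {δ : ℝ} (h₁ : nsq ψ ≤ k ^ 2 * δ) (h₂ : nsq φ ≤ δ) :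
    nsq (ψ + φ) ≤ ((k + 1 : ℕ) : ℝ) ^ 2 * δ := by
  classical
  rcases Nat.eq_zero_or_pos k with rfl | hk
  · have h0 : nsq ψ = 0 := le_antisymm (by simpa using h₁) (nsq_nonneg _)
    have : ψ = 0 := by
      ext m
      have := norm_sq_le_nsq ψ m
      rw [h0] at this
      simpa using le_antisymm this (by positivity)
    simpa [this] using h₂
  set s := ψ.support ∪ φ.support
  have hk' : (0 : ℝ) < k := by exact_mod_cast hk
  rw [nsq_eq_sum ψ (Finset.subset_union_left (s₂ := φ.support))] at h₁
  rw [nsq_eq_sum φ (Finset.subset_union_right (s₁ := ψ.support))] at h₂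
  rw [nsq_eq_sum (ψ + φ) (Finsupp.support_add)]
  -- The mixed term is split with weight `k`, the ratio of the two bounds on the norms, so nothing
  -- is lost after summation. The weight is the reason why `k = 0` was treated separately.
  have : ∀ m, ‖(ψ + φ) m‖ ^ 2 ≤ (1 + 1 / (k:ℝ)) * ‖ψ m‖ ^ 2 + (k + 1) * ‖φ m‖ ^ 2 := by
    intro m
    have h := norm_add_le (ψ m) (φ m)
    have h3 : ‖(ψ + φ) m‖ ^ 2 ≤ (‖ψ m‖ + ‖φ m‖) ^ 2 := by
      rw [Finsupp.add_apply]; gcongr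
    refine h3.trans ?_
    have : (1 + 1 / (k:ℝ)) * ‖ψ m‖ ^ 2 + (k + 1) * ‖φ m‖ ^ 2 - (‖ψ m‖ + ‖φ m‖) ^ 2 =
        (‖ψ m‖ - k * ‖φ m‖) ^ 2 / k := by field_simp; ring
    have : 0 ≤ (‖ψ m‖ - k * ‖φ m‖) ^ 2 / k := by positivity
    linarith
  calc _ ≤ ∑ m ∈ s, ((1 + 1 / (k:ℝ)) * ‖ψ m‖ ^ 2 + (k + 1) * ‖φ m‖ ^ 2) :=
        Finset.sum_le_sum fun m _ => this m
    _ = (1 + 1 / (k:ℝ)) * ∑ m ∈ s, ‖ψ m‖ ^ 2 + (k + 1) * ∑ m ∈ s, ‖φ m‖ ^ 2 := by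
        rw [Finset.sum_add_distrib, Finset.mul_sum, Finset.mul_sum]
    _ ≤ (1 + 1 / (k:ℝ)) * (k ^ 2 * δ) + (k + 1) * δ := by gcongr
    _ = _ := by push_cast; field_simp

/-- Pythagoras: by injectivity the summands are orthogonal. -/
theorem nsq_sum_single {ι : Type*} (s : Finset ι) (f : ι → Mem) (c : ι → ℂ)
    (hf : Set.InjOn f s) :
    nsq (∑ i ∈ s, Finsupp.single (f i) (c i)) = ∑ i ∈ s, ‖c i‖ ^ 2 := by
  classical
  have hval : ∀ i ∈ s, (∑ j ∈ s, Finsupp.single (f j) (c j)) (f i) = c i := by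
    intro i hi
    rw [Finsupp.finsetSum_apply, Finset.sum_eq_single i]
    · simp
    · intro j hj hji
      rw [Finsupp.single_apply, if_neg (fun e => hji (hf hj hi e))]
    · exact fun h => (h hi).elim
  rw [nsq_eq_sum _ (s := s.image f), Finset.sum_image hf]
  · exact Finset.sum_congr rfl fun i hi => by rw [hval i hi]
  · refine Finsupp.support_finsetSum.trans ?_
    intro m hm
    simp only [Finset.mem_biUnion] at hm
    obtain ⟨i, hi, hm⟩ := hm
    have := Finsupp.support_single_subset hm
    simp only [Finset.mem_singleton] at this
    exact Finset.mem_image.2 ⟨i, hi, this.symm⟩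

open Classical in
theorem prob_eq_sum (ψ : QState) (S : Set Mem) {s : Finset Mem} (hs : ψ.support ⊆ s) :
    prob ψ S = ∑ m ∈ s, if m ∈ S then ‖ψ m‖ ^ 2 else 0 := by
  refine Finset.sum_subset hs fun m _ hm => ?_
  rw [Finsupp.notMem_support_iff.1 hm]; simp

theorem prob_add_prob_compl (ψ : QState) (S : Set Mem) : prob ψ S + prob ψ Sᶜ = nsq ψ := by
  classical
  rw [prob, prob, nsq, Finsupp.sum, ← Finset.sum_add_distrib]
  refine Finset.sum_congr rfl fun m _ => ?_
  by_cases h : m ∈ S <;> simp [h]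

theorem prob_nonneg (ψ : QState) (S : Set Mem) : 0 ≤ prob ψ S := by
  classical
  exact Finset.sum_nonneg fun m _ => by split_ifs <;> positivity

theorem prob_single {m : Mem} {S : Set Mem} (h : m ∈ S) : prob (Finsupp.single m 1) S = 1 := by
  classical
  rw [prob_eq_sum _ _ Finsupp.support_single_subset]
  simp [h]

theorem norm_sq_le_prob (ψ : QState) {S : Set Mem} {m : Mem} (h : m ∈ S) :
    ‖ψ m‖ ^ 2 ≤ prob ψ S := by
  classical
  rw [prob_eq_sum ψ S (Finset.subset_insert m _)]
  have := Finset.single_le_sum (f := fun m => if m ∈ S then ‖ψ m‖ ^ 2 else 0)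
    (fun m _ => by split_ifs <;> positivity) (Finset.mem_insert_self m ψ.support)
  simpa [h] using this

open Classical in
theorem prob_sum_single {ι : Type*} (s : Finset ι) (f : ι → Mem) (c : ι → ℂ)
    (hf : Set.InjOn f s) (S : Set Mem) :
    prob (∑ i ∈ s, Finsupp.single (f i) (c i)) S = ∑ i ∈ s, if f i ∈ S then ‖c i‖ ^ 2 else 0 := by
  classical
  have hval : ∀ i ∈ s, (∑ j ∈ s, Finsupp.single (f j) (c j)) (f i) = c i := by
    intro i hi
    rw [Finsupp.finsetSum_apply, Finset.sum_eq_single i]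
    · simp
    · intro j hj hji
      rw [Finsupp.single_apply, if_neg (fun e => hji (hf hj hi e))]
    · exact fun h => (h hi).elim
  rw [prob_eq_sum _ S (s := s.image f), Finset.sum_image hf]
  · exact Finset.sum_congr rfl fun i hi => by rw [hval i hi]
  · refine Finsupp.support_finsetSum.trans ?_
    intro m hm
    simp only [Finset.mem_biUnion] at hm
    obtain ⟨i, hi, hm⟩ := hm
    have := Finsupp.support_single_subset hm
    simp only [Finset.mem_singleton] at this
    exact Finset.mem_image.2 ⟨i, hi, this.symm⟩

/-- A state close to a basis state is measured accordingly. -/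
theorem le_prob_of_close {ψ : QState} {m : Mem} {S : Set Mem} (hm : m ∈ S) {δ : ℝ}
    (hδ : δ ≤ 1) (h0 : 0 ≤ δ) (h : nsq (ψ - Finsupp.single m 1) ≤ δ ^ 2) : (1 - δ) ^ 2 ≤ prob ψ S := by
  refine le_trans ?_ (norm_sq_le_prob ψ hm)
  have h1 := (norm_sq_le_nsq (ψ - Finsupp.single m 1) m).trans h
  rw [Finsupp.sub_apply, Finsupp.single_eq_same] at h1
  have h2 : ‖ψ m - 1‖ ≤ δ := by
    exact (sq_le_sq₀ (norm_nonneg _) h0).1 h1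
  have h3 : 1 - δ ≤ ‖ψ m‖ := by
    have := norm_sub_norm_le (1 : ℂ) (ψ m)
    rw [norm_one, norm_sub_rev] at this
    linarith
  have : 0 ≤ 1 - δ := by linarith
  gcongr


/-! ## Renaming the arrays of a program -/

/-- Replace array `a` by array `a + k`. -/
def Expr.shift (k : ℕ) : Expr → Expr
  | .lit v => .lit v
  | .read a i => .read (a + k) (i.shift k)
  | .add x y => .add (x.shift k) (y.shift k)
  | .sub x y => .sub (x.shift k) (y.shift k)
  | .mul x y => .mul (x.shift k) (y.shift k)
  | .div x y => .div (x.shift k) (y.shift k)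

/-- Replace array `a` by array `a + k`. -/
def Com.shift (k : ℕ) : Com → Com
  | .skip => .skip
  | .assign a i e => .assign (a + k) (i.shift k) (e.shift k)
  | .seq c₁ c₂ => .seq (c₁.shift k) (c₂.shift k)
  | .cond e c₁ c₂ => .cond (e.shift k) (c₁.shift k) (c₂.shift k)
  | .loop e c => .loop (e.shift k) (c.shift k)

/-- The arrays of `h` below `k`, followed by the arrays of `σ`. -/
def overlay (k : ℕ) (h σ : Store) : Store := fun a => if a < k then h a else σ (a - k)

theorem overlay_add (k : ℕ) (h σ : Store) (a : ℕ) : overlay k h σ (a + k) = σ a := by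
  simp [overlay]

theorem overlay_of_lt {k a : ℕ} (h σ : Store) (ha : a < k) : overlay k h σ a = h a := by
  simp [overlay, ha]

theorem Expr.eval_shift (k : ℕ) (h σ : Store) (e : Expr) :
    (e.shift k).eval (overlay k h σ) = e.eval σ := by
  induction e <;> simp_all [Expr.shift, Expr.eval, overlay_add]

theorem overlay_write (k : ℕ) (h σ : Store) (a i v : ℕ) :
    (overlay k h σ).write (a + k) i v = overlay k h (σ.write a i v) := by
  funext b
  by_cases hb : b < k
  · rw [overlay_of_lt _ _ hb, Store.write, Function.update_of_ne (by omega), overlay_of_lt _ _ hb]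
  · obtain ⟨c, rfl⟩ : ∃ c, b = c + k := ⟨b - k, by omega⟩
    rw [overlay_add, Store.write, Store.write, overlay_add]
    by_cases hc : c = a
    · subst hc; simp
    · rw [Function.update_of_ne (by omega), Function.update_of_ne hc, overlay_add]

/-- This lets the program that writes the subroutine run inside a larger program without disturbing
the low arrays of the latter. -/
theorem Exec.shift {B : ℕ} {c : Com} {σ τ : Store} {t : ℕ} (he : Exec B c σ t τ) (k : ℕ)
    (h : Store) : Exec B (c.shift k) (overlay k h σ) t (overlay k h τ) := by
  induction he with
  | skip σ => exact .skip _
  | assign σ a i e hi he =>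
    have := Exec.assign (B := B) (overlay k h σ) (a + k) (i.shift k) (e.shift k)
      (by rwa [Expr.eval_shift]) (by rwa [Expr.eval_shift])
    rwa [Expr.eval_shift, Expr.eval_shift, overlay_write] at this
  | seq _ _ ih₁ ih₂ => exact .seq ih₁ ih₂
  | condTrue he _ ih => exact .condTrue (by rwa [Expr.eval_shift]) ih
  | condFalse he _ ih => exact .condFalse (by rwa [Expr.eval_shift]) ih
  | loopStop he => exact .loopStop (by rwa [Expr.eval_shift])
  | loopStep he _ _ ih₁ ih₂ => exact .loopStep (by rwa [Expr.eval_shift]) ih₁ ih₂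

theorem Exec.congr {B : ℕ} {c : Com} {σ τ : Store} {t t' : ℕ} (he : Exec B c σ t τ)
    (h : t = t') : Exec B c σ t' τ := h ▸ he

theorem Exec.mono {B B' : ℕ} (hB : B ≤ B') {c : Com} {σ τ : Store} {t : ℕ}
    (he : Exec B c σ t τ) : Exec B' c σ t τ := by
  induction he with
  | skip σ => exact .skip _
  | assign σ a i e hi he => exact .assign _ _ _ _ (hi.trans hB) (he.trans hB)
  | seq _ _ ih₁ ih₂ => exact .seq ih₁ ih₂
  | condTrue he _ ih => exact .condTrue he ih
  | condFalse he _ ih => exact .condFalse he ih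
  | loopStop he => exact .loopStop he
  | loopStep he _ _ ih₁ ih₂ => exact .loopStep he ih₁ ih₂

theorem Store.write_apply (σ : Store) (a i v b j : ℕ) :
    σ.write a i v b j = if b = a ∧ j = i then v else σ b j := by
  unfold Store.write
  by_cases hb : b = a
  · subst hb
    by_cases hj : j = i
    · subst hj; simp
    · simp [hj]
  · simp [hb]

/-- Every final word is either an initial word or was written during the run. In particular, the
parameters of a written circuit are bounded. -/
theorem Exec.le_bound {B B' : ℕ} (hB : B ≤ B') {c : Com} {σ τ : Store} {t : ℕ}
    (he : Exec B c σ t τ) (hσ : ∀ a i, σ a i ≤ B') : ∀ a i, τ a i ≤ B' := by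
  induction he with
  | skip σ => exact hσ
  | assign σ a i e hi he =>
    intro b j
    rw [Store.write_apply]
    split_ifs
    · exact he.trans hB
    · exact hσ _ _
  | seq _ _ ih₁ ih₂ => exact ih₂ (ih₁ hσ)
  | condTrue he _ ih => exact ih hσ
  | condFalse he _ ih => exact ih hσ
  | loopStop he => exact hσ
  | loopStep he _ _ ih₁ ih₂ => exact ih₂ (ih₁ hσ)

/-! ## A language for programs that write circuits -/

/-- The five words that describe a gate. -/
structure RawGate where
  op : ℕ
  d : ℕ
  N : ℕ
  x : ℕ
  y : ℕ

def RawGate.gate (r : RawGate) : Gate := Gate.decode r.op r.d r.N r.x r.y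

def invOp (op : ℕ) : ℕ :=
  if op < 6 then op + 6 else if op < 12 then op - 6 else
  if op = 14 then 15 else if op = 15 then 14 else op

def RawGate.inv (r : RawGate) : RawGate := { r with op := invOp r.op }

theorem decode_of_lt {op : ℕ} (h : 15 < op) (d N x y : ℕ) : Gate.decode op d N x y = .idle := by
  unfold Gate.decode
  split <;> first | omega | rfl

theorem RawGate.gate_inv (r : RawGate) : r.inv.gate = r.gate.inv := by
  obtain ⟨op, d, N, x, y⟩ := r
  by_cases h : op < 16
  · interval_cases op <;> rfl
  · have h1 : invOp op = op := by unfold invOp; split_ifs <;> omega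
    simp only [RawGate.gate, RawGate.inv, h1]
    rw [decode_of_lt (by omega)]; rfl

/-- Word expressions of a writing program: `var i` is a variable, and `hi a i` is a word of the
arrays that are only read. -/
inductive WExpr : Type
  | lit (k : ℕ)
  | var (i : ℕ)
  | hi (a : ℕ) (i : WExpr)
  | add (x y : WExpr)
  | sub (x y : WExpr)
  | mul (x y : WExpr)
  | div (x y : WExpr)

def WExpr.eval (h : Store) (v : ℕ → ℕ) : WExpr → ℕ
  | .lit k => k
  | .var i => v i
  | .hi a i => h a (i.eval h v)
  | .add x y => x.eval h v + y.eval h v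
  | .sub x y => x.eval h v - y.eval h v
  | .mul x y => x.eval h v * y.eval h v
  | .div x y => x.eval h v / y.eval h v

/-- Writing programs: `loop e p` runs `p` for the values `0, …, e - 1` of a new variable,
`bind e p` introduces a variable of value `e`, `bits e p` introduces the number `k` of bits of
`e` and the number `2 ^ k`, and `conj p q` writes what `p` writes, what `q` writes, and the
inverse of what `p` writes. -/
inductive Writer : Type
  | nop
  | emit (op d N x y : WExpr)
  | seq (p q : Writer)
  | loop (e : WExpr) (p : Writer)
  | bind (e : WExpr) (p : Writer)
  | bits (e : WExpr) (p : Writer)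
  | ite (e : WExpr) (p q : Writer)
  | conj (p q : Writer)

/-- The gates that are written when `d` variables, with values `v`, are in use. -/
def Writer.run (h : Store) : ℕ → (ℕ → ℕ) → Writer → List RawGate
  | _, _, .nop => []
  | _, v, .emit op t N x y =>
      [⟨op.eval h v, t.eval h v, N.eval h v, x.eval h v, y.eval h v⟩]
  | d, v, .seq p q => p.run h d v ++ q.run h d v
  | d, v, .loop e p =>
      (List.range (e.eval h v)).flatMap fun i => p.run h (d + 1) (Function.update v d i)
  | d, v, .bind e p => p.run h (d + 1) (Function.update v d (e.eval h v))
  | d, v, .bits e p => p.run h (d + 2)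
      (Function.update (Function.update v d (e.eval h v).size) (d + 1) (2 ^ (e.eval h v).size))
  | d, v, .ite e p q => if e.eval h v ≠ 0 then p.run h d v else q.run h d v
  | d, v, .conj p q => p.run h d v ++ q.run h d v ++ ((p.run h d v).map RawGate.inv).reverse

/-- The number of steps of a writing program. -/
def Writer.cost (h : Store) : ℕ → (ℕ → ℕ) → Writer → ℕ
  | _, _, .nop => 1
  | _, _, .emit _ _ _ _ _ => 6
  | d, v, .seq p q => p.cost h d v + q.cost h d v
  | d, v, .loop e p =>
      2 + ∑ i ∈ Finset.range (e.eval h v), (p.cost h (d + 1) (Function.update v d i) + 2)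
  | d, v, .bind e p => 1 + p.cost h (d + 1) (Function.update v d (e.eval h v))
  | d, v, .bits e p => 3 + 3 * (e.eval h v).size + p.cost h (d + 2)
      (Function.update (Function.update v d (e.eval h v).size) (d + 1) (2 ^ (e.eval h v).size))
  | d, v, .ite e p q => (if e.eval h v ≠ 0 then p.cost h d v else q.cost h d v) + 1
  | d, v, .conj p q => p.cost h d v + q.cost h d v + 8 * (p.run h d v).length + 4

/-- All words that occur are at most `B`. -/
def Writer.Bounded (B : ℕ) (h : Store) : ℕ → ℕ → (ℕ → ℕ) → Writer → Prop
  | _, _, _, .nop => True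
  | _, _, v, .emit op t N x y =>
      op.eval h v ≤ B ∧ t.eval h v ≤ B ∧ N.eval h v ≤ B ∧ x.eval h v ≤ B ∧ y.eval h v ≤ B
  | d, r, v, .seq p q => p.Bounded B h d r v ∧ q.Bounded B h d r v
  | d, r, v, .loop e p => d ≤ B ∧ e.eval h v ≤ B ∧
      ∀ i < e.eval h v, p.Bounded B h (d + 1) r (Function.update v d i)
  | d, r, v, .bind e p => d ≤ B ∧ e.eval h v ≤ B ∧
      p.Bounded B h (d + 1) r (Function.update v d (e.eval h v))
  | d, r, v, .bits e p => d + 1 ≤ B ∧ 2 ^ (e.eval h v).size ≤ B ∧ p.Bounded B h (d + 2) r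
      (Function.update (Function.update v d (e.eval h v).size) (d + 1) (2 ^ (e.eval h v).size))
  | d, r, v, .ite e p q => (e.eval h v ≠ 0 → p.Bounded B h d r v) ∧
      (e.eval h v = 0 → q.Bounded B h d r v)
  | d, r, v, .conj p q => 3 * r + 2 ≤ B ∧ p.Bounded B h d (r + 1) v ∧ q.Bounded B h d (r + 1) v

/-! ### Translation to the random-access machine -/

/-- Arrays `0` to `5` are for the circuit that is being written, array `6` is for the variables,
array `7` for the bookkeeping of `conj`, and the arrays that are only read start at `8`. Variables
that are not in use have the value zero. -/
def WExpr.toExpr (d : ℕ) : WExpr → Expr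
  | .lit k => .lit k
  | .var i => if i < d then .read 6 (.lit i) else .lit 0
  | .hi a i => .read (a + 8) (i.toExpr d)
  | .add x y => .add (x.toExpr d) (y.toExpr d)
  | .sub x y => .sub (x.toExpr d) (y.toExpr d)
  | .mul x y => .mul (x.toExpr d) (y.toExpr d)
  | .div x y => .div (x.toExpr d) (y.toExpr d)

/-- A conditional expression. -/
def Expr.ite (c x y : Expr) : Expr :=
  .add (.mul (.sub (.lit 1) (.sub (.lit 1) c)) x) (.mul (.sub (.lit 1) c) y)

theorem Expr.eval_ite (σ : Store) (c x y : Expr) :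
    (Expr.ite c x y).eval σ = if c.eval σ ≠ 0 then x.eval σ else y.eval σ := by
  simp only [Expr.ite, Expr.eval]
  rcases Nat.eq_zero_or_pos (c.eval σ) with h | h
  · simp [h]
  · have h1 : 1 - c.eval σ = 0 := by omega
    rw [if_pos (by omega), h1]; simp

def invOpExpr (e : Expr) : Expr :=
  .ite (.sub (.lit 6) e) (.add e (.lit 6)) (.ite (.sub (.lit 12) e) (.sub e (.lit 6))
    (.ite (.add (.sub (.lit 14) e) (.sub e (.lit 14)))
      (.ite (.add (.sub (.lit 15) e) (.sub e (.lit 15))) e (.lit 14)) (.lit 15)))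

theorem eval_invOpExpr (σ : Store) (e : Expr) : (invOpExpr e).eval σ = invOp (e.eval σ) := by
  unfold invOpExpr invOp
  rw [Expr.eval_ite]
  by_cases h1 : e.eval σ < 6
  · rw [if_pos (by simp only [Expr.eval]; omega), if_pos h1]; rfl
  rw [if_neg (by simp only [Expr.eval]; omega), if_neg h1, Expr.eval_ite]
  by_cases h2 : e.eval σ < 12
  · rw [if_pos (by simp only [Expr.eval]; omega), if_pos h2]; rfl
  rw [if_neg (by simp only [Expr.eval]; omega), if_neg h2, Expr.eval_ite]
  by_cases h3 : e.eval σ = 14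
  · rw [if_neg (by simp only [Expr.eval]; omega), if_pos h3]; rfl
  rw [if_pos (by simp only [Expr.eval]; omega), if_neg h3, Expr.eval_ite]
  by_cases h4 : e.eval σ = 15
  · rw [if_neg (by simp only [Expr.eval]; omega), if_pos h4]; rfl
  · rw [if_pos (by simp only [Expr.eval]; omega), if_neg h4]

def counter : Expr := .read 0 (.lit 0)

/-- The counter is increased last, so all five words go to the same index. -/
def emitCom (op d N x y : Expr) : Com :=
  .seq (.assign 1 counter op) (.seq (.assign 2 counter d) (.seq (.assign 3 counter N)
    (.seq (.assign 4 counter x) (.seq (.assign 5 counter y)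
      (.assign 0 (.lit 0) (.add counter (.lit 1)))))))

/-- A variable is addressed by the number `d` of variables in use when it is introduced, and `r` is
the nesting depth of `conj`. For each depth, three words record where the gates of `p` start, where
they end, and how many of them have been undone. The inverse is obtained by rereading the gates that
`p` has written from last to first; `p` is not run again. -/
def Writer.toCom : ℕ → ℕ → Writer → Com
  | _, _, .nop => .skip
  | d, _, .emit op t N x y =>
      emitCom (op.toExpr d) (t.toExpr d) (N.toExpr d) (x.toExpr d) (y.toExpr d)
  | d, r, .seq p q => .seq (p.toCom d r) (q.toCom d r)
  | d, r, .loop e p => .seq (.assign 6 (.lit d) (.lit 0))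
      (.loop (.sub (e.toExpr d) (.read 6 (.lit d)))
        (.seq (p.toCom (d + 1) r) (.assign 6 (.lit d) (.add (.read 6 (.lit d)) (.lit 1)))))
  | d, r, .bind e p => .seq (.assign 6 (.lit d) (e.toExpr d)) (p.toCom (d + 1) r)
  | d, r, .bits e p => .seq (.assign 6 (.lit d) (.lit 0)) (.seq (.assign 6 (.lit (d + 1)) (.lit 1))
      (.seq (.loop (.div (e.toExpr d) (.read 6 (.lit (d + 1))))
        (.seq (.assign 6 (.lit (d + 1)) (.mul (.lit 2) (.read 6 (.lit (d + 1)))))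
          (.assign 6 (.lit d) (.add (.read 6 (.lit d)) (.lit 1)))))
        (p.toCom (d + 2) r)))
  | d, r, .ite e p q => .cond (e.toExpr d) (p.toCom d r) (q.toCom d r)
  | d, r, .conj p q =>
      let start : Expr := .read 7 (.lit (3 * r))
      let last : Expr := .read 7 (.lit (3 * r + 1))
      let i : Expr := .read 7 (.lit (3 * r + 2))
      let j : Expr := .sub (.sub last (.lit 1)) i
      .seq (.assign 7 (.lit (3 * r)) counter) (.seq (p.toCom d (r + 1))
        (.seq (.assign 7 (.lit (3 * r + 1)) counter) (.seq (q.toCom d (r + 1))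
          (.seq (.assign 7 (.lit (3 * r + 2)) (.lit 0))
            (.loop (.sub (.sub last start) i)
              (.seq (emitCom (invOpExpr (.read 1 j)) (.read 2 j) (.read 3 j) (.read 4 j)
                (.read 5 j)) (.assign 7 (.lit (3 * r + 2)) (.add i (.lit 1)))))))))

/-- The store `σ` holds the gates `gs`, `d` variables, `r` triples of bookkeeping words, and the
arrays `h`. -/
structure Holds (h : Store) (d r : ℕ) (v s : ℕ → ℕ) (gs : List RawGate) (σ : Store) : Prop where
  count : σ 0 0 = gs.length
  gate : ∀ i g, gs[i]? = some g →
    σ 1 i = g.op ∧ σ 2 i = g.d ∧ σ 3 i = g.N ∧ σ 4 i = g.x ∧ σ 5 i = g.y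
  var : ∀ i < d, σ 6 i = v i
  stack : ∀ i < 3 * r, σ 7 i = s i
  high : ∀ a, σ (a + 8) = h a

theorem Holds.circuitOf {h : Store} {d r : ℕ} {v s : ℕ → ℕ} {gs : List RawGate} {σ : Store}
    (H : Holds h d r v s gs σ) : circuitOf σ = gs.map RawGate.gate := by
  rw [QRAM.circuitOf, H.count]
  apply List.ext_getElem
  · simp
  · intro i h1 h2
    simp only [List.getElem_map, List.getElem_range]
    have hi : i < gs.length := by simpa using h2
    obtain ⟨e1, e2, e3, e4, e5⟩ := H.gate i gs[i] (by simp [hi])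
    rw [e1, e2, e3, e4, e5]; rfl

theorem Holds.eval {h : Store} {d r : ℕ} {v s : ℕ → ℕ} {gs : List RawGate} {σ : Store}
    (H : Holds h d r v s gs σ) (hv : ∀ i ≥ d, v i = 0) (e : WExpr) :
    (e.toExpr d).eval σ = e.eval h v := by
  induction e with
  | var i =>
    simp only [WExpr.toExpr, WExpr.eval]
    split_ifs with hi
    · exact H.var i hi
    · exact (hv i (by omega)).symm
  | hi a i ih => simp only [WExpr.toExpr, WExpr.eval, Expr.eval, ih, H.high]
  | lit k => rfl
  | _ => simp_all [WExpr.toExpr, WExpr.eval, Expr.eval]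

/-- The five expressions are evaluated while the new gate is only partly written. Hence their values
must be known in every store that differs from `σ` only at the index of the new gate in the arrays
`1` to `5`. -/
theorem Holds.emit {h : Store} {d r : ℕ} {v s : ℕ → ℕ} {gs : List RawGate} {σ : Store}
    (H : Holds h d r v s gs σ) {B : ℕ} {op t N x y : Expr} {g : RawGate}
    (he : ∀ σ' : Store, (∀ a i, i ≠ σ 0 0 ∨ a = 0 ∨ 5 < a → σ' a i = σ a i) →
      op.eval σ' = g.op ∧ t.eval σ' = g.d ∧ N.eval σ' = g.N ∧ x.eval σ' = g.x ∧ y.eval σ' = g.y)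
    (hg : g.op ≤ B ∧ g.d ≤ B ∧ g.N ≤ B ∧ g.x ≤ B ∧ g.y ≤ B) (hB : gs.length + 1 ≤ B) :
    ∃ τ, Exec B (emitCom op t N x y) σ 6 τ ∧ Holds h d r v s (gs ++ [g]) τ ∧
      ∀ a > 5, τ a = σ a := by
  have hc : ∀ σ' : Store, (∀ a i, i ≠ σ 0 0 ∨ a = 0 ∨ 5 < a → σ' a i = σ a i) →
      counter.eval σ' = gs.length := by
    intro σ' h'
    simp only [counter, Expr.eval]
    rw [h' 0 0 (by simp), H.count]
  have step : ∀ (σ' : Store), (∀ a i, i ≠ σ 0 0 ∨ a = 0 ∨ 5 < a → σ' a i = σ a i) →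
      ∀ (a : ℕ) (e : Expr) (w : ℕ), e.eval σ' = w → w ≤ B → 0 < a → a ≤ 5 →
      Exec B (.assign a counter e) σ' 1 (σ'.write a gs.length w) ∧
      (∀ b i, i ≠ σ 0 0 ∨ b = 0 ∨ 5 < b → σ'.write a gs.length w b i = σ b i) := by
    intro σ' h' a e w hw hwB ha ha'
    constructor
    · have := Exec.assign (B := B) σ' a counter e (by rw [hc σ' h']; omega) (by rw [hw]; exact hwB)
      rwa [hc σ' h', hw] at this
    · intro b i hbi
      rw [Store.write_apply, if_neg, h' b i hbi]
      rintro ⟨rfl, rfl⟩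
      rw [H.count] at hbi
      omega
  obtain ⟨g1, g2, g3, g4, g5⟩ := hg
  obtain ⟨x1, r1⟩ := step σ (fun _ _ _ => rfl) 1 op g.op
    (he _ fun _ _ _ => rfl).1 g1 (by norm_num) (by norm_num)
  obtain ⟨x2, r2⟩ := step _ r1 2 t g.d (he _ r1).2.1 g2 (by norm_num) (by norm_num)
  obtain ⟨x3, r3⟩ := step _ r2 3 N g.N (he _ r2).2.2.1 g3 (by norm_num) (by norm_num)
  obtain ⟨x4, r4⟩ := step _ r3 4 x g.x (he _ r3).2.2.2.1 g4 (by norm_num) (by norm_num)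
  obtain ⟨x5, r5⟩ := step _ r4 5 y g.y (he _ r4).2.2.2.2 g5 (by norm_num) (by norm_num)
  have x6 := Exec.assign (B := B) _ 0 (.lit 0) (.add counter (.lit 1)) (Nat.zero_le B)
    (by simp only [Expr.eval]; rw [hc _ r5]; exact hB)
  refine ⟨_, .seq x1 (.seq x2 (.seq x3 (.seq x4 (.seq x5 x6)))), ?_⟩
  simp only [Expr.eval]
  rw [hc _ r5]
  refine ⟨⟨by simp [Store.write_apply], ?_, ?_, ?_, ?_⟩, fun a ha => ?_⟩
  · intro i g' hi
    rcases Nat.lt_trichotomy i gs.length with hlt | heq | hgt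
    · rw [List.getElem?_append_left hlt] at hi
      have hne : i ≠ gs.length := by omega
      simpa [Store.write_apply, hne] using H.gate i g' hi
    · subst heq
      have : g = g' := by simpa using hi
      subst this
      simp [Store.write_apply]
    · rw [List.getElem?_eq_none (by simp; omega)] at hi
      exact absurd hi (by simp)
  · intro i hi; simpa [Store.write_apply] using H.var i hi
  · intro i hi; simpa [Store.write_apply] using H.stack i hi
  · intro a; funext i; simpa [Store.write_apply] using congrFun (H.high a) i
  · funext i
    simp only [Store.write_apply]
    simp [show a ≠ 0 by omega, show a ≠ 1 by omega, show a ≠ 2 by omega, show a ≠ 3 by omega,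
      show a ≠ 4 by omega, show a ≠ 5 by omega]

theorem Holds.setVar {h : Store} {d r : ℕ} {v s : ℕ → ℕ} {gs : List RawGate} {σ : Store}
    (H : Holds h d r v s gs σ) (w : ℕ) :
    Holds h (d + 1) r (Function.update v d w) s gs (σ.write 6 d w) := by
  refine ⟨by simpa [Store.write_apply] using H.count, ?_, ?_, ?_, ?_⟩
  · intro i g hi; simpa [Store.write_apply] using H.gate i g hi
  · intro i hi
    rw [Store.write_apply, Function.update_apply]
    by_cases hid : i = d
    · simp [hid]
    · simpa [hid] using H.var i (by omega)
  · intro i hi; simpa [Store.write_apply] using H.stack i hi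
  · intro a; funext i; simpa [Store.write_apply] using congrFun (H.high a) i

theorem Holds.dropVar {h : Store} {d r : ℕ} {v s : ℕ → ℕ} {gs : List RawGate} {σ : Store} {w : ℕ}
    (H : Holds h (d + 1) r (Function.update v d w) s gs σ) : Holds h d r v s gs σ :=
  ⟨H.count, H.gate, fun i hi => by
    rw [H.var i (by omega), Function.update_of_ne (by omega)], H.stack, H.high⟩

theorem Holds.setStack {h : Store} {d r : ℕ} {v s : ℕ → ℕ} {gs : List RawGate} {σ : Store}
    (H : Holds h d r v s gs σ) {i : ℕ} (w : ℕ) (hi : 3 * r ≤ i) :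
    Holds h d r v s gs (σ.write 7 i w) := by
  refine ⟨by simpa [Store.write_apply] using H.count, ?_, ?_, ?_, ?_⟩
  · intro j g hj; simpa [Store.write_apply] using H.gate j g hj
  · intro j hj; simpa [Store.write_apply] using H.var j hj
  · intro j hj
    have : j ≠ i := by omega
    simpa [Store.write_apply, this] using H.stack j hj
  · intro a; funext i; simpa [Store.write_apply] using congrFun (H.high a) i

theorem update_eq_zero {v : ℕ → ℕ} {d : ℕ} (hv : ∀ i ≥ d, v i = 0) (w : ℕ) :
    ∀ i ≥ d + 1, Function.update v d w i = 0 := by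
  intro i hi
  rw [Function.update_of_ne (by omega)]; exact hv i (by omega)

/-- Inversion can increase an operation number, but then the new number is at most `15`; this is
where `16 ≤ B` enters. -/
theorem Writer.run_le_of_bounded {B : ℕ} (hB : 16 ≤ B) {h : Store} {p : Writer} :
    ∀ {d r : ℕ} {v : ℕ → ℕ}, p.Bounded B h d r v → ∀ g ∈ p.run h d v,
      g.op ≤ B ∧ g.d ≤ B ∧ g.N ≤ B ∧ g.x ≤ B ∧ g.y ≤ B := by
  induction p with
  | nop => intro d r v _ g hg; simp [Writer.run] at hg
  | emit op t N x y =>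
    intro d r v hb g hg
    simp only [Writer.run, List.mem_singleton] at hg
    subst hg; exact hb
  | seq p q ihp ihq =>
    intro d r v hb g hg
    rcases List.mem_append.1 hg with hg | hg
    exacts [ihp hb.1 g hg, ihq hb.2 g hg]
  | loop e p ih =>
    intro d r v hb g hg
    simp only [Writer.run, List.mem_flatMap, List.mem_range] at hg
    obtain ⟨i, hi, hg⟩ := hg
    exact ih (hb.2.2 i hi) g hg
  | bind e p ih => intro d r v hb g hg; exact ih hb.2.2 g hg
  | bits e p ih => intro d r v hb g hg; exact ih hb.2.2 g hg
  | ite e p q ihp ihq =>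
    intro d r v hb g hg
    simp only [Writer.run] at hg
    split_ifs at hg with he
    exacts [ihp (hb.1 he) g hg, ihq (hb.2 (by simpa using he)) g hg]
  | conj p q ihp ihq =>
    intro d r v hb g hg
    simp only [Writer.run, List.mem_append, List.mem_reverse, List.mem_map] at hg
    rcases hg with (hg | hg) | ⟨g', hg, rfl⟩
    · exact ihp hb.2.1 g hg
    · exact ihq hb.2.2 g hg
    · have := ihp hb.2.1 g' hg
      refine ⟨?_, this.2⟩
      have := this.1
      simp only [RawGate.inv, invOp]
      split_ifs <;> omega

/-- Correctness of the compiler, with the exact number of steps. The gates `gs` are already present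
when `p` starts; the induction needs this generality because pieces of a program append to each
other's output. -/
theorem Writer.exec {B : ℕ} (hB : 16 ≤ B) (h : Store) (p : Writer) :
    ∀ (d r : ℕ) (v s : ℕ → ℕ) (gs : List RawGate) (σ : Store), Holds h d r v s gs σ →
      (∀ i ≥ d, v i = 0) → p.Bounded B h d r v → gs.length + (p.run h d v).length ≤ B →
      ∃ τ, Exec B (p.toCom d r) σ (p.cost h d v) τ ∧
        Holds h d r v s (gs ++ p.run h d v) τ := by
  induction p with
  | nop =>
    intro d r v s gs σ H hv hb hl
    exact ⟨σ, .skip σ, by simpa [Writer.run] using H⟩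
  | emit op t N x y =>
    intro d r v s gs σ H hv hb hl
    suffices hs : _ by
      obtain ⟨τ, e₁, H₁, -⟩ := H.emit (g := ⟨op.eval h v, t.eval h v, N.eval h v, x.eval h v,
        y.eval h v⟩) hs hb (by simpa [Writer.run] using hl)
      exact ⟨τ, e₁, H₁⟩
    intro σ' h'
    -- With its counter reset, the store holds the empty circuit whatever the half-written gate is.
    -- The compiled expressions never read array `0`, so `Holds.eval` for the reset store also gives
    -- their values in `σ'`.
    have H' : Holds h d r v s [] (σ'.write 0 0 0) := by
      refine ⟨by simp [Store.write_apply], by simp, ?_, ?_, ?_⟩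
      · intro i hi; rw [Store.write_apply, if_neg (by simp), h' _ _ (by simp), H.var i hi]
      · intro i hi; rw [Store.write_apply, if_neg (by simp), h' _ _ (by simp), H.stack i hi]
      · intro a; funext i
        rw [Store.write_apply, if_neg (by simp), h' _ _ (by right; right; omega), H.high]
    have key : ∀ e : WExpr, (e.toExpr d).eval σ' = e.eval h v := by
      intro e
      rw [← H'.eval hv e]
      induction e with
      | var i => simp only [WExpr.toExpr]; split_ifs <;> simp [Expr.eval, Store.write_apply]
      | hi a i ih => simp [WExpr.toExpr, Expr.eval, Store.write_apply, ih]
      | lit k => rfl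
      | _ => simp_all [WExpr.toExpr, Expr.eval]
    exact ⟨key _, key _, key _, key _, key _⟩
  | seq p q ihp ihq =>
    intro d r v s gs σ H hv hb hl
    simp only [Writer.run, List.length_append] at hl
    obtain ⟨τ, e₁, H₁⟩ := ihp d r v s gs σ H hv hb.1 (by omega)
    obtain ⟨τ', e₂, H₂⟩ := ihq d r v s _ τ H₁ hv hb.2 (by simp; omega)
    exact ⟨τ', .seq e₁ e₂, by simpa [Writer.run, List.append_assoc] using H₂⟩
  | loop e p ih =>
    intro d r v s gs σ H hv hb hl
    obtain ⟨hd, heB, hbody⟩ := hb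
    set E := e.eval h v with hE
    have x0 := Exec.assign (B := B) σ 6 (.lit d) (.lit 0) hd (Nat.zero_le _)
    -- Induction on the number `k` of rounds that are still to come.
    have main : ∀ k, k ≤ E → ∀ (gs : List RawGate) (σ : Store),
        Holds h (d + 1) r (Function.update v d (E - k)) s gs σ →
        gs.length + (((List.range' (E - k) k).flatMap fun i =>
          p.run h (d + 1) (Function.update v d i))).length ≤ B →
        ∃ τ, Exec B (.loop (.sub (e.toExpr d) (.read 6 (.lit d)))
          (.seq (p.toCom (d + 1) r) (.assign 6 (.lit d) (.add (.read 6 (.lit d)) (.lit 1))))) σ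
          (1 + ((List.range' (E - k) k).map fun i =>
            (p.cost h (d + 1) (Function.update v d i) + 2)).sum) τ ∧
          Holds h d r v s (gs ++ (List.range' (E - k) k).flatMap fun i =>
            p.run h (d + 1) (Function.update v d i)) τ := by
      intro k
      induction k with
      | zero =>
        intro _ gs σ H _
        refine ⟨σ, .loopStop ?_, by simpa using H.dropVar⟩
        simp only [Expr.eval]
        rw [H.dropVar.eval hv, H.var d (by omega)]
        simp [← hE]
      | succ k ihk =>
        intro hk gs σ H hl
        have hr : List.range' (E - (k + 1)) (k + 1) = (E - (k + 1)) :: List.range' (E - k) k := by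
          rw [List.range'_succ]; congr 2; omega
        rw [hr] at hl ⊢
        simp only [List.flatMap_cons, List.length_append, List.map_cons, List.sum_cons] at hl ⊢
        obtain ⟨τ₁, e₁, H₁⟩ := ih (d + 1) r _ s gs σ H (update_eq_zero hv _)
          (hbody _ (by omega)) (by omega)
        have hval : τ₁ 6 d = E - (k + 1) := by rw [H₁.var d (by omega)]; simp
        have x₂ := Exec.assign (B := B) τ₁ 6 (.lit d) (.add (.read 6 (.lit d)) (.lit 1)) hd
          (by simp only [Expr.eval]; rw [hval]; omega)
        have H₂ := H₁.dropVar.setVar (E - k)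
        have hval2 : (Expr.add (.read 6 (.lit d)) (.lit 1)).eval τ₁ = E - k := by
          simp only [Expr.eval]; rw [hval]; omega
        rw [hval2] at x₂
        simp only [Expr.eval] at x₂
        obtain ⟨τ₂, e₂, H₃⟩ := ihk (by omega) _ _ H₂ (by rw [List.length_append]; omega)
        have := Exec.loopStep (B := B) (e := .sub (e.toExpr d) (.read 6 (.lit d))) ?_ (.seq e₁ x₂) e₂
        · refine ⟨τ₂, ?_, by simpa [List.append_assoc] using H₃⟩
          convert this using 1; omega
        · simp only [Expr.eval]
          rw [H.dropVar.eval hv, H.var d (by omega)]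
          simp; omega
    have hr : List.range' 0 E = List.range E := by rw [List.range_eq_range']
    have hH := H.setVar 0
    obtain ⟨τ, e₁, H₁⟩ := main E le_rfl gs (σ.write 6 d 0) (by simpa using hH)
      (by simpa [hr, Writer.run] using hl)
    refine ⟨τ, ?_, ?_⟩
    · have := Exec.seq x0 e₁
      refine this.congr ?_
      simp only [Nat.sub_self, hr, Writer.cost, ← hE]
      have : ∀ f : ℕ → ℕ, ∑ i ∈ Finset.range E, f i = ((List.range E).map f).sum := fun f => rfl
      rw [this]; omega
    · simpa [hr, Writer.run] using H₁
  | bind e p ih =>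
    intro d r v s gs σ H hv hb hl
    have x0 := Exec.assign (B := B) σ 6 (.lit d) (e.toExpr d) hb.1
      (by rw [H.eval hv]; exact hb.2.1)
    rw [H.eval hv] at x0
    obtain ⟨τ, e₁, H₁⟩ := ih (d + 1) r _ s gs _ (H.setVar (e.eval h v)) (update_eq_zero hv _)
      hb.2.2 hl
    exact ⟨τ, .seq x0 e₁, H₁.dropVar⟩
  | bits e p ih =>
    intro d r v s gs σ H hv hb hl
    obtain ⟨hd, hB2, hb⟩ := hb
    set E := e.eval h v with hE
    have hpow : ∀ j, j ≤ E.size → 2 ^ j ≤ B :=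
      fun j hj => (Nat.pow_le_pow_right (by norm_num) hj).trans hB2
    have x0 := Exec.assign (B := B) σ 6 (.lit d) (.lit 0) (by simp only [Expr.eval]; omega)
      (Nat.zero_le _)
    have x1 := Exec.assign (B := B) (σ.write 6 d 0) 6 (.lit (d + 1)) (.lit 1) hd
      (by simp only [Expr.eval]; omega)
    -- Here `k` doublings are still to come. The loop stops when `E` divided by the current power of
    -- two is zero, which happens first at `2 ^ E.size`.
    have main : ∀ k, k ≤ E.size → ∀ (σ : Store),
        Holds h (d + 2) r (Function.update (Function.update v d (E.size - k)) (d + 1)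
          (2 ^ (E.size - k))) s gs σ →
        ∃ τ, Exec B (.loop (.div (e.toExpr d) (.read 6 (.lit (d + 1))))
        (.seq (.assign 6 (.lit (d + 1)) (.mul (.lit 2) (.read 6 (.lit (d + 1)))))
          (.assign 6 (.lit d) (.add (.read 6 (.lit d)) (.lit 1))))) σ (1 + 3 * k) τ ∧
          Holds h (d + 2) r (Function.update (Function.update v d E.size) (d + 1)
          (2 ^ E.size)) s gs τ := by
      intro k
      induction k with
      | zero =>
        intro _ σ H
        refine ⟨σ, .loopStop ?_, by simpa using H⟩
        simp only [Expr.eval]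
        rw [H.dropVar.dropVar.eval hv, H.var (d + 1) (by omega)]
        simp only [Function.update_self, ← hE, Nat.sub_zero]
        exact Nat.div_eq_of_lt (Nat.size_le.1 le_rfl)
      | succ k ihk =>
        intro hk σ H
        have v1 : σ 6 (d + 1) = 2 ^ (E.size - (k + 1)) := by rw [H.var (d + 1) (by omega)]; simp
        have v0 : σ 6 d = E.size - (k + 1) := by rw [H.var d (by omega)]; simp
        have hp2 : 2 * 2 ^ (E.size - (k + 1)) = 2 ^ (E.size - k) := by
          rw [← pow_succ']; congr 1; omega
        have y1 := Exec.assign (B := B) σ 6 (.lit (d + 1))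
          (.mul (.lit 2) (.read 6 (.lit (d + 1)))) hd
          (by simp only [Expr.eval]; rw [v1, hp2]; exact hpow _ (by omega))
        simp only [Expr.eval] at y1
        rw [v1, hp2] at y1
        set σ₁ := σ.write 6 (d + 1) (2 ^ (E.size - k)) with hσ₁
        have v0' : σ₁ 6 d = E.size - (k + 1) := by rw [hσ₁, Store.write_apply]; simp [v0]
        have y2 := Exec.assign (B := B) σ₁ 6 (.lit d) (.add (.read 6 (.lit d)) (.lit 1))
          (by simp only [Expr.eval]; omega)
          (by simp only [Expr.eval]; rw [v0']; exact le_trans (by omega) ((Nat.lt_two_pow_self (n := E.size)).le.trans hB2))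
        simp only [Expr.eval] at y2
        rw [v0', show E.size - (k + 1) + 1 = E.size - k by omega] at y2
        have H2 : Holds h (d + 2) r (Function.update (Function.update v d (E.size - k)) (d + 1)
          (2 ^ (E.size - k))) s gs (σ₁.write 6 d (E.size - k)) := by
          have := (H.dropVar.dropVar.setVar (E.size - k)).setVar (2 ^ (E.size - k))
          convert this using 1
          rw [hσ₁]
          funext a i
          simp only [Store.write_apply]
          split_ifs <;> omega
        obtain ⟨τ, e₁, H₃⟩ := ihk (by omega) _ H2
        have := Exec.loopStep (B := B) (e := .div (e.toExpr d) (.read 6 (.lit (d + 1)))) ?_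
          (.seq y1 y2) e₁
        · refine ⟨τ, ?_, H₃⟩
          convert this using 1; omega
        · simp only [Expr.eval]
          rw [H.dropVar.dropVar.eval hv, v1, ← hE]
          have : 2 ^ (E.size - (k + 1)) ≤ E := Nat.lt_size.1 (by omega)
          exact (Nat.div_pos this (by positivity)).ne'
    obtain ⟨τ, e₁, H₁⟩ := main E.size le_rfl _
      (by simpa using (H.setVar 0).setVar 1)
    obtain ⟨τ', e₂, H₂⟩ := ih (d + 2) r _ s gs _ H₁ (update_eq_zero (update_eq_zero hv _) _) hb hl
    refine ⟨τ', ?_, H₂.dropVar.dropVar⟩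
    have := Exec.seq x0 (.seq x1 (.seq e₁ e₂))
    refine this.congr ?_
    simp only [Writer.cost, ← hE]; omega
  | ite e p q ihp ihq =>
    intro d r v s gs σ H hv hb hl
    by_cases he : e.eval h v = 0
    · simp only [Writer.run, Writer.cost, he, ne_eq, not_true, if_false] at hl ⊢
      obtain ⟨τ, e₁, H₁⟩ := ihq d r v s gs σ H hv (hb.2 he) hl
      exact ⟨τ, .condFalse (by rw [H.eval hv, he]) e₁, H₁⟩
    · simp only [Writer.run, Writer.cost, he, ne_eq, not_false_eq_true, if_true] at hl ⊢
      obtain ⟨τ, e₁, H₁⟩ := ihp d r v s gs σ H hv (hb.1 he) hl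
      exact ⟨τ, .condTrue (by rwa [H.eval hv]) e₁, H₁⟩
  | conj p q ihp ihq =>
    intro d r v s gs σ H hv hb hl
    obtain ⟨hr, hbp, hbq⟩ := hb
    set P := p.run h d v with hP
    set Q := q.run h d v with hQ
    simp only [Writer.run, List.length_append, List.length_reverse, List.length_map, ← hP, ← hQ]
      at hl ⊢
    have lift : ∀ {gs σ} (s' : ℕ → ℕ), Holds h d r v s gs σ → (∀ i < 3 * (r + 1), σ 7 i = s' i) →
        Holds h d (r + 1) v s' gs σ := fun s' H hs => ⟨H.count, H.gate, H.var, hs, H.high⟩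
    have drop : ∀ {gs σ} {s' : ℕ → ℕ}, Holds h d (r + 1) v s' gs σ → (∀ i < 3 * r, s' i = s i) →
        Holds h d r v s gs σ := fun H hs => ⟨H.count, H.gate, H.var,
          fun i hi => (H.stack i (by omega)).trans (hs i hi), H.high⟩
    have x0 := Exec.assign (B := B) σ 7 (.lit (3 * r)) counter (by simp only [Expr.eval]; omega)
      (by simp only [counter, Expr.eval]; rw [H.count]; omega)
    simp only [counter, Expr.eval] at x0
    rw [H.count] at x0
    have H0 := H.setStack (i := 3 * r) gs.length le_rfl
    set σ₀ := σ.write 7 (3 * r) gs.length with hσ₀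
    obtain ⟨σ₁, e₁, H₁⟩ := ihp d (r + 1) v (σ₀ 7) gs σ₀ (lift _ H0 fun _ _ => rfl) hv hbp
      (by rw [← hP]; omega)
    rw [← hP] at H₁
    have s0 : ∀ i < 3 * r, σ₀ 7 i = s i := fun i hi => H0.stack i hi
    have s1 : σ₀ 7 (3 * r) = gs.length := by simp [hσ₀, Store.write_apply]
    have H₁' := drop H₁ s0
    have x1 := Exec.assign (B := B) σ₁ 7 (.lit (3 * r + 1)) counter
      (by simp only [Expr.eval]; omega)
      (by simp only [counter, Expr.eval]; rw [H₁.count, List.length_append]; omega)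
    simp only [counter, Expr.eval] at x1
    rw [H₁.count] at x1
    have H2 := H₁'.setStack (i := 3 * r + 1) (gs ++ P).length (by omega)
    have s2 : σ₁ 7 (3 * r) = gs.length := by rw [H₁.stack _ (by omega), s1]
    set σ₂ := σ₁.write 7 (3 * r + 1) (gs ++ P).length with hσ₂
    have s3 : σ₂ 7 (3 * r) = gs.length := by simp [hσ₂, Store.write_apply, s2]
    have s4 : σ₂ 7 (3 * r + 1) = gs.length + P.length := by simp [hσ₂, Store.write_apply]
    obtain ⟨σ₃, e₃, H₃⟩ := ihq d (r + 1) v (σ₂ 7) (gs ++ P) σ₂ (lift _ H2 fun _ _ => rfl) hv hbq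
      (by rw [← hQ, List.length_append]; omega)
    rw [← hQ] at H₃
    have x3 := Exec.assign (B := B) σ₃ 7 (.lit (3 * r + 2)) (.lit 0) hr (Nat.zero_le _)
    simp only [Expr.eval] at x3
    have H₃' := drop H₃ fun i hi => H2.stack i hi
    have H4 := H₃'.setStack (i := 3 * r + 2) 0 (by omega)
    have t0 : (σ₃.write 7 (3 * r + 2) 0) 7 (3 * r) = gs.length := by
      simp [Store.write_apply, H₃.stack (3 * r) (by omega), s3]
    have t1 : (σ₃.write 7 (3 * r + 2) 0) 7 (3 * r + 1) = gs.length + P.length := by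
      simp [Store.write_apply, H₃.stack (3 * r + 1) (by omega), s4]
    set start : Expr := .read 7 (.lit (3 * r)) with hstart
    set last : Expr := .read 7 (.lit (3 * r + 1)) with hlast
    set i : Expr := .read 7 (.lit (3 * r + 2)) with hi
    set j : Expr := .sub (.sub last (.lit 1)) i with hj
    -- The first `k` gates of `P` remain to be undone; the next one to be read is at index
    -- `gs.length + k - 1`, far from the index that is being written.
    have main : ∀ k, k ≤ P.length → ∀ (gs' : List RawGate) (σ : Store),
        Holds h d r v s ((gs ++ P) ++ gs') σ →
        σ 7 (3 * r) = gs.length → σ 7 (3 * r + 1) = gs.length + P.length →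
        σ 7 (3 * r + 2) = P.length - k →
        gs.length + P.length + gs'.length + k ≤ B →
        ∃ τ, Exec B (.loop (.sub (.sub last start) i)
              (.seq (emitCom (invOpExpr (.read 1 j)) (.read 2 j) (.read 3 j) (.read 4 j)
                (.read 5 j)) (.assign 7 (.lit (3 * r + 2)) (.add i (.lit 1))))) σ (1 + 8 * k) τ ∧
          Holds h d r v s ((gs ++ P) ++ (gs' ++ ((P.take k).map RawGate.inv).reverse)) τ := by
      intro k
      induction k with
      | zero =>
        intro _ gs' σ H h0 h1 h2 _
        refine ⟨σ, .loopStop ?_, by simpa using H⟩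
        simp only [hstart, hlast, hi, Expr.eval]
        rw [h0, h1, h2]; omega
      | succ k ihk =>
        intro hk gs' σ H h0 h1 h2 hlen
        have hjv : ∀ σ' : Store, (∀ a i, i ≠ σ 0 0 ∨ a = 0 ∨ 5 < a → σ' a i = σ a i) →
            j.eval σ' = gs.length + k := by
          intro σ' h'
          simp only [hj, hlast, hi, Expr.eval]
          rw [h' 7 _ (by simp), h' 7 _ (by simp), h1, h2]; omega
        have hcount := H.count
        have hg : ((gs ++ P) ++ gs')[gs.length + k]? = some P[k] := by
          rw [List.append_assoc, List.getElem?_append_right (by omega),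
            List.getElem?_append_left (by omega)]
          simp
        obtain ⟨o1, o2, o3, o4, o5⟩ := H.gate _ _ hg
        have hle : P[k].op ≤ B ∧ P[k].d ≤ B ∧ P[k].N ≤ B ∧ P[k].x ≤ B ∧ P[k].y ≤ B :=
          Writer.run_le_of_bounded hB hbp _ (List.getElem_mem _)
        obtain ⟨τ₁, y1, H₁, unch⟩ := H.emit (B := B) (op := invOpExpr (.read 1 j)) (t := .read 2 j)
          (N := .read 3 j) (x := .read 4 j) (y := .read 5 j) (g := P[k].inv)
          (by
            intro σ' h'
            have hne : gs.length + k ≠ σ 0 0 := by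
              rw [hcount]; simp; omega
            simp only [eval_invOpExpr, Expr.eval, hjv σ' h']
            rw [h' 1 _ (.inl hne), h' 2 _ (.inl hne), h' 3 _ (.inl hne), h' 4 _ (.inl hne),
              h' 5 _ (.inl hne), o1, o2, o3, o4, o5]
            exact ⟨rfl, rfl, rfl, rfl, rfl⟩)
          (by
            refine ⟨?_, hle.2⟩
            have := hle.1
            simp only [RawGate.inv, invOp]
            split_ifs <;> omega)
          (by simp only [List.length_append]; omega)
        have unch := unch 7 (by norm_num)
        have x₂ := Exec.assign (B := B) τ₁ 7 (.lit (3 * r + 2)) (.add i (.lit 1)) hr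
          (by simp only [hi, Expr.eval]; rw [unch, h2]; omega)
        have hv2 : (Expr.add i (.lit 1)).eval τ₁ = P.length - k := by
          simp only [hi, Expr.eval]; rw [unch, h2]; omega
        rw [hv2] at x₂
        simp only [Expr.eval] at x₂
        have H₂ := H₁.setStack (i := 3 * r + 2) (P.length - k) (by omega)
        rw [List.append_assoc] at H₂
        obtain ⟨τ₂, e₂, H₃⟩ := ihk (by omega) (gs' ++ [P[k].inv]) _ H₂
          (by simp [Store.write_apply, unch, h0]) (by simp [Store.write_apply, unch, h1])
          (by simp [Store.write_apply]) (by simp only [List.length_append, List.length_singleton]; omega)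
        have := Exec.loopStep (B := B) (e := .sub (.sub last start) i) ?_ (.seq y1 x₂) e₂
        · refine ⟨τ₂, ?_, ?_⟩
          · convert this using 1; omega
          · rw [List.take_succ_eq_append_getElem (show k < P.length by omega), List.map_append,
              List.reverse_append, ← List.append_assoc gs']
            exact H₃
        · simp only [hstart, hlast, hi, Expr.eval]
          rw [h0, h1, h2]; omega
    obtain ⟨τ, e₅, H₅⟩ := main P.length le_rfl Q _ H4 t0 t1 (by simp [Store.write_apply])
      (by omega)
    refine ⟨τ, ?_, by simpa [List.append_assoc] using H₅⟩
    have := Exec.seq x0 (.seq e₁ (.seq x1 (.seq e₃ (.seq x3 e₅))))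
    refine this.congr ?_
    simp only [Writer.cost, ← hP]; omega


/-! ### All words of a writing program are polynomially bounded -/

theorem pow_mono (n : ℕ) {a b : ℕ} (h : a ≤ b) : (n + 2) ^ a ≤ (n + 2) ^ b :=
  Nat.pow_le_pow_right (by omega) h

theorem le_pow_self (n k : ℕ) : k ≤ (n + 2) ^ k :=
  (Nat.lt_pow_self (by omega)).le

theorem pow_add_pow_le (n a b : ℕ) : (n + 2) ^ a + (n + 2) ^ b ≤ (n + 2) ^ (a + b + 1) := by
  have h1 := pow_mono n (show a ≤ a + b by omega)
  have h2 := pow_mono n (show b ≤ a + b by omega)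
  calc _ ≤ 2 * (n + 2) ^ (a + b) := by omega
    _ ≤ (n + 2) * (n + 2) ^ (a + b) := by gcongr; omega
    _ = _ := by rw [pow_succ']

/-- An expression is a fixed polynomial-size computation: products add exponents, a sum costs one
more power of `n + 2 ≥ 2`, and differences and quotients do not grow. -/
theorem WExpr.exists_pow_bound (e : WExpr) (k : ℕ) : ∃ κ, ∀ (n : ℕ) (h : Store) (v : ℕ → ℕ),
    (∀ a i, h a i ≤ (n + 2) ^ k) → (∀ i, v i ≤ (n + 2) ^ k) → e.eval h v ≤ (n + 2) ^ κ := by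
  induction e with
  | lit w => exact ⟨w, fun n h v _ _ => le_pow_self n w⟩
  | var i => exact ⟨k, fun n h v _ hv => hv i⟩
  | hi a i _ => exact ⟨k, fun n h v hh _ => hh a _⟩
  | add x y ihx ihy =>
    obtain ⟨a, ha⟩ := ihx
    obtain ⟨b, hb⟩ := ihy
    exact ⟨a + b + 1, fun n h v hh hv =>
      (Nat.add_le_add (ha n h v hh hv) (hb n h v hh hv)).trans (pow_add_pow_le n a b)⟩
  | sub x y ihx _ =>
    obtain ⟨a, ha⟩ := ihx
    exact ⟨a, fun n h v hh hv => (Nat.sub_le _ _).trans (ha n h v hh hv)⟩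
  | mul x y ihx ihy =>
    obtain ⟨a, ha⟩ := ihx
    obtain ⟨b, hb⟩ := ihy
    exact ⟨a + b, fun n h v hh hv =>
      (Nat.mul_le_mul (ha n h v hh hv) (hb n h v hh hv)).trans_eq (pow_add _ _ _).symm⟩
  | div x y ihx _ =>
    obtain ⟨a, ha⟩ := ihx
    exact ⟨a, fun n h v hh hv => (Nat.div_le_self _ _).trans (ha n h v hh hv)⟩

theorem Writer.Bounded.mono {B B' : ℕ} (hB : B ≤ B') {h : Store} {p : Writer} :
    ∀ {d r : ℕ} {v : ℕ → ℕ}, p.Bounded B h d r v → p.Bounded B' h d r v := by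
  induction p with
  | nop => exact fun _ => trivial
  | emit op t N x y =>
    intro d r v ⟨h1, h2, h3, h4, h5⟩
    exact ⟨h1.trans hB, h2.trans hB, h3.trans hB, h4.trans hB, h5.trans hB⟩
  | seq p q ihp ihq => exact fun h => ⟨ihp h.1, ihq h.2⟩
  | loop e p ih => exact fun h => ⟨h.1.trans hB, h.2.1.trans hB, fun i hi => ih (h.2.2 i hi)⟩
  | bind e p ih => exact fun h => ⟨h.1.trans hB, h.2.1.trans hB, ih h.2.2⟩
  | bits e p ih => exact fun h => ⟨h.1.trans hB, h.2.1.trans hB, ih h.2.2⟩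
  | ite e p q ihp ihq => exact fun h => ⟨fun he => ihp (h.1 he), fun he => ihq (h.2 he)⟩
  | conj p q ihp ihq => exact fun h => ⟨h.1.trans hB, ihp h.2.1, ihq h.2.2⟩

theorem two_pow_size_le (e : ℕ) : 2 ^ e.size ≤ 2 * e + 1 := by
  rcases Nat.eq_zero_or_pos e with rfl | he
  · simp
  · have h1 : 0 < e.size := Nat.size_pos.2 he
    have h2 : 2 ^ (e.size - 1) ≤ e := Nat.lt_size.1 (by omega)
    have h3 : 2 ^ e.size = 2 * 2 ^ (e.size - 1) := by rw [← pow_succ']; congr 1; omega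
    omega

theorem update_le {v : ℕ → ℕ} {B B' w : ℕ} (d : ℕ) (hB : B ≤ B') (hv : ∀ i, v i ≤ B)
    (hw : w ≤ B') : ∀ i, Function.update v d w i ≤ B' := by
  intro i
  rw [Function.update_apply]
  split_ifs
  · exact hw
  · exact (hv i).trans hB

/-- The exponent depends on the program only, because the nesting of loops and expressions is
constant. Thus no particular circuit needs its own verification of word sizes. -/
theorem Writer.exists_pow_bound (p : Writer) : ∀ d r k : ℕ, ∃ κ, ∀ (n : ℕ) (h : Store)
    (v : ℕ → ℕ), (∀ a i, h a i ≤ (n + 2) ^ k) → (∀ i, v i ≤ (n + 2) ^ k) →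
    p.Bounded ((n + 2) ^ κ) h d r v ∧ (p.run h d v).length ≤ (n + 2) ^ κ := by
  induction p with
  | nop => exact fun d r k => ⟨0, fun n h v _ _ => ⟨trivial, by simp [Writer.run]⟩⟩
  | emit op t N x y =>
    intro d r k
    obtain ⟨a1, h1⟩ := op.exists_pow_bound k
    obtain ⟨a2, h2⟩ := t.exists_pow_bound k
    obtain ⟨a3, h3⟩ := N.exists_pow_bound k
    obtain ⟨a4, h4⟩ := x.exists_pow_bound k
    obtain ⟨a5, h5⟩ := y.exists_pow_bound k
    refine ⟨a1 + a2 + a3 + a4 + a5, fun n h v hh hv => ⟨⟨?_, ?_, ?_, ?_, ?_⟩, ?_⟩⟩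
    · exact (h1 n h v hh hv).trans (pow_mono n (by omega))
    · exact (h2 n h v hh hv).trans (pow_mono n (by omega))
    · exact (h3 n h v hh hv).trans (pow_mono n (by omega))
    · exact (h4 n h v hh hv).trans (pow_mono n (by omega))
    · exact (h5 n h v hh hv).trans (pow_mono n (by omega))
    · simpa [Writer.run] using Nat.one_le_pow _ _ (by omega)
  | seq p q ihp ihq =>
    intro d r k
    obtain ⟨a, ha⟩ := ihp d r k
    obtain ⟨b, hb⟩ := ihq d r k
    refine ⟨a + b + 1, fun n h v hh hv => ⟨⟨?_, ?_⟩, ?_⟩⟩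
    · exact (ha n h v hh hv).1.mono (pow_mono n (by omega))
    · exact (hb n h v hh hv).1.mono (pow_mono n (by omega))
    · rw [Writer.run, List.length_append]
      exact (Nat.add_le_add (ha n h v hh hv).2 (hb n h v hh hv).2).trans (pow_add_pow_le n a b)
  | loop e p ih =>
    intro d r k
    obtain ⟨a, ha⟩ := e.exists_pow_bound k
    -- Inside the loop the new variable is bounded by the `a`-th power and everything else by the
    -- `k`-th power.
    obtain ⟨b, hb⟩ := ih (d + 1) r (k + a)
    refine ⟨d + a + b, fun n h v hh hv => ?_⟩
    have hE := ha n h v hh hv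
    have key : ∀ i < e.eval h v, _ := fun i hi => hb n h (Function.update v d i)
      (fun a i => (hh a i).trans (pow_mono n (by omega)))
      (update_le d (pow_mono n (by omega)) hv (hi.le.trans (hE.trans (pow_mono n (by omega)))))
    refine ⟨⟨?_, ?_, fun i hi => (key i hi).1.mono (pow_mono n (by omega))⟩, ?_⟩
    · exact (le_pow_self n d).trans (pow_mono n (by omega))
    · exact hE.trans (pow_mono n (by omega))
    · rw [Writer.run, List.length_flatMap]
      calc _ ≤ ((List.range (e.eval h v)).map fun i => (n + 2) ^ b).sum := by
            apply List.sum_le_sum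
            intro i hi
            exact (key i (List.mem_range.1 hi)).2
        _ = e.eval h v * (n + 2) ^ b := by simp
        _ ≤ (n + 2) ^ a * (n + 2) ^ b := by gcongr
        _ = (n + 2) ^ (a + b) := by rw [pow_add]
        _ ≤ _ := pow_mono n (by omega)
  | bind e p ih =>
    intro d r k
    obtain ⟨a, ha⟩ := e.exists_pow_bound k
    obtain ⟨b, hb⟩ := ih (d + 1) r (k + a)
    refine ⟨d + a + b, fun n h v hh hv => ?_⟩
    have hE := ha n h v hh hv
    have key := hb n h (Function.update v d (e.eval h v))
      (fun a i => (hh a i).trans (pow_mono n (by omega)))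
      (update_le d (pow_mono n (by omega)) hv (hE.trans (pow_mono n (by omega))))
    exact ⟨⟨(le_pow_self n d).trans (pow_mono n (by omega)), hE.trans (pow_mono n (by omega)),
      key.1.mono (pow_mono n (by omega))⟩, key.2.trans (pow_mono n (by omega))⟩
  | bits e p ih =>
    intro d r k
    obtain ⟨a, ha⟩ := e.exists_pow_bound k
    -- The power `2 ^ size` is at most twice the value plus one, and two further factors `n + 2`
    -- absorb the constant.
    obtain ⟨b, hb⟩ := ih (d + 2) r (k + (a + 2))
    refine ⟨d + 1 + (a + 2) + b, fun n h v hh hv => ?_⟩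
    have hE : 2 ^ (e.eval h v).size ≤ (n + 2) ^ (a + 2) := by
      have h1 := ha n h v hh hv
      have h2 := two_pow_size_le (e.eval h v)
      have h3 : 1 ≤ (n + 2) ^ a := Nat.one_le_pow _ _ (by omega)
      calc _ ≤ (n + 2) ^ a * 2 ^ 2 := by omega
        _ ≤ (n + 2) ^ a * (n + 2) ^ 2 := by gcongr; omega
        _ = _ := by rw [pow_add]
    have hE' : (e.eval h v).size ≤ (n + 2) ^ (a + 2) := (Nat.lt_two_pow_self).le.trans hE
    have key := hb n h (Function.update (Function.update v d (e.eval h v).size) (d + 1)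
        (2 ^ (e.eval h v).size))
      (fun a i => (hh a i).trans (pow_mono n (by omega)))
      (update_le (d + 1) le_rfl
        (update_le d (pow_mono n (by omega)) hv (hE'.trans (pow_mono n (by omega))))
        (hE.trans (pow_mono n (by omega))))
    exact ⟨⟨(le_pow_self n (d + 1)).trans (pow_mono n (by omega)),
      hE.trans (pow_mono n (by omega)), key.1.mono (pow_mono n (by omega))⟩,
      key.2.trans (pow_mono n (by omega))⟩
  | ite e p q ihp ihq =>
    intro d r k
    obtain ⟨a, ha⟩ := ihp d r k
    obtain ⟨b, hb⟩ := ihq d r k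
    refine ⟨a + b, fun n h v hh hv => ⟨⟨fun _ => ?_, fun _ => ?_⟩, ?_⟩⟩
    · exact (ha n h v hh hv).1.mono (pow_mono n (by omega))
    · exact (hb n h v hh hv).1.mono (pow_mono n (by omega))
    · rw [Writer.run]
      split_ifs
      · exact (ha n h v hh hv).2.trans (pow_mono n (by omega))
      · exact (hb n h v hh hv).2.trans (pow_mono n (by omega))
  | conj p q ihp ihq =>
    intro d r k
    obtain ⟨a, ha⟩ := ihp d (r + 1) k
    obtain ⟨b, hb⟩ := ihq d (r + 1) k
    refine ⟨(a + b + 1) + a + 1 + (3 * r + 2), fun n h v hh hv => ⟨⟨?_, ?_, ?_⟩, ?_⟩⟩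
    · exact (le_pow_self n (3 * r + 2)).trans (pow_mono n (by omega))
    · exact (ha n h v hh hv).1.mono (pow_mono n (by omega))
    · exact (hb n h v hh hv).1.mono (pow_mono n (by omega))
    · rw [Writer.run, List.length_append, List.length_append, List.length_reverse,
        List.length_map]
      calc _ ≤ ((n + 2) ^ a + (n + 2) ^ b) + (n + 2) ^ a :=
            Nat.add_le_add (Nat.add_le_add (ha n h v hh hv).2 (hb n h v hh hv).2)
              (ha n h v hh hv).2
        _ ≤ (n + 2) ^ (a + b + 1) + (n + 2) ^ a := by gcongr; exact pow_add_pow_le n a b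
        _ ≤ (n + 2) ^ (a + b + 1 + a + 1) := pow_add_pow_le n _ _
        _ ≤ _ := pow_mono n (by omega)

/-- The values of the variables at the start of a writing program: variable `0` is `n`. -/
def startVar (n : ℕ) : ℕ → ℕ := Function.update (fun _ => 0) 0 n

/-- A writing program that may read the arrays that another program has computed. -/
theorem exists_com_of_writer (A : Com) (κ : ℕ) (f : WExpr) (F : ℕ → ℕ)
    (hf : ∀ n, f.eval (fun _ _ => 0) (startVar n) = F n) (hF : ∀ n, F n ≤ n + 3) (p : Writer) :
    ∃ (W : Com) (κ' : ℕ), ∀ n s τ,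
      Exec ((F n + 2) ^ κ) A (initStore (F n) fun _ => 0) s τ →
      ∃ τ', Exec ((n + 2) ^ κ') W (initStore n fun _ => 0) (s + p.cost τ 1 (startVar n) + 3) τ' ∧
        circuitOf τ' = (p.run τ 1 (startVar n)).map RawGate.gate := by
  obtain ⟨b, hb⟩ := p.exists_pow_bound 1 0 (3 * (κ + 1))
  -- Save `n` as variable `0`, clear the gate counter, put the size `F n` where the shifted program
  -- `A` expects its input, run `A`, and then write. The three assignments are the additional three
  -- steps.
  refine ⟨.seq (.assign 6 (.lit 0) (.read 0 (.lit 0))) (.seq (.assign 0 (.lit 0) (.lit 0))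
    (.seq (.assign 8 (.lit 0) (f.toExpr 1)) (.seq (A.shift 8) (p.toCom 1 0)))),
    b + 3 * (κ + 1) + 4, fun n s τ hA => ?_⟩
  set B := (n + 2) ^ (b + 3 * (κ + 1) + 4) with hB
  -- The exponent three covers `n + 5`, also for `n = 0`; this converts word bounds for size `F n`
  -- into bounds for size `n`.
  have hF3 : F n + 2 ≤ (n + 2) ^ 3 := by
    have := hF n
    nlinarith [Nat.zero_le (n ^ 2), Nat.zero_le (n ^ 3)]
  have hFB : (F n + 2) ^ (κ + 1) ≤ (n + 2) ^ (3 * (κ + 1)) := by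
    rw [pow_mul]; exact Nat.pow_le_pow_left hF3 _
  have hF1 : F n + 2 ≤ B := hF3.trans (pow_mono n (by omega))
  have hn : n ≤ B := by
    have : n + 2 ≤ B := by
      calc n + 2 = (n + 2) ^ 1 := (pow_one _).symm
        _ ≤ _ := pow_mono n (by omega)
    omega
  have hA' : Exec B A (initStore (F n) fun _ => 0) s τ :=
    hA.mono (((Nat.pow_le_pow_right (by omega) (by omega : κ ≤ κ + 1)).trans hFB).trans
      (pow_mono n (by omega)))
  have hτ : ∀ a i, τ a i ≤ (n + 2) ^ (3 * (κ + 1)) := by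
    refine hA.le_bound ((Nat.pow_le_pow_right (by omega) (by omega : κ ≤ κ + 1)).trans hFB) ?_
    intro a i
    have h1 : F n ≤ (n + 2) ^ (3 * (κ + 1)) :=
      (show F n ≤ F n + 2 by omega).trans (hF3.trans (pow_mono n (by omega)))
    unfold initStore
    split_ifs
    · exact h1
    · exact Nat.zero_le _
    · exact Nat.zero_le _
  have hv : ∀ i, startVar n i ≤ (n + 2) ^ (3 * (κ + 1)) := by
    intro i
    have h1 : n ≤ (n + 2) ^ (3 * (κ + 1)) := by
      calc n ≤ (n + 2) ^ 1 := by rw [pow_one]; omega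
        _ ≤ _ := pow_mono n (by omega)
    unfold startVar
    rw [Function.update_apply]
    split_ifs
    · exact h1
    · exact Nat.zero_le _
  obtain ⟨hbd, hlen⟩ := hb n τ (startVar n) hτ hv
  set σ₀ := initStore n fun _ => 0 with hσ₀
  have e₁ := Exec.assign (B := B) σ₀ 6 (.lit 0) (.read 0 (.lit 0)) (Nat.zero_le _)
    (by simpa [Expr.eval, hσ₀, initStore] using hn)
  have e₂ := Exec.assign (B := B) (σ₀.write 6 0 n) 0 (.lit 0) (.lit 0) (Nat.zero_le _)
    (Nat.zero_le _)
  have hr : (Expr.read 0 (.lit 0)).eval σ₀ = n := by simp [Expr.eval, hσ₀, initStore]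
  rw [hr] at e₁
  simp only [Expr.eval] at e₁ e₂
  set σ₁ := (σ₀.write 6 0 n).write 0 0 0 with hσ₁
  have hz : ∀ i ≥ 1, startVar n i = 0 := by
    intro i hi; unfold startVar; rw [Function.update_of_ne (by omega)]
  have H : Holds (fun _ _ => 0) 1 0 (startVar n) (fun _ => 0) [] σ₁ := by
    refine ⟨by simp [hσ₁, Store.write_apply], by simp, ?_, by simp, ?_⟩
    · intro i hi
      obtain rfl : i = 0 := by omega
      simp [hσ₁, Store.write_apply, startVar]
    · intro a; funext i
      simp [hσ₁, hσ₀, Store.write_apply, initStore]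
  have hev : (f.toExpr 1).eval σ₁ = F n := by rw [H.eval hz, hf]
  have e₃ := Exec.assign (B := B) σ₁ 8 (.lit 0) (f.toExpr 1) (Nat.zero_le _)
    (by rw [hev]; omega)
  rw [hev] at e₃
  simp only [Expr.eval] at e₃
  have hov : σ₁.write 8 0 (F n) = overlay 8 σ₁ (initStore (F n) fun _ => 0) := by
    funext a i
    rw [Store.write_apply]
    unfold overlay
    by_cases ha : a < 8
    · simp [ha, show a ≠ 8 by omega]
    · have ha0 : a - 8 = 0 ↔ a = 8 := by omega
      simp only [ha, if_false, initStore, ha0]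
      split_ifs
      · rfl
      · simp [hσ₁, hσ₀, Store.write_apply, initStore, show a ≠ 0 by omega, show a ≠ 6 by omega]
      · simp [hσ₁, hσ₀, Store.write_apply, initStore, show a ≠ 0 by omega, show a ≠ 6 by omega]
  rw [hov] at e₃
  have e₄ := hA'.shift 8 σ₁
  have H₂ : Holds τ 1 0 (startVar n) (fun _ => 0) [] (overlay 8 σ₁ τ) := by
    refine ⟨?_, by simp, ?_, by simp, ?_⟩
    · rw [overlay_of_lt _ _ (by norm_num)]; exact H.count
    · intro i hi; rw [overlay_of_lt _ _ (by norm_num)]; exact H.var i hi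
    · intro a; rw [overlay_add]
  have hB16 : 16 ≤ B := by
    calc 16 = 2 ^ 4 := by norm_num
      _ ≤ (n + 2) ^ 4 := Nat.pow_le_pow_left (by omega) _
      _ ≤ B := pow_mono n (by omega)
  obtain ⟨τ', e₅, H₃⟩ := p.exec hB16 τ 1 0 _ _ [] _ H₂ hz (hbd.mono (pow_mono n (by omega)))
    (by simpa using hlen.trans (pow_mono n (by omega)))
  refine ⟨τ', ?_, ?_⟩
  · exact (Exec.seq e₁ (.seq e₂ (.seq e₃ (.seq e₄ e₅)))).congr (by omega)
  · simpa using H₃.circuitOf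

/-! ### From writing programs to quantum running times -/

theorem Writer.length_run_le_cost (h : Store) (p : Writer) :
    ∀ (d : ℕ) (v : ℕ → ℕ), (p.run h d v).length ≤ p.cost h d v := by
  induction p with
  | nop => intro d v; simp [Writer.run]
  | emit => intro d v; simp [Writer.run, Writer.cost]
  | seq p q ihp ihq =>
    intro d v
    rw [Writer.run, List.length_append]
    exact Nat.add_le_add (ihp d v) (ihq d v)
  | loop e p ih =>
    intro d v
    rw [Writer.run, List.length_flatMap, Writer.cost]
    have : ∀ f : ℕ → ℕ, ∑ i ∈ Finset.range (e.eval h v), f i =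
      ((List.range (e.eval h v)).map f).sum := fun f => rfl
    rw [this]
    refine le_trans (List.sum_le_sum fun i _ => ?_) (Nat.le_add_left _ _)
    exact (ih _ _).trans (Nat.le_add_right _ _)
  | bind e p ih => intro d v; exact (ih _ _).trans (Nat.le_add_left _ _)
  | bits e p ih => intro d v; exact (ih _ _).trans (Nat.le_add_left _ _)
  | ite e p q ihp ihq =>
    intro d v
    simp only [Writer.run, Writer.cost]
    split_ifs
    · exact (ihp d v).trans (Nat.le_add_right _ _)
    · exact (ihq d v).trans (Nat.le_add_right _ _)
  | conj p q ihp ihq =>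
    intro d v
    simp only [Writer.run, Writer.cost, List.length_append, List.length_reverse, List.length_map]
    have := ihp d v
    have := ihq d v
    omega

/-- The cost of `w` is counted twice, once for the writing and once for the gates, whose number it
bounds. The program `A` runs first, for the size `F n`, and leaves the store `S n` that `w` reads.
-/
theorem quantumTime_of_writer {P : Problem} {q : ℝ} {T : ℕ → ℝ} (A : Com) (κ : ℕ) (f : WExpr)
    (F : ℕ → ℕ) (hf : ∀ n, f.eval (fun _ _ => 0) (startVar n) = F n) (hF : ∀ n, F n ≤ n + 3)
    (w : Writer) (u t : ℕ → ℕ) (S : ℕ → Store)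
    (hA : ∀ n, ∃ s ≤ u n, Exec ((F n + 2) ^ κ) A (initStore (F n) fun _ => 0) s (S n))
    (ht : ∀ n, u n + 2 * w.cost (S n) 1 (startVar n) + 3 ≤ t n)
    (hT : (fun n => (t n : ℝ)) =O[Filter.atTop] T)
    (hP : ∀ n (x : P.Inst n), q ≤ prob (circ ((w.run (S n) 1 (startVar n)).map RawGate.gate)
      (Finsupp.single (P.inputWords n x) 1)) (P.correct n x)) :
    QuantumTime q P T := by
  obtain ⟨W, κ', hW⟩ := exists_com_of_writer A κ f F hf hF w
  refine ⟨W, κ', t, hT, fun n => ?_⟩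
  obtain ⟨s, hs, he⟩ := hA n
  obtain ⟨τ, e, hτ⟩ := hW n s (S n) he
  refine ⟨_, τ, e, ?_, fun x => ?_⟩
  · have h1 := ht n
    have h2 := w.length_run_le_cost (S n) 1 (startVar n)
    rw [hτ, List.length_map]; omega
  · rw [hτ, runCircuit_eq_circ]; exact hP n x


/-! ## Relocation of circuits -/

def Operand.shift (o : ℕ) : Operand → Operand
  | .const k => .const k
  | .copy a => .copy (a + o)
  | .monus a b => .monus (a + o) (b + o)
  | .mul a b => .mul (a + o) (b + o)
  | .div a b => .div (a + o) (b + o)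
  | .load base a => .load (base + o) (a + o)

/-- The same gate, with all cell addresses increased by `o`. -/
def Gate.shift (o : ℕ) : Gate → Gate
  | .add d N f => .add (d + o) N (f.shift o)
  | .sub d N f => .sub (d + o) N (f.shift o)
  | .swap d base a => .swap (d + o) (base + o) (a + o)
  | .had d => .had (d + o)
  | .phase d k => .phase (d + o) k
  | .phaseInv d k => .phaseInv (d + o) k
  | .idle => .idle

/-- For the operations `0`, `6`, `14`, `15` the word `x` is a constant or a phase exponent, not an
address. Shifting a word that the gate ignores does no harm. -/
def RawGate.shift (o : ℕ) (r : RawGate) : RawGate :=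
  ⟨r.op, r.d + o, r.N, if r.op = 0 ∨ r.op = 6 ∨ r.op = 14 ∨ r.op = 15 then r.x else r.x + o,
    r.y + o⟩

theorem RawGate.gate_shift (o : ℕ) (r : RawGate) : (r.shift o).gate = r.gate.shift o := by
  obtain ⟨op, d, N, x, y⟩ := r
  by_cases h : op < 16
  · interval_cases op <;> rfl
  · simp only [RawGate.gate, RawGate.shift]
    rw [decode_of_lt (by omega), decode_of_lt (by omega)]; rfl

def Operand.Bounded (W : ℕ) : Operand → Prop
  | .const _ => True
  | .copy a => a ≤ W
  | .monus a b => a ≤ W ∧ b ≤ W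
  | .mul a b => a ≤ W ∧ b ≤ W
  | .div a b => a ≤ W ∧ b ≤ W
  | .load base a => base ≤ W ∧ a ≤ W

/-- Cell addresses and moduli are at most `W`. -/
def Gate.Bounded (W : ℕ) : Gate → Prop
  | .add d N f => d ≤ W ∧ N ≤ W ∧ f.Bounded W
  | .sub d N f => d ≤ W ∧ N ≤ W ∧ f.Bounded W
  | .swap d base a => d ≤ W ∧ base ≤ W ∧ a ≤ W
  | .had d => d ≤ W
  | .phase d _ => d ≤ W
  | .phaseInv d _ => d ≤ W
  | .idle => True

theorem Gate.bounded_decode {W op d N x y : ℕ} (hd : d ≤ W) (hN : N ≤ W) (hx : x ≤ W)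
    (hy : y ≤ W) : (Gate.decode op d N x y).Bounded W := by
  unfold Gate.decode
  split <;> simp [Gate.Bounded, Operand.Bounded, *]

/-- The memory `b` with the cells `o, …, o + L - 1` replaced by the first cells of `m`. -/
def patch (b : Mem) (o L : ℕ) (m : Mem) : Mem := fun i => if o ≤ i ∧ i < o + L then m (i - o) else b i

theorem patch_add {b : Mem} {o L : ℕ} {m : Mem} {i : ℕ} (hi : i < L) :
    patch b o L m (i + o) = m i := by
  unfold patch
  rw [if_pos (by omega), Nat.add_sub_cancel]

theorem patch_of_not {b : Mem} {o L : ℕ} {m : Mem} {i : ℕ} (hi : ¬ (o ≤ i ∧ i < o + L)) :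
    patch b o L m i = b i := if_neg hi

theorem update_patch {b : Mem} {o L : ℕ} {m : Mem} {i : ℕ} (hi : i < L) (x : ℕ) :
    Function.update (patch b o L m) (i + o) x = patch b o L (Function.update m i x) := by
  funext j
  by_cases hj : o ≤ j ∧ j < o + L
  · obtain ⟨k, rfl⟩ : ∃ k, j = k + o := ⟨j - o, by omega⟩
    rw [patch_add (by omega)]
    by_cases hk : k = i
    · subst hk; simp
    · rw [Function.update_of_ne (by omega), Function.update_of_ne hk, patch_add (by omega)]
  · rw [patch_of_not hj, Function.update_of_ne (by omega), patch_of_not hj]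

theorem patch_comp_swap {b : Mem} {o L : ℕ} {m : Mem} {i j : ℕ} (hi : i < L) (hj : j < L) :
    patch b o L m ∘ Equiv.swap (i + o) (j + o) = patch b o L (m ∘ Equiv.swap i j) := by
  funext l
  by_cases hl : o ≤ l ∧ l < o + L
  · obtain ⟨k, rfl⟩ : ∃ k, l = k + o := ⟨l - o, by omega⟩
    rw [patch_add (by omega)]
    simp only [Function.comp_apply]
    by_cases h1 : k = i
    · subst h1; simp [patch_add hj]
    by_cases h2 : k = j
    · subst h2; simp [patch_add hi]
    rw [Equiv.swap_apply_of_ne_of_ne (by omega) (by omega),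
      Equiv.swap_apply_of_ne_of_ne h1 h2, patch_add (by omega)]
  · rw [patch_of_not hl, Function.comp_apply,
      Equiv.swap_apply_of_ne_of_ne (by omega) (by omega), patch_of_not hl]

/-- Words are at most `V`, and only the first `L` cells are in use. -/
def Small (V L : ℕ) (m : Mem) : Prop := (∀ i, m i ≤ V) ∧ ∀ i ≥ L, m i = 0

theorem Small.update {V L : ℕ} {m : Mem} (hm : Small V L m) {d x : ℕ} (hd : d < L) (hx : x ≤ V) :
    Small V L (Function.update m d x) := by
  constructor
  · intro i
    rw [Function.update_apply]
    split_ifs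
    exacts [hx, hm.1 i]
  · intro i hi
    rw [Function.update_of_ne (by omega)]
    exact hm.2 i hi

theorem Small.patch_inj {V L o : ℕ} {b m m' : Mem} (hm : Small V L m) (hm' : Small V L m')
    (h : patch b o L m = patch b o L m') : m = m' := by
  funext i
  by_cases hi : i < L
  · have := congrFun h (i + o)
    rwa [patch_add hi, patch_add hi] at this
  · rw [hm.2 i (by omega), hm'.2 i (by omega)]

/-- An indirect address is at most `W + V`, so it never leaves the window of `L` cells. -/
theorem Operand.eval_shift {V L W o : ℕ} {b m : Mem} (hm : Small V L m) (hL : W + V < L)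
    {f : Operand} (hf : f.Bounded W) : (f.shift o).eval (patch b o L m) = f.eval m := by
  cases f with
  | const k => rfl
  | copy a => exact patch_add (by simp only [Operand.Bounded] at hf; omega)
  | load base a =>
    have ha : a < L := by have := hf.2; omega
    have hb := hf.1
    have h1 : patch b o L m (a + o) = m a := patch_add ha
    have h2 := hm.1 a
    change patch b o L m (base + o + patch b o L m (a + o)) = m (base + m a)
    rw [h1, show base + o + m a = base + m a + o by omega, patch_add (by omega)]
  | _ =>
    have h1 := hf.1
    have h2 := hf.2
    simp only [Operand.shift, Operand.eval]
    rw [patch_add (by omega), patch_add (by omega)]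

theorem Gate.act_shift {V L W o : ℕ} {b m : Mem} (hm : Small V L m) (hWV : W ≤ V)
    (hL : W + V < L) {g : Gate} (hg : g.Bounded W) (hc : g.IsClassical) :
    (g.shift o).act (patch b o L m) = patch b o L (g.act m) ∧ Small V L (g.act m) := by
  have hupd : ∀ d, d ≤ W → Small V L (Function.update m d 0) :=
    fun d hd => hm.update (by omega) (Nat.zero_le _)
  cases g with
  | add d N f =>
    obtain ⟨hd, hN, hf⟩ := hg
    simp only [Gate.shift, Gate.act]
    rw [patch_add (by omega), update_patch (x := 0) (by omega), Operand.eval_shift (hupd d hd) hL hf,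
      update_patch (by omega)]
    split_ifs with h
    · exact ⟨rfl, hm.update (by omega) (((Nat.mod_lt _ (by omega)).le.trans hN).trans hWV)⟩
    · exact ⟨rfl, hm⟩
  | sub d N f =>
    obtain ⟨hd, hN, hf⟩ := hg
    simp only [Gate.shift, Gate.act]
    rw [patch_add (by omega), update_patch (x := 0) (by omega), Operand.eval_shift (hupd d hd) hL hf,
      update_patch (by omega)]
    split_ifs with h
    · exact ⟨rfl, hm.update (by omega) (((Nat.mod_lt _ (by omega)).le.trans hN).trans hWV)⟩
    · exact ⟨rfl, hm⟩
  | swap d base a =>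
    obtain ⟨hd, hb, ha⟩ := hg
    have h1 : patch b o L m (a + o) = m a := patch_add (by omega)
    have h2 := hm.1 a
    have e : (Gate.shift o (.swap d base a)).act (patch b o L m) =
        if a ≠ d ∧ base + m a ≠ a then
          patch b o L m ∘ Equiv.swap (d + o) (base + m a + o) else patch b o L m := by
      simp only [Gate.shift, Gate.act, h1, show base + o + m a = base + m a + o by omega]
      congr 1
      simp only [ne_eq, eq_iff_iff]
      omega
    rw [e]
    simp only [Gate.act]
    split_ifs with h
    · refine ⟨patch_comp_swap (by omega) (by omega), fun i => hm.1 _, fun i hi => ?_⟩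
      rw [Function.comp_apply, Equiv.swap_apply_of_ne_of_ne (by omega) (by omega)]
      exact hm.2 i hi
    · exact ⟨rfl, hm⟩
  | idle => exact ⟨rfl, hm⟩
  | _ => exact hc.elim

/-- Words stay at most `V`: arithmetic gates produce residues for moduli at most `W ≤ V`, and
setting the last bit of a word does not pass `V` because `V` is odd. -/
theorem Gate.onBasis_shift {V L W o : ℕ} {b m : Mem} (hm : Small V L m) (hWV : W ≤ V)
    (hV : V % 2 = 1) (hL : W + V < L) {g : Gate} (hg : g.Bounded W) :
    (g.shift o).onBasis (patch b o L m) = (g.onBasis m).mapDomain (patch b o L) ∧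
      ∀ m' ∈ (g.onBasis m).support, Small V L m' := by
  classical
  have cl : ∀ g : Gate, g.Bounded W → g.IsClassical → (g.shift o).IsClassical →
      (g.shift o).onBasis (patch b o L m) = (g.onBasis m).mapDomain (patch b o L) ∧
      ∀ m' ∈ (g.onBasis m).support, Small V L m' := by
    intro g hg hc hc'
    obtain ⟨h1, h2⟩ := Gate.act_shift (o := o) (b := b) hm hWV hL hg hc
    rw [hc.onBasis, hc'.onBasis, h1, Finsupp.mapDomain_single]
    refine ⟨rfl, fun m' hm' => ?_⟩
    have := Finset.mem_singleton.1 (Finsupp.support_single_subset hm')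
    rwa [this]
  cases g with
  | had d =>
    have hd : d < L := by simp only [Gate.Bounded] at hg; omega
    simp only [Gate.shift, Gate.onBasis, Finsupp.mapDomain_add, Finsupp.mapDomain_single]
    rw [patch_add hd, update_patch hd, update_patch hd]
    refine ⟨rfl, fun m' hm' => ?_⟩
    have hv := hm.1 d
    rcases Finset.mem_union.1 (Finsupp.support_add hm') with h | h
    · rw [Finset.mem_singleton.1 (Finsupp.support_single_subset h)]
      exact hm.update hd (by omega)
    · rw [Finset.mem_singleton.1 (Finsupp.support_single_subset h)]
      exact hm.update hd (by omega)
  | phase d k =>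
    simp only [Gate.shift, Gate.onBasis, Finsupp.mapDomain_single]
    rw [patch_add (by simp only [Gate.Bounded] at hg; omega)]
    refine ⟨rfl, fun m' hm' => ?_⟩
    rwa [Finset.mem_singleton.1 (Finsupp.support_single_subset hm')]
  | phaseInv d k =>
    simp only [Gate.shift, Gate.onBasis, Finsupp.mapDomain_single]
    rw [patch_add (by simp only [Gate.Bounded] at hg; omega)]
    refine ⟨rfl, fun m' hm' => ?_⟩
    rwa [Finset.mem_singleton.1 (Finsupp.support_single_subset hm')]
  | _ => exact cl _ hg trivial trivial

theorem Gate.apply_shift {V L W o : ℕ} {b : Mem} {ψ : QState} (hψ : ∀ m ∈ ψ.support, Small V L m)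
    (hWV : W ≤ V) (hV : V % 2 = 1) (hL : W + V < L) {g : Gate} (hg : g.Bounded W) :
    (g.shift o).apply (ψ.mapDomain (patch b o L)) = (g.apply ψ).mapDomain (patch b o L) ∧
      ∀ m ∈ (g.apply ψ).support, Small V L m := by
  classical
  have e : g.apply ψ = ∑ m ∈ ψ.support, ψ m • g.onBasis m := by
    rw [Gate.apply, Finsupp.linearCombination_apply, Finsupp.sum]
  constructor
  · rw [Gate.apply, Finsupp.linearCombination_mapDomain, Finsupp.linearCombination_apply,
      Finsupp.sum, e, Finsupp.mapDomain_finsetSum]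
    refine Finset.sum_congr rfl fun m hm => ?_
    rw [Finsupp.mapDomain_smul, Function.comp_apply,
      (Gate.onBasis_shift (hψ m hm) hWV hV hL hg).1]
  · intro m' hm'
    rw [e] at hm'
    obtain ⟨m, hm, h⟩ := Finset.mem_biUnion.1 (Finsupp.support_finsetSum hm')
    exact (Gate.onBasis_shift (o := o) (b := b) (hψ m hm) hWV hV hL hg).2 m'
      (Finsupp.support_smul h)

/-- A subroutine whose parameters and words are bounded treats the window as its private memory and
ignores the rest, which may therefore be in superposition. -/
theorem circ_shift {V L W o : ℕ} {b : Mem} (hWV : W ≤ V) (hV : V % 2 = 1) (hL : W + V < L)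
    {C : List Gate} (hC : ∀ g ∈ C, g.Bounded W) :
    ∀ {ψ : QState}, (∀ m ∈ ψ.support, Small V L m) →
    circ (C.map (Gate.shift o)) (ψ.mapDomain (patch b o L)) =
      (circ C ψ).mapDomain (patch b o L) ∧ ∀ m ∈ (circ C ψ).support, Small V L m := by
  induction C with
  | nil => exact fun hψ => ⟨rfl, hψ⟩
  | cons g C ih =>
    intro ψ hψ
    obtain ⟨h1, h2⟩ := Gate.apply_shift (o := o) (b := b) hψ hWV hV hL (hC g (by simp))
    rw [List.map_cons, circ_cons, circ_cons, h1]
    exact ih (fun g hg => hC g (by simp [hg])) h2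

/-- A relocated circuit, on a basis state. -/
theorem circ_shift_single {V L W o : ℕ} {b m : Mem} (hWV : W ≤ V) (hV : V % 2 = 1)
    (hL : W + V < L) {C : List Gate} (hC : ∀ g ∈ C, g.Bounded W) (hm : Small V L m) :
    circ (C.map (Gate.shift o)) (Finsupp.single (patch b o L m) 1) =
      (∑ m' ∈ (circ C (Finsupp.single m 1)).support,
        Finsupp.single (patch b o L m') (circ C (Finsupp.single m 1) m')) ∧
      ∀ m' ∈ (circ C (Finsupp.single m 1)).support, Small V L m' := by
  have hm' : ∀ m' ∈ (Finsupp.single m (1 : ℂ)).support, Small V L m' := by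
    intro m' h
    rwa [Finset.mem_singleton.1 (Finsupp.support_single_subset h)]
  obtain ⟨h1, h2⟩ := circ_shift (o := o) (b := b) hWV hV hL hC hm'
  rw [Finsupp.mapDomain_single] at h1
  refine ⟨?_, h2⟩
  rw [h1, Finsupp.mapDomain, Finsupp.sum]

/-! ### Writing a relocated circuit -/

/-- Write the circuit in the arrays `0` to `5`, with addresses increased by `o`; the number of
variables in use is `d`. -/
def relocate (d : ℕ) (o : WExpr) : Writer :=
  .loop (.hi 0 (.lit 0))
    (.ite (.mul (.mul (.hi 1 (.var d))
        (.add (.sub (.hi 1 (.var d)) (.lit 6)) (.sub (.lit 6) (.hi 1 (.var d)))))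
        (.mul (.add (.sub (.hi 1 (.var d)) (.lit 14)) (.sub (.lit 14) (.hi 1 (.var d))))
        (.add (.sub (.hi 1 (.var d)) (.lit 15)) (.sub (.lit 15) (.hi 1 (.var d))))))
      (.emit (.hi 1 (.var d)) (.add (.hi 2 (.var d)) o) (.hi 3 (.var d))
        (.add (.hi 4 (.var d)) o) (.add (.hi 5 (.var d)) o))
      (.emit (.hi 1 (.var d)) (.add (.hi 2 (.var d)) o) (.hi 3 (.var d))
        (.hi 4 (.var d)) (.add (.hi 5 (.var d)) o)))

theorem run_relocate (h : Store) (d : ℕ) (v : ℕ → ℕ) (o : WExpr) (O : ℕ)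
    (ho : ∀ i, o.eval h (Function.update v d i) = O) :
    ((relocate d o).run h d v).map RawGate.gate = (circuitOf h).map (Gate.shift O) := by
  have key : (relocate d o).run h d v = (List.range (h 0 0)).map fun i =>
      RawGate.shift O ⟨h 1 i, h 2 i, h 3 i, h 4 i, h 5 i⟩ := by
    simp only [relocate, Writer.run, WExpr.eval, ho, Function.update_self]
    rw [List.map_eq_flatMap]
    congr 1
    funext i
    generalize h 1 i = op
    simp only [RawGate.shift]
    -- The condition in the writing program is a product of four absolute differences, written with
    -- truncated subtraction; it vanishes exactly for these operations.
    by_cases hc : op = 0 ∨ op = 6 ∨ op = 14 ∨ op = 15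
    · rw [if_neg, if_pos hc]
      rcases hc with rfl | rfl | rfl | rfl <;> simp
    · rw [if_pos, if_neg hc]
      have h1 : op ≠ 0 := by omega
      have h2 : op - 6 + (6 - op) ≠ 0 := by omega
      have h3 : op - 14 + (14 - op) ≠ 0 := by omega
      have h4 : op - 15 + (15 - op) ≠ 0 := by omega
      exact mul_ne_zero (mul_ne_zero h1 h2) (mul_ne_zero h3 h4)
  rw [key, circuitOf]
  simp only [List.map_map]
  congr 1
  funext i
  exact RawGate.gate_shift O _

theorem cost_relocate (h : Store) (d : ℕ) (v : ℕ → ℕ) (o : WExpr) :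
    (relocate d o).cost h d v = 2 + 9 * (circuitOf h).length := by
  have hl : (circuitOf h).length = h 0 0 := by simp [circuitOf]
  simp only [relocate, Writer.cost, hl, WExpr.eval]
  simp [mul_comm]


/-! ## Phases -/

/-- The phase `exp (2 π i x)`. -/
noncomputable def ph (x : ℝ) : ℂ := Complex.exp (2 * Real.pi * Complex.I * x)

theorem ph_add (x y : ℝ) : ph (x + y) = ph x * ph y := by
  rw [ph, ph, ph, ← Complex.exp_add]; congr 1; push_cast; ring

@[simp] theorem ph_zero : ph 0 = 1 := by simp [ph]

theorem ph_int (k : ℤ) : ph k = 1 := by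
  rw [ph, Complex.exp_eq_one_iff]
  exact ⟨k, by push_cast; ring⟩

theorem ph_add_int (x : ℝ) (k : ℤ) : ph (x + k) = ph x := by rw [ph_add, ph_int, mul_one]

@[simp] theorem norm_ph (x : ℝ) : ‖ph x‖ = 1 := by
  have : 2 * (Real.pi : ℂ) * Complex.I * x = ((2 * Real.pi * x : ℝ) : ℂ) * Complex.I := by
    push_cast; ring
  rw [ph, this, Complex.norm_exp_ofReal_mul_I]

theorem ph_sum {ι : Type*} (s : Finset ι) (f : ι → ℝ) : ph (∑ i ∈ s, f i) = ∏ i ∈ s, ph (f i) := by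
  classical
  induction s using Finset.induction_on with
  | empty => simp
  | insert a s ha ih => rw [Finset.sum_insert ha, Finset.prod_insert ha, ph_add, ih]

/-- Phases with denominator `N` see residues only, so all computations before the phase may be done
modulo `N`. -/
theorem ph_div_eq {a b : ℤ} {N : ℕ} (hN : N ≠ 0) (h : (N : ℤ) ∣ a - b) :
    ph ((a : ℝ) / N) = ph ((b : ℝ) / N) := by
  obtain ⟨k, hk⟩ := h
  have hN' : (N : ℝ) ≠ 0 := by exact_mod_cast hN
  have : (a : ℝ) / N = (b : ℝ) / N + (k : ℤ) := by
    have : (a : ℝ) = b + N * k := by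
      have h2 : a = b + N * k := by linarith
      exact_mod_cast h2
    rw [this]; field_simp
  rw [this, ph_add_int]

theorem neg_one_pow_eq_ph (k : ℕ) : (-1 : ℂ) ^ k = ph ((k : ℝ) / 2) := by
  rw [ph, ← Complex.exp_pi_mul_I, ← Complex.exp_nat_mul]
  congr 1; push_cast; ring

/-- A bit is computed, multiplied into the phase and erased again. No work cell stays entangled, so
the effect is a diagonal operator. -/
theorem circ_conj_phase {C : List Gate} (hC : ClassicalCircuit C) (t k : ℕ) (m : Mem) :
    circ (C ++ [.phase t k] ++ invCircuit C) (Finsupp.single m 1) =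
      ph ((actCircuit C m t % 2 : ℕ) / 2 ^ k) • Finsupp.single m 1 := by
  rw [circ_append, circ_append, circ_single hC, circ_cons, circ_nil, Gate.apply_single, one_smul]
  simp only [Gate.onBasis]
  rw [circ_inv_single hC, Finsupp.smul_single, smul_eq_mul, mul_one]
  congr 1
  rw [ph]; congr 1; push_cast; ring

theorem circ_flatMap_diag {R : ℕ} {G : ℕ → List Gate} {m : Mem} {θ : ℕ → ℝ}
    (h : ∀ k < R, circ (G k) (Finsupp.single m 1) = ph (θ k) • Finsupp.single m 1) :
    circ ((List.range R).flatMap G) (Finsupp.single m 1) =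
      ph (∑ k ∈ Finset.range R, θ k) • Finsupp.single m 1 := by
  induction R with
  | zero => simp
  | succ R ih =>
    rw [List.range_succ, List.flatMap_append, circ_append, ih fun k hk => h k (by omega),
      Finset.sum_range_succ, ph_add, map_smul, List.flatMap_singleton, h R (by omega), smul_smul]

theorem actCircuit_flatMap {R : ℕ} {G : ℕ → List Gate} {μ : ℕ → Mem}
    (h : ∀ k < R, actCircuit (G k) (μ k) = μ (k + 1)) :
    actCircuit ((List.range R).flatMap G) (μ 0) = μ R := by
  induction R with
  | zero => simp
  | succ R ih =>
    rw [List.range_succ, List.flatMap_append, actCircuit_append, ih fun k hk => h k (by omega),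
      List.flatMap_singleton, h R (by omega)]

theorem classicalCircuit_flatMap {R : ℕ} {G : ℕ → List Gate}
    (h : ∀ k < R, ClassicalCircuit (G k)) : ClassicalCircuit ((List.range R).flatMap G) := by
  intro g hg
  obtain ⟨k, hk, hg⟩ := List.mem_flatMap.1 hg
  exact h k (List.mem_range.1 hk) g hg

theorem patch_succ (b : Mem) (o k : ℕ) (w : Mem) :
    patch b o (k + 1) w = Function.update (patch b o k w) (o + k) (w k) := by
  funext i
  rw [Function.update_apply]
  unfold patch
  by_cases hi : i = o + k
  · subst hi; simp
  · simp only [hi, if_false]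
    congr 1
    simp only [eq_iff_iff]; omega

theorem patch_zero (b : Mem) (o : ℕ) (w : Mem) : patch b o 0 w = b := by
  funext i; exact if_neg (by omega)

theorem sum_range_mul (E K : ℕ) {M : Type*} [AddCommMonoid M] (f : ℕ → ℕ → M) :
    ∑ q ∈ Finset.range (E * K), f (q / K) (q % K) =
      ∑ e ∈ Finset.range E, ∑ j ∈ Finset.range K, f e j := by
  induction E with
  | zero => simp
  | succ E ih =>
    rw [Nat.succ_mul, Finset.sum_range_add, ih, Finset.sum_range_succ]
    congr 1
    refine Finset.sum_congr rfl fun j hj => ?_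
    have hj := Finset.mem_range.1 hj
    rw [Nat.mul_add_mod', Nat.mod_eq_of_lt hj, Nat.mul_comm, Nat.mul_add_div (by omega), Nat.div_eq_of_lt hj,
      Nat.add_zero]

theorem sum_bits (w K : ℕ) : ∑ l ∈ Finset.range K, w / 2 ^ l % 2 * 2 ^ l = w % 2 ^ K := by
  induction K with
  | zero => simp [Nat.mod_one]
  | succ K ih => rw [Finset.sum_range_succ, ih, Nat.mod_pow_succ, mul_comm]

/-! ## Phase oracles -/

/-- A circuit that computes with small error probability, followed by a phase that depends on the
result and by the inverse of the circuit, almost is a phase. -/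
theorem nsq_conj_sub_le {ι : Type*} {Y : Finset ι} {L P : List Gate} {b : ι → Mem}
    {g : ι → Mem → Mem} {ψ : ι → QState} {φ : ι → Mem → ℂ} {ω : ι → ℂ} {ε : ℝ}
    (hL : ∀ y ∈ Y, circ L (Finsupp.single (b y) 1) =
      ∑ m ∈ (ψ y).support, Finsupp.single (g y m) (ψ y m))
    (hg : ∀ y ∈ Y, ∀ y' ∈ Y, ∀ m ∈ (ψ y).support, ∀ m' ∈ (ψ y').support,
      g y m = g y' m' → y = y' ∧ m = m')
    (hP : ∀ y ∈ Y, ∀ m ∈ (ψ y).support,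
      circ P (Finsupp.single (g y m) 1) = φ y m • Finsupp.single (g y m) 1)
    (hφ : ∀ y ∈ Y, ∀ m ∈ (ψ y).support, ‖φ y m‖ = 1) (hω : ∀ y ∈ Y, ‖ω y‖ = 1)
    (hε : ∀ y ∈ Y, prob (ψ y) {m | φ y m ≠ ω y} ≤ ε) (a : ι → ℂ) :
    nsq (circ (L ++ P ++ invCircuit L) (∑ y ∈ Y, Finsupp.single (b y) (a y)) -
      ∑ y ∈ Y, Finsupp.single (b y) (a y * ω y)) ≤ 4 * ε * ∑ y ∈ Y, ‖a y‖ ^ 2 := by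
  classical
  have s1 : ∀ (m : Mem) (z : ℂ), Finsupp.single m z = z • Finsupp.single m (1 : ℂ) := by
    intro m z; simp
  have hL' : ∀ z : ι → ℂ, circ L (∑ y ∈ Y, Finsupp.single (b y) (z y)) =
      ∑ y ∈ Y, ∑ m ∈ (ψ y).support, Finsupp.single (g y m) (z y * ψ y m) := by
    intro z
    rw [map_sum]
    refine Finset.sum_congr rfl fun y hy => ?_
    rw [s1, map_smul, hL y hy, Finset.smul_sum]
    refine Finset.sum_congr rfl fun m _ => by simp
  -- The target state is written as `L` followed by its inverse. By unitarity the comparison takes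
  -- place before the inverse is applied, where both states are explicit and differ only in the
  -- factors `φ` and `ω`.
  have h1 : circ (L ++ P ++ invCircuit L) (∑ y ∈ Y, Finsupp.single (b y) (a y)) -
      ∑ y ∈ Y, Finsupp.single (b y) (a y * ω y) =
      circ (invCircuit L) (circ P (circ L (∑ y ∈ Y, Finsupp.single (b y) (a y))) -
        circ L (∑ y ∈ Y, Finsupp.single (b y) (a y * ω y))) := by
    rw [map_sub, circ_invCircuit, circ_append, circ_append]
  rw [h1, nsq_circ, hL', hL', map_sum, ← Finset.sum_sub_distrib]
  have h2 : ∀ y ∈ Y, (circ P (∑ m ∈ (ψ y).support, Finsupp.single (g y m) (a y * ψ y m)) -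
      ∑ m ∈ (ψ y).support, Finsupp.single (g y m) (a y * ω y * ψ y m)) =
      ∑ m ∈ (ψ y).support, Finsupp.single (g y m) (a y * ψ y m * (φ y m - ω y)) := by
    intro y hy
    rw [map_sum, ← Finset.sum_sub_distrib]
    refine Finset.sum_congr rfl fun m hm => ?_
    rw [s1 _ (a y * ψ y m), map_smul, hP y hy m hm, Finsupp.smul_single, Finsupp.smul_single,
      ← Finsupp.single_sub]
    congr 1
    simp only [smul_eq_mul, mul_one]; ring
  rw [Finset.sum_congr rfl h2, Finset.sum_sigma', nsq_sum_single
    (Y.sigma fun y => (ψ y).support) (fun x => g x.1 x.2) (fun x => a x.1 * ψ x.1 x.2 * (φ x.1 x.2 - ω x.1))]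
  · rw [Finset.sum_sigma, Finset.mul_sum]
    refine Finset.sum_le_sum fun y hy => ?_
    calc _ ≤ ∑ m ∈ (ψ y).support, 4 * ‖a y‖ ^ 2 *
          (if m ∈ {m | φ y m ≠ ω y} then ‖ψ y m‖ ^ 2 else 0) := by
          refine Finset.sum_le_sum fun m hm => ?_
          by_cases h : φ y m = ω y
          · simp [h]
          -- Branches with the right phase contribute nothing; the others contribute at most `2 ^ 2`
          -- times their probability.
          · have h4 : ‖φ y m - ω y‖ ≤ 2 := by
              have := norm_sub_le (φ y m) (ω y)
              rw [hφ y hy m hm, hω y hy] at this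
              linarith
            have h5 : ‖φ y m - ω y‖ ^ 2 ≤ 2 ^ 2 := by gcongr
            rw [norm_mul, norm_mul, mul_pow, mul_pow]
            simp only [Set.mem_ofPred_eq, ne_eq, h, not_false_eq_true, if_true]
            have h6 : 0 ≤ ‖a y‖ ^ 2 * ‖ψ y m‖ ^ 2 := by positivity
            nlinarith
      _ = 4 * ‖a y‖ ^ 2 * prob (ψ y) {m | φ y m ≠ ω y} := by
          rw [← Finset.mul_sum, prob]; congr!
      _ ≤ 4 * ‖a y‖ ^ 2 * ε := by gcongr; exact hε y hy
      _ = _ := by ring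
  · rintro ⟨y, m⟩ hx ⟨y', m'⟩ hx' h
    simp only [Finset.coe_sigma, Set.mem_sigma_iff, Finset.mem_coe] at hx hx'
    obtain ⟨rfl, rfl⟩ := hg y hx.1 y' hx'.1 m hx.2 m' hx'.2 h
    rfl

/-- The hybrid argument: replacing the actual queries by ideal ones one after another costs `2 √ε`
in norm each time, and unitary circuits do not magnify earlier deviations. -/
theorem nsq_iterate_sub_le {ι : Type*} {Y : Finset ι} {R : ℕ} {G : ℕ → List Gate} {b : ι → Mem}
    {ω : ℕ → ι → ℂ} {ε : ℝ} (hω : ∀ k < R, ∀ y ∈ Y, ‖ω k y‖ = 1) (a : ι → ℂ)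
    (ha : ∑ y ∈ Y, ‖a y‖ ^ 2 ≤ 1) (hε : 0 ≤ ε)
    (hG : ∀ k < R, ∀ a : ι → ℂ, nsq (circ (G k) (∑ y ∈ Y, Finsupp.single (b y) (a y)) -
      ∑ y ∈ Y, Finsupp.single (b y) (a y * ω k y)) ≤ 4 * ε * ∑ y ∈ Y, ‖a y‖ ^ 2) :
    nsq (circ ((List.range R).flatMap G) (∑ y ∈ Y, Finsupp.single (b y) (a y)) -
      ∑ y ∈ Y, Finsupp.single (b y) (a y * ∏ k ∈ Finset.range R, ω k y)) ≤ (R : ℝ) ^ 2 * (4 * ε) := by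
  induction R with
  | zero => simp [nsq]
  | succ R ih =>
    have h1 := ih (fun k hk => hω k (by omega)) (fun k hk => hG k (by omega))
    have h2 := hG R (by omega) fun y => a y * ∏ k ∈ Finset.range R, ω k y
    have h3 : ∑ y ∈ Y, ‖a y * ∏ k ∈ Finset.range R, ω k y‖ ^ 2 = ∑ y ∈ Y, ‖a y‖ ^ 2 := by
      refine Finset.sum_congr rfl fun y hy => ?_
      rw [norm_mul, norm_prod, Finset.prod_eq_one, mul_one]
      exact fun k hk => hω k (by have := Finset.mem_range.1 hk; omega) y hy
    rw [h3] at h2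
    have h4 : 4 * ε * ∑ y ∈ Y, ‖a y‖ ^ 2 ≤ 4 * ε := by nlinarith
    rw [← nsq_circ (G R), map_sub] at h1
    have := nsq_add_le h1 (h2.trans h4)
    rw [List.range_succ, List.flatMap_append, circ_append, List.flatMap_singleton]
    rw [sub_add_sub_cancel] at this
    simpa only [Finset.prod_range_succ, ← mul_assoc] using this


/-! ## The Fourier transform on registers of qubits -/

/-- The circuit of the Fourier transform for qubit number `q`; registers have `K` qubits, qubit
`q` is in cell `b + q`, and cell `t` is a work cell. -/
def fourierStep (K b t N q : ℕ) : List Gate :=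
  .had (b + q) :: (List.range (q % K)).flatMap fun l =>
    [.add t N (.mul (b + (q - q % K) + l) (b + q))] ++ [.phase t (q % K - l + 1)] ++
      invCircuit [.add t N (.mul (b + (q - q % K) + l) (b + q))]

/-- The Fourier transform on `Q` qubits. -/
def fourier (K b t N Q : ℕ) : List Gate :=
  (List.range Q).flatMap fun i => fourierStep K b t N (Q - 1 - i)

/-- The phase that qubit `q` acquires when it is set to `1`. The last summand, with denominator `2`,
is the sign of the Hadamard gate; the others come from the controlled phases of the lower qubits in
the same register. -/
noncomputable def fourierAngle (K b q : ℕ) (m : Mem) : ℝ :=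
  ∑ l ∈ Finset.range (q % K + 1), (m (b + (q - q % K) + l) : ℝ) / 2 ^ (q % K - l + 1)

/-- The memory `m` with the qubits `lo, …, Q - 1` given by their set `y`. -/
def setBits (b lo Q : ℕ) (m : Mem) (y : Finset ℕ) : Mem := fun i =>
  if b + lo ≤ i ∧ i < b + Q then (if i - b ∈ y then 1 else 0) else m i

/-- There is no controlled phase gate, so the product of control and target is computed in the work
cell `t`, followed by a phase on `t` and the inverse computation. -/
theorem circ_fourierStep {K b t N q : ℕ} {m : Mem} (hN : 2 ≤ N) (ht : m t = 0)
    (htb : t < b) (hm : ∀ i, b ≤ i → i ≤ b + q → m i ≤ 1) :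
    circ (fourierStep K b t N q) (Finsupp.single m 1) = (Real.sqrt 2 : ℂ)⁻¹ •
      (Finsupp.single (Function.update m (b + q) 0) 1 +
        ph (fourierAngle K b q m) • Finsupp.single (Function.update m (b + q) 1) 1) := by
  have hq : q % K ≤ q := Nat.mod_le _ _
  have hmq := hm (b + q) (by omega) le_rfl
  have hdiv : m (b + q) / 2 = 0 := by omega
  have loop : ∀ y, y ≤ 1 → circ ((List.range (q % K)).flatMap fun l =>
      [.add t N (.mul (b + (q - q % K) + l) (b + q))] ++ [.phase t (q % K - l + 1)] ++
      invCircuit [.add t N (.mul (b + (q - q % K) + l) (b + q))])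
      (Finsupp.single (Function.update m (b + q) y) 1) =
      ph (∑ l ∈ Finset.range (q % K), (m (b + (q - q % K) + l) * y : ℕ) / 2 ^ (q % K - l + 1)) •
        Finsupp.single (Function.update m (b + q) y) 1 := by
    intro y hy
    refine circ_flatMap_diag fun l hl => ?_
    rw [circ_conj_phase (by intro g hg; rw [List.mem_singleton.1 hg]; trivial)]
    have h1 := hm (b + (q - q % K) + l) (by omega) (by omega)
    have h2 : m (b + (q - q % K) + l) * y ≤ 1 := Nat.mul_le_mul h1 hy
    have e1 : Function.update m (b + q) y t = 0 := by rw [Function.update_of_ne (by omega), ht]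
    have : actCircuit [.add t N (.mul (b + (q - q % K) + l) (b + q))]
        (Function.update m (b + q) y) t = m (b + (q - q % K) + l) * y := by
      simp only [actCircuit_cons, actCircuit_nil, Gate.act, e1, show 0 < N by omega, if_true,
        Function.update_self, Operand.eval]
      rw [Function.update_of_ne (by omega), Function.update_of_ne (by omega),
        Function.update_of_ne (by omega), Function.update_self, Nat.mod_eq_of_lt (by omega)]
      omega
    rw [this, Nat.mod_eq_of_lt (by omega)]
  rw [fourierStep, circ_cons, Gate.apply_single, one_smul]
  simp only [Gate.onBasis, hdiv, mul_zero, zero_add]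
  have s1 : ∀ (m : Mem) (z : ℂ), Finsupp.single m z = z • Finsupp.single m (1 : ℂ) := by
    intro m z; simp
  rw [s1 _ (Real.sqrt 2 : ℂ)⁻¹, s1 _ (_ * _), map_add, map_smul, map_smul, loop 0 (by omega),
    loop 1 le_rfl, smul_add]
  congr 1
  · simp
  · rw [smul_smul, smul_smul, neg_one_pow_eq_ph, mul_right_comm, ← ph_add, mul_comm]
    congr 3
    rw [fourierAngle, Finset.sum_range_succ, add_comm]
    congr 1
    · refine Finset.sum_congr rfl fun l _ => by rw [mul_one]
    · rw [show b + (q - q % K) + q % K = b + q by omega]; simp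

theorem fourierAngle_setBits {K b q lo Q : ℕ} {m : Mem} {y : Finset ℕ} (hq : q < lo) :
    fourierAngle K b q (setBits b lo Q m y) = fourierAngle K b q m := by
  refine Finset.sum_congr rfl fun l hl => ?_
  have := Finset.mem_range.1 hl
  have := Nat.mod_le q K
  rw [setBits, if_neg (by omega)]

theorem update_setBits_zero {b lo Q : ℕ} {m : Mem} {y : Finset ℕ} (hlo : lo < Q) (hy : lo ∉ y) :
    Function.update (setBits b (lo + 1) Q m y) (b + lo) 0 = setBits b lo Q m y := by
  funext i
  rw [Function.update_apply]
  by_cases hi : i = b + lo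
  · subst hi
    simp [setBits, hlo, hy]
  · simp only [hi, if_false, setBits]
    have : (b + (lo + 1) ≤ i ∧ i < b + Q) ↔ (b + lo ≤ i ∧ i < b + Q) := by omega
    simp only [this]

theorem update_setBits_one {b lo Q : ℕ} {m : Mem} {y : Finset ℕ} (hlo : lo < Q) :
    Function.update (setBits b (lo + 1) Q m y) (b + lo) 1 = setBits b lo Q m (insert lo y) := by
  funext i
  rw [Function.update_apply]
  by_cases hi : i = b + lo
  · subst hi
    simp [setBits, hlo]
  · simp only [hi, if_false, setBits]
    by_cases h : b + lo ≤ i ∧ i < b + Q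
    · have h' : b + (lo + 1) ≤ i ∧ i < b + Q := by omega
      have : i - b ∈ insert lo y ↔ i - b ∈ y := by
        rw [Finset.mem_insert]; exact or_iff_right (by omega)
      simp only [h, h', this]
    · have h' : ¬ (b + (lo + 1) ≤ i ∧ i < b + Q) := by omega
      simp only [h, h', if_false]

/-- Qubits are treated from the highest to the lowest. The angle of a qubit involves only itself and
lower ones, so when its turn comes these still have their original values, and the branches simply
double. -/
theorem circ_fourier_aux {K b t N Q : ℕ} {m : Mem} (hN : 2 ≤ N) (ht : m t = 0)
    (htb : t < b) (hm : ∀ i, b ≤ i → i < b + Q → m i ≤ 1) (R : ℕ) (hR : R ≤ Q) :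
    circ ((List.range R).flatMap fun i => fourierStep K b t N (Q - 1 - i)) (Finsupp.single m 1) =
      ((Real.sqrt 2 : ℂ)⁻¹) ^ R • ∑ y ∈ (Finset.Ico (Q - R) Q).powerset,
        Finsupp.single (setBits b (Q - R) Q m y) (ph (∑ q ∈ y, fourierAngle K b q m)) := by
  induction R with
  | zero =>
    have : setBits b Q Q m ∅ = m := by
      funext i; rw [setBits, if_neg (by omega)]
    simp [this]
  | succ R ih =>
    have hI : Finset.Ico (Q - (R + 1)) Q = insert (Q - (R + 1)) (Finset.Ico (Q - R) Q) := by
      ext x; simp only [Finset.mem_Ico, Finset.mem_insert]; omega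
    have hni : Q - (R + 1) ∉ Finset.Ico (Q - R) Q := by simp; omega
    set q := Q - (R + 1) with hq
    have hq1 : Q - R = q + 1 := by omega
    rw [List.range_succ, List.flatMap_append, circ_append, ih (by omega), hI,
      Finset.sum_powerset_insert hni, List.flatMap_singleton, map_smul, map_sum,
      ← Finset.sum_add_distrib, pow_succ, mul_smul]
    congr 1
    rw [Finset.smul_sum]
    refine Finset.sum_congr rfl fun y hy => ?_
    have hqy : q ∉ y := fun h => hni (Finset.mem_powerset.1 hy h)
    have e : Q - 1 - R = q := by omega
    rw [hq1, e]
    have s1 : ∀ (m : Mem) (z : ℂ), Finsupp.single m z = z • Finsupp.single m (1 : ℂ) := by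
      intro m z; simp
    rw [s1, map_smul, circ_fourierStep hN
      (by rw [setBits, if_neg (by omega), ht]) htb, fourierAngle_setBits (by omega),
      update_setBits_zero (by omega) hqy, update_setBits_one (by omega), smul_comm, smul_add,
      Finset.sum_insert hqy]
    · rw [smul_smul, ← ph_add, add_comm (fourierAngle K b q m)]
      simp
    · intro i h1 h2
      rw [setBits]
      split_ifs
      · exact le_rfl
      · exact Nat.zero_le _
      · exact hm i h1 (by omega)

theorem circ_fourier {K b t N Q : ℕ} {m : Mem} (hN : 2 ≤ N) (ht : m t = 0)
    (htb : t < b) (hm : ∀ i, b ≤ i → i < b + Q → m i ≤ 1) :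
    circ (fourier K b t N Q) (Finsupp.single m 1) =
      ∑ y ∈ (Finset.range Q).powerset, Finsupp.single (setBits b 0 Q m y)
        (((Real.sqrt 2 : ℂ)⁻¹) ^ Q * ph (∑ q ∈ y, fourierAngle K b q m)) := by
  rw [fourier, circ_fourier_aux hN ht htb hm Q le_rfl, Finset.smul_sum, Nat.sub_self,
    Nat.Ico_zero_eq_range]
  refine Finset.sum_congr rfl fun y _ => by rw [Finsupp.smul_single, smul_eq_mul]

theorem sum_fourier_coeff (Q : ℕ) :
    ∑ _y ∈ (Finset.range Q).powerset, ‖((Real.sqrt 2 : ℂ)⁻¹) ^ Q‖ ^ 2 = 1 := by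
  have h : ‖((Real.sqrt 2 : ℂ)⁻¹) ^ Q‖ ^ 2 = (1 / 2 : ℝ) ^ Q := by
    rw [norm_pow, ← pow_mul, mul_comm Q 2, pow_mul, norm_inv, Complex.norm_real, Real.norm_eq_abs,
      inv_pow, sq_abs, Real.sq_sqrt (by norm_num), one_div]
  rw [Finset.sum_const, h, Finset.card_powerset, Finset.card_range, nsmul_eq_mul, Nat.cast_pow,
    ← mul_pow]
  norm_num

theorem setBits_injOn (b Q : ℕ) (m : Mem) :
    Set.InjOn (setBits b 0 Q m) ((Finset.range Q).powerset : Finset (Finset ℕ)) := by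
  intro y hy y' hy' h
  simp only [Finset.coe_powerset, Set.mem_preimage, Set.mem_powerset_iff, Finset.coe_subset] at hy hy'
  ext q
  have hz : ∀ q, q < Q → (q ∈ y ↔ q ∈ y') := by
    intro q hq
    have := congrFun h (b + q)
    simp only [setBits, show b + 0 ≤ b + q ∧ b + q < b + Q by omega,
      Nat.add_sub_cancel_left] at this
    by_cases h1 : q ∈ y <;> by_cases h2 : q ∈ y' <;> simp_all
  constructor
  · intro hq; exact (hz q (Finset.mem_range.1 (hy hq))).1 hq
  · intro hq; exact (hz q (Finset.mem_range.1 (hy' hq))).2 hq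

/-- The registers hold the binary digits of the numbers `w`. -/
def bitsOf (b K Q : ℕ) (m : Mem) (w : ℕ → ℕ) : Mem := fun i =>
  if b ≤ i ∧ i < b + Q then w ((i - b) / K) / 2 ^ ((i - b) % K) % 2 else m i

/-- The number in register `e`, read with the most significant digit first. -/
def revValue (K e : ℕ) (y : Finset ℕ) : ℕ :=
  ∑ j ∈ Finset.range K, if e * K + j ∈ y then 2 ^ (K - 1 - j) else 0

/-- Position `j` of a register contributes the fraction of `w` modulo `2 ^ (j + 1)`, which modulo
one is `w * 2 ^ (K - 1 - j) / 2 ^ K`. So the position counts with weight `2 ^ (K - 1 - j)`: the dual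
variable appears with reversed digits. Reading it in this order replaces a final permutation of the
qubits. -/
theorem ph_fourierAngle_bitsOf {b K E : ℕ} (hK : 0 < K) {m : Mem} {w : ℕ → ℕ} {y : Finset ℕ}
    (hy : y ⊆ Finset.range (E * K)) :
    ph (∑ q ∈ y, fourierAngle K b q (bitsOf b K (E * K) m w)) =
      ph ((∑ e ∈ Finset.range E, w e * revValue K e y : ℕ) / 2 ^ K) := by
  have h1 : ∀ q ∈ y, ph (fourierAngle K b q (bitsOf b K (E * K) m w)) =
      ph ((w (q / K) * 2 ^ (K - 1 - q % K) : ℕ) / 2 ^ K) := by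
    intro q hq
    have hqQ := Finset.mem_range.1 (hy hq)
    have hj := Nat.mod_lt q hK
    have hdm := Nat.div_add_mod q K
    have hle := Nat.mod_le q K
    have e1 : fourierAngle K b q (bitsOf b K (E * K) m w) =
        ((w (q / K) % 2 ^ (q % K + 1) : ℕ) : ℝ) / 2 ^ (q % K + 1) := by
      rw [← sum_bits, fourierAngle, Nat.cast_sum, Finset.sum_div]
      refine Finset.sum_congr rfl fun l hl => ?_
      have hl := Finset.mem_range.1 hl
      have hsub : b + (q - q % K) + l - b = K * (q / K) + l := by omega
      rw [bitsOf, if_pos (by omega), hsub, Nat.mul_add_div hK,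
        Nat.div_eq_of_lt (show l < K by omega), Nat.mul_add_mod, Nat.mod_eq_of_lt (show l < K by omega), Nat.add_zero]
      have : (2 : ℝ) ^ (q % K + 1) = 2 ^ (q % K - l + 1) * 2 ^ l := by
        rw [← pow_add]; congr 1; omega
      push_cast
      rw [this]
      field_simp
    have e2 : ((w (q / K) * 2 ^ (K - 1 - q % K) : ℕ) : ℝ) / 2 ^ K =
        ((w (q / K) % 2 ^ (q % K + 1) : ℕ) : ℝ) / 2 ^ (q % K + 1) +
          ((w (q / K) / 2 ^ (q % K + 1) : ℕ) : ℤ) := by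
      have : (2 : ℝ) ^ K = 2 ^ (q % K + 1) * 2 ^ (K - 1 - q % K) := by
        rw [← pow_add]; congr 1; omega
      have h3 : (w (q / K) : ℝ) = 2 ^ (q % K + 1) * (w (q / K) / 2 ^ (q % K + 1) : ℕ) +
          (w (q / K) % 2 ^ (q % K + 1) : ℕ) := by
        exact_mod_cast (Nat.div_add_mod (w (q / K)) (2 ^ (q % K + 1))).symm
      generalize w (q / K) / 2 ^ (q % K + 1) = A at h3 ⊢
      generalize w (q / K) % 2 ^ (q % K + 1) = B at h3 ⊢
      rw [this]
      push_cast at h3 ⊢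
      rw [mul_div_mul_right _ _ (by positivity)]
      field_simp
      linarith
    rw [e1, e2, ph_add_int]
  rw [ph_sum, Finset.prod_congr rfl h1, ← ph_sum, ← Finset.sum_div]
  congr 2
  rw [← Nat.cast_sum]
  congr 1
  have e3 : ∀ e, w e * revValue K e y =
      ∑ j ∈ Finset.range K, if e * K + j ∈ y then w e * 2 ^ (K - 1 - j) else 0 := by
    intro e
    rw [revValue, Finset.mul_sum]
    refine Finset.sum_congr rfl fun j _ => by split_ifs <;> simp
  rw [Finset.sum_congr rfl fun e _ => e3 e, ← sum_range_mul E K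
    (fun e j => if e * K + j ∈ y then w e * 2 ^ (K - 1 - j) else 0),
    ← Finset.sum_subset hy (by
      intro q _ hq
      rw [mul_comm, Nat.div_add_mod, if_neg hq])]
  refine Finset.sum_congr rfl fun q hq => ?_
  rw [mul_comm (q / K), Nat.div_add_mod, if_pos hq]

theorem revValue_lt (K e : ℕ) (y : Finset ℕ) : revValue K e y < 2 ^ K := by
  have h : revValue K e y ≤ ∑ j ∈ Finset.range K, 2 ^ (K - 1 - j) :=
    Finset.sum_le_sum fun j _ => by split_ifs <;> simp
  rw [Finset.sum_range_reflect (fun j => 2 ^ j)] at h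
  have := Nat.geomSum_lt (m := 2) (n := K) (s := Finset.range K) le_rfl (by simp)
  omega

/-- The transforms of all inputs `w` live on the same family of basis states; only the phases depend
on `w`. -/
theorem setBits_bitsOf (b K Q : ℕ) (m : Mem) (w : ℕ → ℕ) (y : Finset ℕ) :
    setBits b 0 Q (bitsOf b K Q m w) y = setBits b 0 Q m y := by
  funext i
  simp only [setBits, bitsOf]
  split_ifs <;> first | rfl | omega


/-! ## A symmetric matrix whose cube has the trace of a triple product -/

/-- The part above the diagonal of a tripartite matrix with blocks of size `m`. -/
def triEntry {R : Type*} [Zero R] (m : ℕ) (α β γ : ℕ → ℕ → R) (p q : ℕ) : R :=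
  if p / m = 0 ∧ q / m = 1 then α (p % m) (q % m)
  else if p / m = 1 ∧ q / m = 2 then β (p % m) (q % m)
  else if p / m = 0 ∧ q / m = 2 then γ (p % m) (q % m)
  else 0

/-- The symmetric tripartite matrix with blocks `α`, `β`, `γ` of size `m`. -/
def triMatrix (s m : ℕ) (α β γ : ℕ → ℕ → ℤ) : Matrix (Fin s) (Fin s) ℤ :=
  Matrix.of fun p q => triEntry m α β γ (min p q : ℕ) (max p q : ℕ)

theorem triMatrix_isSymm (s m : ℕ) (α β γ : ℕ → ℕ → ℤ) : (triMatrix s m α β γ).IsSymm := by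
  ext p q
  simp [triMatrix, min_comm, max_comm]

theorem sum_range_blocks {M : Type*} [AddCommMonoid M] {s m : ℕ} (hs : 3 * m ≤ s) (f : ℕ → M)
    (hf : ∀ p, 3 * m ≤ p → f p = 0) :
    ∑ p ∈ Finset.range s, f p =
      ∑ a ∈ Finset.range m, (f a + f (m + a) + f (2 * m + a)) := by
  have h1 : ∑ p ∈ Finset.range s, f p = ∑ p ∈ Finset.range (m + m + m), f p := by
    refine (Finset.sum_subset ?_ ?_).symm
    · intro p hp; simp only [Finset.mem_range] at hp ⊢; omega
    · intro p _ hp; simp only [Finset.mem_range] at hp; exact hf p (by omega)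
  rw [h1, Finset.sum_range_add, Finset.sum_range_add, Finset.sum_add_distrib,
    Finset.sum_add_distrib]
  simp only [← two_mul]

/-- Nonzero entries join different classes only, so a closed walk of length three passes through all
three classes. Three starting points and two directions make the factor six. Indices from `3 * m` on
are isolated. -/
theorem trace_triMatrix {s m : ℕ} (hs : 3 * m ≤ s) (α β γ : ℕ → ℕ → ℤ) :
    (triMatrix s m α β γ ^ 3).trace = 6 * ∑ a ∈ Finset.range m, ∑ b ∈ Finset.range m,
      ∑ c ∈ Finset.range m, α a b * β b c * γ a c := by
  set μ : ℕ → ℕ → ℤ := fun p q => triEntry m α β γ (min p q) (max p q) with hμ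
  have htr : (triMatrix s m α β γ ^ 3).trace = ∑ p ∈ Finset.range s, ∑ q ∈ Finset.range s,
      ∑ r ∈ Finset.range s, μ p q * μ q r * μ r p := by
    have h1 : ∀ i j, triMatrix s m α β γ i j = μ i j := fun i j => by simp [triMatrix, hμ]
    rw [pow_succ, pow_two, Matrix.trace]
    simp only [Matrix.diag_apply, Matrix.mul_apply, h1, Finset.sum_range]
    refine Finset.sum_congr rfl fun p _ => ?_
    simp only [Finset.sum_mul]
    rw [Finset.sum_comm]
  rcases Nat.eq_zero_or_pos m with rfl | hm
  · have : ∀ p q, μ p q = 0 := by intro p q; simp [hμ, triEntry]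
    rw [htr]; simp [this]
  have hz : ∀ p q, 3 * m ≤ p ∨ 3 * m ≤ q → μ p q = 0 := by
    intro p q h
    have : 3 ≤ max p q / m := by
      rw [Nat.le_div_iff_mul_le hm]; omega
    simp only [hμ, triEntry]
    rw [if_neg (by omega), if_neg (by omega), if_neg (by omega)]
  have dv : ∀ P a, a < m → (P * m + a) / m = P ∧ (P * m + a) % m = a := by
    intro P a ha
    refine ⟨?_, ?_⟩
    · rw [Nat.mul_comm, Nat.mul_add_div hm, Nat.div_eq_of_lt ha, Nat.add_zero]
    · rw [Nat.mul_add_mod', Nat.mod_eq_of_lt ha]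
  have val : ∀ P Q a b, a < m → b < m → P < Q →
      μ (P * m + a) (Q * m + b) = μ (Q * m + b) (P * m + a) ∧
      μ (P * m + a) (Q * m + b) = (if P = 0 ∧ Q = 1 then α a b else if P = 1 ∧ Q = 2 then β a b
        else if P = 0 ∧ Q = 2 then γ a b else 0) := by
    intro P Q a b ha hb hPQ
    have hlt : P * m + a < Q * m + b := by
      have : (P + 1) * m ≤ Q * m := Nat.mul_le_mul_right m hPQ
      rw [Nat.add_mul] at this; omega
    simp only [hμ, min_eq_left hlt.le, max_eq_right hlt.le, min_eq_right hlt.le,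
      max_eq_left hlt.le, triEntry, (dv P a ha).1, (dv P a ha).2, (dv Q b hb).1, (dv Q b hb).2]
    exact ⟨trivial, trivial⟩
  have dg : ∀ P a b, a < m → b < m → μ (P * m + a) (P * m + b) = 0 := by
    intro P a b ha hb
    rcases le_total (P * m + a) (P * m + b) with h | h
    · simp only [hμ, min_eq_left h, max_eq_right h, triEntry, (dv P a ha).1, (dv P b hb).1]
      rw [if_neg (by omega), if_neg (by omega), if_neg (by omega)]
    · simp only [hμ, min_eq_right h, max_eq_left h, triEntry, (dv P a ha).1, (dv P b hb).1]
      rw [if_neg (by omega), if_neg (by omega), if_neg (by omega)]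
  set t : ℕ → ℕ → ℕ → ℤ := fun a b c => α a b * β b c * γ a c with ht
  -- Of the 27 ways to assign `p`, `q`, `r` to the classes, the six permutations survive; renaming
  -- the summation indices identifies their sums.
  have hexp : ∑ p ∈ Finset.range s, ∑ q ∈ Finset.range s,
      ∑ r ∈ Finset.range s, μ p q * μ q r * μ r p =
      ∑ a ∈ Finset.range m, ∑ b ∈ Finset.range m, ∑ c ∈ Finset.range m,
        (t a b c + t a c b + t b a c + t b c a + t c a b + t c b a) := by
    rw [sum_range_blocks hs _ (fun p hp => Finset.sum_eq_zero fun q _ => Finset.sum_eq_zero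
      fun r _ => by rw [hz p q (.inl hp)]; ring)]
    refine Finset.sum_congr rfl fun a ha => ?_
    have ha := Finset.mem_range.1 ha
    rw [← Finset.sum_add_distrib, ← Finset.sum_add_distrib]
    rw [sum_range_blocks hs _ (fun q hq => by
      rw [← Finset.sum_add_distrib, ← Finset.sum_add_distrib]
      exact Finset.sum_eq_zero fun r _ => by
        rw [hz _ q (.inr hq), hz _ q (.inr hq), hz _ q (.inr hq)]; ring)]
    refine Finset.sum_congr rfl fun b hb => ?_
    have hb := Finset.mem_range.1 hb
    simp only [← Finset.sum_add_distrib]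
    rw [sum_range_blocks hs _ (fun r hr => by
      simp only [hz _ r (.inr hr)]; ring)]
    refine Finset.sum_congr rfl fun c hc => ?_
    have hc := Finset.mem_range.1 hc
    have d0 : ∀ a b, a < m → b < m → μ a b = 0 := fun a b ha hb => by
      simpa using dg 0 a b ha hb
    have d1 : ∀ a b, a < m → b < m → μ (m + a) (m + b) = 0 := fun a b ha hb => by
      simpa using dg 1 a b ha hb
    have d2 : ∀ a b, a < m → b < m → μ (2 * m + a) (2 * m + b) = 0 := fun a b ha hb => dg 2 a b ha hb
    have e01 : ∀ a b, a < m → b < m → μ a (m + b) = α a b ∧ μ (m + b) a = α a b := by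
      intro a b ha hb
      have := val 0 1 a b ha hb (by norm_num)
      simp only [Nat.zero_mul, Nat.zero_add, Nat.one_mul] at this
      exact ⟨by simpa using this.2, this.1.symm.trans (by simpa using this.2)⟩
    have e12 : ∀ a b, a < m → b < m → μ (m + a) (2 * m + b) = β a b ∧ μ (2 * m + b) (m + a) = β a b := by
      intro a b ha hb
      have := val 1 2 a b ha hb (by norm_num)
      simp only [Nat.one_mul] at this
      exact ⟨by simpa using this.2, this.1.symm.trans (by simpa using this.2)⟩
    have e02 : ∀ a b, a < m → b < m → μ a (2 * m + b) = γ a b ∧ μ (2 * m + b) a = γ a b := by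
      intro a b ha hb
      have := val 0 2 a b ha hb (by norm_num)
      simp only [Nat.zero_mul, Nat.zero_add] at this
      exact ⟨by simpa using this.2, this.1.symm.trans (by simpa using this.2)⟩
    simp only [d0, d1, d2, (e01 _ _ _ _).1, (e01 _ _ _ _).2, (e12 _ _ _ _).1, (e12 _ _ _ _).2,
      (e02 _ _ _ _).1, (e02 _ _ _ _).2, ha, hb, hc, ht]
    ring
  rw [htr, hexp]
  simp only [Finset.sum_add_distrib]
  have S1 : ∑ a ∈ Finset.range m, ∑ b ∈ Finset.range m, ∑ c ∈ Finset.range m, t a c b =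
      ∑ a ∈ Finset.range m, ∑ b ∈ Finset.range m, ∑ c ∈ Finset.range m, t a b c :=
    Finset.sum_congr rfl fun a _ => Finset.sum_comm
  have S2 : ∑ a ∈ Finset.range m, ∑ b ∈ Finset.range m, ∑ c ∈ Finset.range m, t b a c =
      ∑ a ∈ Finset.range m, ∑ b ∈ Finset.range m, ∑ c ∈ Finset.range m, t a b c := Finset.sum_comm
  have S3 : ∑ a ∈ Finset.range m, ∑ b ∈ Finset.range m, ∑ c ∈ Finset.range m, t b c a =
      ∑ a ∈ Finset.range m, ∑ b ∈ Finset.range m, ∑ c ∈ Finset.range m, t a b c := by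
    rw [Finset.sum_comm, ← S1]
  have S4 : ∑ a ∈ Finset.range m, ∑ b ∈ Finset.range m, ∑ c ∈ Finset.range m, t c a b =
      ∑ a ∈ Finset.range m, ∑ b ∈ Finset.range m, ∑ c ∈ Finset.range m, t a b c := by
    rw [← S2]
    exact Finset.sum_congr rfl fun a _ => Finset.sum_comm
  have S5 : ∑ a ∈ Finset.range m, ∑ b ∈ Finset.range m, ∑ c ∈ Finset.range m, t c b a =
      ∑ a ∈ Finset.range m, ∑ b ∈ Finset.range m, ∑ c ∈ Finset.range m, t a b c := by
    rw [Finset.sum_comm, ← S4]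
  rw [S1, S2, S3, S4, S5]; ring


/-! ## The circuit for the matrix product -/

theorem index_lt {i j n : ℕ} (hi : i < n) (hj : j < n) : i * n + j < n ^ 2 := by
  have h1 : (i + 1) * n ≤ n * n := Nat.mul_le_mul_right n hi
  rw [Nat.add_mul] at h1
  rw [pow_two]; omega

/-- Partial sums are at most the total, which is below `N`, so no addition wraps around. -/
theorem act_accumulate {t N K : ℕ} {c d : ℕ → ℕ} {m : Mem} (hc : ∀ j < K, c j ≠ t)
    (hd : ∀ j < K, d j ≠ t)
    (hN : m t + ∑ j ∈ Finset.range K, m (c j) * m (d j) < N) :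
    actCircuit ((List.range K).flatMap fun j => [.add t N (.mul (c j) (d j))]) m =
      Function.update m t (m t + ∑ j ∈ Finset.range K, m (c j) * m (d j)) := by
  have h := actCircuit_flatMap (R := K) (G := fun j => [.add t N (.mul (c j) (d j))])
    (μ := fun k => Function.update m t (m t + ∑ j ∈ Finset.range k, m (c j) * m (d j))) ?_
  · simpa using h
  · intro k hk
    have h1 : m t + ∑ j ∈ Finset.range (k + 1), m (c j) * m (d j) < N :=
      lt_of_le_of_lt (Nat.add_le_add_left (Finset.sum_le_sum_of_subset (by
        intro x hx; simp only [Finset.mem_range] at hx ⊢; omega)) _) hN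
    rw [Finset.sum_range_succ] at h1 ⊢
    simp only [actCircuit_cons, actCircuit_nil, Gate.act, Function.update_self,
      Function.update_idem, Operand.eval, Function.update_of_ne (hc k hk),
      Function.update_of_ne (hd k hk)]
    rw [if_pos (by omega), Nat.mod_eq_of_lt (by omega), Nat.add_assoc]

/-- Sizes and addresses: matrices of size `n` are multiplied with the help of matrices of size
`s` with blocks of size `m`; numbers are taken modulo `N = 2 ^ K`; from `a` on there are
constants and work cells, from `b` on qubits, and from `o` on the memory of the subroutine. -/
structure Params where
  n : ℕ
  s : ℕ
  m : ℕ
  K : ℕ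
  N : ℕ
  S : ℕ
  a : ℕ
  b : ℕ
  o : ℕ

namespace Params

/-- Layout of the memory: `4 * n ^ 2` input and `2 * n ^ 2` output cells; from `a` on the `K` powers
of two, the constants six and `S`, and three work cells; from `b` on the `n ^ 2 * K` qubits; from
`o` on the subroutine. By `hnm`, five blocks cover an index range. -/
structure Valid (P : Params) : Prop where
  hn : P.n ≤ P.s
  hm : 3 * P.m ≤ P.s
  hm0 : 0 < P.m
  hnm : P.n ≤ 5 * P.m
  hK : 0 < P.K
  hN : P.N = 2 ^ P.K
  h6 : 6 < P.N
  hS : P.S < P.N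
  ha : P.a = 6 * P.n ^ 2
  hb : P.b = P.a + P.K + 5
  ho : P.o = P.b + P.n ^ 2 * P.K

variable (P : Params)

/-- Compute the constants. -/
def setup : List Gate :=
  [.add P.a P.N (.const 1)] ++ ((List.range (P.K - 1)).flatMap fun j =>
    [.add (P.a + j + 1) P.N (.copy (P.a + j)), .add (P.a + j + 1) P.N (.copy (P.a + j))]) ++
  [.add (P.a + P.K) P.N (.const 6), .add (P.a + P.K + 1) P.N (.const P.S)]

def loadEntry (k base i j : ℕ) : List Gate :=
  if i < P.n ∧ j < P.n then [.add (P.o + k) P.N (.copy (base + 2 * (i * P.n + j) + k % 2))] else []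

/-- The weights run backwards through the powers of two, to match the reversed digits of `revValue`.
The dual entries are nonnegative, so only the words for positive parts are filled. -/
def loadQubits (k i j : ℕ) : List Gate :=
  if i < P.n ∧ j < P.n ∧ k % 2 = 0 then (List.range P.K).flatMap fun l =>
    [.add (P.o + k) P.N (.mul (P.b + (i * P.n + j) * P.K + l) (P.a + (P.K - 1 - l)))] else []

/-- Compute one word of the input of the subroutine. -/
def loadCell (I J H k : ℕ) : List Gate :=
  let p := k / 2 / P.s
  let q := k / 2 % P.s
  let lo := min p q
  let hi := max p q
  if lo / P.m = 0 ∧ hi / P.m = 1 then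
    P.loadEntry k 0 (I * P.m + lo % P.m) (J * P.m + hi % P.m)
  else if lo / P.m = 1 ∧ hi / P.m = 2 then
    P.loadEntry k (2 * P.n ^ 2) (J * P.m + lo % P.m) (H * P.m + hi % P.m)
  else if lo / P.m = 0 ∧ hi / P.m = 2 then
    P.loadQubits k (I * P.m + lo % P.m) (H * P.m + hi % P.m)
  else []

/-- Compute the input of the subroutine. -/
def load (I J H : ℕ) : List Gate := (List.range (2 * P.s ^ 2)).flatMap (P.loadCell I J H)

/-- Binary digit `j` of a number z is the parity of z / 2 ^ j, and its share of z / 2 ^ K is the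
digit divided by `2 ^ (K - j)`. -/
def phaseStep (j : ℕ) : List Gate :=
  [.add (P.a + P.K + 4) P.N (.div (P.a + P.K + 3) (P.a + j))] ++
    [.phase (P.a + P.K + 4) (P.K - j)] ++
    invCircuit [.add (P.a + P.K + 4) P.N (.div (P.a + P.K + 3) (P.a + j))]

def phasePrep : List Gate :=
  [.add (P.a + P.K + 3) P.N (.div (P.o + 2 * P.s ^ 2) (P.a + P.K)),
    .sub (P.a + P.K + 3) P.N (.div (P.o + 2 * P.s ^ 2 + 1) (P.a + P.K))]

/-- The phase that belongs to one sixth of the output of the subroutine. -/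
def phases : List Gate :=
  P.phasePrep ++ (List.range P.K).flatMap P.phaseStep ++ invCircuit P.phasePrep

/-- The three digits of `k` in base five select the block triple. -/
def oracle (C : List Gate) (k : ℕ) : List Gate :=
  (P.load (k / 5 / 5) (k / 5 % 5) (k % 5) ++ C.map (Gate.shift P.o)) ++ P.phases ++
    invCircuit (P.load (k / 5 / 5) (k / 5 % 5) (k % 5) ++ C.map (Gate.shift P.o))

/-- After the inverse transform the digits stand in their natural order. Adding `S` moves the
admissible entries to the interval from `0` to `2 * S`, so that truncated subtraction can separate
positive and negative parts. -/
def outPrep (k : ℕ) : List Gate :=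
  ((List.range P.K).flatMap fun j =>
    [.add (P.a + P.K + 3) P.N (.mul (P.b + k / 2 * P.K + j) (P.a + j))]) ++
    [.add (P.a + P.K + 3) P.N (.copy (P.a + P.K + 1))]

def outStep (k : ℕ) : List Gate :=
  P.outPrep k ++
    (if k % 2 = 0 then [.add (4 * P.n ^ 2 + k) P.N (.monus (P.a + P.K + 3) (P.a + P.K + 1))]
      else [.add (4 * P.n ^ 2 + k) P.N (.monus (P.a + P.K + 1) (P.a + P.K + 3))]) ++
    invCircuit (P.outPrep k)

/-- Compute the output. -/
def out : List Gate := (List.range (2 * P.n ^ 2)).flatMap P.outStep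

def fourierPart : List Gate := fourier P.K P.b (P.a + P.K + 2) P.N (P.n ^ 2 * P.K)

/-- The circuit for the matrix product, with the subroutine `C`. -/
def circuit (C : List Gate) : List Gate :=
  P.setup ++ (P.fourierPart ++ (List.range 125).flatMap (P.oracle C) ++ invCircuit P.fourierPart) ++
    P.out

/-- The constants are present, the work cells are clear, and the input is `w`. -/
structure Ready (w : ℕ → ℕ) (m : Mem) : Prop where
  input : ∀ i < 4 * P.n ^ 2, m i = w i
  output : ∀ i, 4 * P.n ^ 2 ≤ i → i < 6 * P.n ^ 2 → m i = 0
  pow : ∀ j < P.K, m (P.a + j) = 2 ^ j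
  six : m (P.a + P.K) = 6
  shift : m (P.a + P.K + 1) = P.S
  work : ∀ i, P.a + P.K + 2 ≤ i → i < P.b → m i = 0
  high : ∀ i, P.o ≤ i → m i = 0

variable {P}

theorem Ready.congr {w : ℕ → ℕ} {m m' : Mem} (hP : P.Valid) (h : P.Ready w m)
    (hm : ∀ i, i < P.b ∨ P.o ≤ i → m' i = m i) : P.Ready w m' := by
  obtain ⟨-, -, -, -, -, -, -, -, ha, hb, ho⟩ := hP
  refine ⟨?_, ?_, ?_, ?_, ?_, ?_, ?_⟩
  · intro i hi; rw [hm i (by omega)]; exact h.input i hi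
  · intro i h1 h2; rw [hm i (by omega)]; exact h.output i h1 h2
  · intro j hj; rw [hm _ (by omega)]; exact h.pow j hj
  · rw [hm _ (by omega)]; exact h.six
  · rw [hm _ (by omega)]; exact h.shift
  · intro i h1 h2; rw [hm i (by omega)]; exact h.work i h1 h2
  · intro i h1; rw [hm i (by omega)]; exact h.high i h1

theorem setup_ready (hP : P.Valid) {w : ℕ → ℕ} (hw : ∀ i ≥ 4 * P.n ^ 2, w i = 0) :
    P.Ready w (actCircuit P.setup w) ∧
      ∀ i, P.b ≤ i → actCircuit P.setup w i = 0 := by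
  obtain ⟨-, -, -, -, hK, hN, h6, hS, ha, hb, ho⟩ := hP
  set c : Mem := fun i => 2 ^ i with hc
  have h1 : actCircuit [.add P.a P.N (.const 1)] w = patch w P.a 1 c := by
    rw [patch_succ, patch_zero]
    simp [actCircuit_cons, Gate.act, Operand.eval, hw P.a (by omega), hc,
      show 0 < P.N by omega, Nat.mod_eq_of_lt (show 1 < P.N by omega)]
  -- Each power of two is obtained by adding the previous one twice to a clear cell.
  have h2 : actCircuit ((List.range (P.K - 1)).flatMap fun j =>
    [.add (P.a + j + 1) P.N (.copy (P.a + j)), .add (P.a + j + 1) P.N (.copy (P.a + j))])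
      (patch w P.a 1 c) = patch w P.a (P.K - 1 + 1) c := by
    refine actCircuit_flatMap (μ := fun j => patch w P.a (j + 1) c) fun j hj => ?_
    have e1 : patch w P.a (j + 1) c (P.a + j + 1) = 0 := by
      rw [patch_of_not (by omega)]; exact hw _ (by omega)
    have e2 : patch w P.a (j + 1) c (P.a + j) = 2 ^ j := by
      rw [Nat.add_comm P.a j, patch_add (by omega)]
    have hlt : 2 ^ j * 2 < P.N := by
      rw [hN, ← pow_succ]; exact Nat.pow_lt_pow_right (by norm_num) (by omega)
    simp only [actCircuit_cons, actCircuit_nil, Gate.act, Operand.eval, e1,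
      Function.update_of_ne (show P.a + j ≠ P.a + j + 1 by omega), e2, zero_add]
    rw [if_pos (show 0 < P.N by omega), Function.update_self, Nat.mod_eq_of_lt (by omega),
      if_pos (by omega), Function.update_idem,
      Function.update_of_ne (show P.a + j ≠ P.a + j + 1 by omega),
      e2, patch_succ w P.a (j + 1), ← Nat.mul_two, Nat.mod_eq_of_lt hlt]
    rfl
  have h3 : actCircuit P.setup w = Function.update (Function.update (patch w P.a P.K c)
      (P.a + P.K) 6) (P.a + P.K + 1) P.S := by
    rw [setup, actCircuit_append, actCircuit_append, h1, h2, Nat.sub_add_cancel hK]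
    have e1 : patch w P.a P.K c (P.a + P.K) = 0 := by
      rw [patch_of_not (by omega)]; exact hw _ (by omega)
    have e2 : patch w P.a P.K c (P.a + P.K + 1) = 0 := by
      rw [patch_of_not (by omega)]; exact hw _ (by omega)
    simp only [actCircuit_cons, actCircuit_nil, Gate.act, Operand.eval, e1, zero_add,
      show 0 < P.N by omega, if_true,
      Function.update_of_ne (show P.a + P.K + 1 ≠ P.a + P.K by omega), e2,
      Nat.mod_eq_of_lt h6, Nat.mod_eq_of_lt hS]
  have hv : ∀ i, actCircuit P.setup w i = if i = P.a + P.K + 1 then P.S else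
      if i = P.a + P.K then 6 else if P.a ≤ i ∧ i < P.a + P.K then 2 ^ (i - P.a) else w i := by
    intro i
    rw [h3, Function.update_apply, Function.update_apply]
    rfl
  refine ⟨⟨?_, ?_, ?_, ?_, ?_, ?_, ?_⟩, ?_⟩
  · intro i hi
    rw [hv, if_neg (by omega), if_neg (by omega), if_neg (by omega)]
  · intro i h1 h2
    rw [hv, if_neg (by omega), if_neg (by omega), if_neg (by omega), hw i h1]
  · intro j hj
    rw [hv, if_neg (by omega), if_neg (by omega), if_pos (by omega), Nat.add_sub_cancel_left]
  · rw [hv, if_neg (by omega), if_pos rfl]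
  · rw [hv, if_pos rfl]
  · intro i h1 h2
    rw [hv, if_neg (by omega), if_neg (by omega), if_neg (by omega), hw i (by omega)]
  · intro i h1
    rw [hv, if_neg (by omega), if_neg (by omega), if_neg (by omega), hw i (by omega)]
  · intro i h1
    rw [hv, if_neg (by omega), if_neg (by omega), if_neg (by omega), hw i (by omega)]

/-! ### The input of the subroutine -/

def entryWord (P : Params) (m : Mem) (base r i j : ℕ) : ℕ :=
  if i < P.n ∧ j < P.n then m (base + 2 * (i * P.n + j) + r) else 0

def qubitWord (P : Params) (y : Finset ℕ) (r i j : ℕ) : ℕ :=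
  if i < P.n ∧ j < P.n ∧ r = 0 then revValue P.K (i * P.n + j) y else 0

/-- The words that are loaded. -/
def loadWord (P : Params) (m : Mem) (y : Finset ℕ) (I J H k : ℕ) : ℕ :=
  triEntry P.m (fun i j => P.entryWord m 0 (k % 2) (I * P.m + i) (J * P.m + j))
    (fun i j => P.entryWord m (2 * P.n ^ 2) (k % 2) (J * P.m + i) (H * P.m + j))
    (fun i j => P.qubitWord y (k % 2) (I * P.m + i) (H * P.m + j))
    (min (k / 2 / P.s) (k / 2 % P.s)) (max (k / 2 / P.s) (k / 2 % P.s))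

/-- Cells are loaded in increasing order into clear memory. All loaded words are below `N`, so
addition modulo `N` onto a clear cell is a faithful copy. -/
theorem act_loadCell (hP : P.Valid) {w : ℕ → ℕ} {m : Mem} {y : Finset ℕ}
    (hm : P.Ready w m) (hw : ∀ i < 4 * P.n ^ 2, w i < P.N)
    (hy : ∀ q < P.n ^ 2 * P.K, m (P.b + q) = if q ∈ y then 1 else 0) (I J H k : ℕ) :
    actCircuit (P.loadCell I J H k) (patch m P.o k (P.loadWord m y I J H)) =
      patch m P.o (k + 1) (P.loadWord m y I J H) := by
  have hV := hP
  obtain ⟨-, -, -, -, hK, hN, h6, hS, ha, hb, ho⟩ := hP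
  set μ := patch m P.o k (P.loadWord m y I J H) with hμ
  have h0 : μ (P.o + k) = 0 := by
    rw [hμ, patch_of_not (by omega)]; exact hm.high _ (by omega)
  have hlow : ∀ i < P.o, μ i = m i := fun i hi => by rw [hμ, patch_of_not (by omega)]
  have hEntry : ∀ base i j, base ≤ 2 * P.n ^ 2 → actCircuit (P.loadEntry k base i j) μ =
      Function.update μ (P.o + k) (P.entryWord m base (k % 2) i j) := by
    intro base i j hbase
    unfold loadEntry entryWord
    split_ifs with hij
    · have hlt := index_lt hij.1 hij.2
      have h4 : base + 2 * (i * P.n + j) + k % 2 < 4 * P.n ^ 2 := by omega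
      simp only [actCircuit_cons, actCircuit_nil, Gate.act, Operand.eval, h0, zero_add,
        show 0 < P.N by omega, if_true]
      rw [Function.update_of_ne (by omega), hlow _ (by omega), hm.input _ h4,
        Nat.mod_eq_of_lt (hw _ h4)]
    · rw [← h0, Function.update_eq_self]; rfl
  have hQubits : ∀ i j, actCircuit (P.loadQubits k i j) μ =
      Function.update μ (P.o + k) (P.qubitWord y (k % 2) i j) := by
    intro i j
    unfold loadQubits qubitWord
    split_ifs with hij
    · have hlt := index_lt hij.1 hij.2.1
      have hQ : ∀ l < P.K, (i * P.n + j) * P.K + l < P.n ^ 2 * P.K := by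
        intro l hl
        have : (i * P.n + j + 1) * P.K ≤ P.n ^ 2 * P.K := Nat.mul_le_mul_right _ hlt
        rw [Nat.add_mul] at this; omega
      have hsum : ∑ l ∈ Finset.range P.K, μ (P.b + (i * P.n + j) * P.K + l) *
          μ (P.a + (P.K - 1 - l)) = revValue P.K (i * P.n + j) y := by
        refine Finset.sum_congr rfl fun l hl => ?_
        have hl := Finset.mem_range.1 hl
        have := hQ l hl
        rw [hlow _ (by omega), hlow _ (by omega), Nat.add_assoc, hy _ this, hm.pow _ (by omega)]
        split_ifs <;> simp
      rw [act_accumulate (fun l hl => by have := hQ l hl; omega) (fun l hl => by omega)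
        (by rw [hsum, h0, hN, zero_add]; exact revValue_lt _ _ _), hsum, h0, zero_add]
    · rw [← h0, Function.update_eq_self]; rfl
  rw [patch_succ, ← hμ]
  unfold loadCell loadWord triEntry
  simp only
  split_ifs
  · rw [hEntry _ _ _ (by omega)]
  · rw [hEntry _ _ _ (by omega)]
  · rw [hQubits]
  · rw [← h0, Function.update_eq_self]; rfl

theorem classical_loadCell (I J H k : ℕ) : ClassicalCircuit (P.loadCell I J H k) := by
  have h1 : ∀ base i j, ClassicalCircuit (P.loadEntry k base i j) := by
    intro base i j g hg
    unfold loadEntry at hg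
    split_ifs at hg
    · rw [List.mem_singleton.1 hg]; trivial
    · simp at hg
  have h2 : ∀ i j, ClassicalCircuit (P.loadQubits k i j) := by
    intro i j
    unfold loadQubits
    split_ifs
    · refine classicalCircuit_flatMap fun l _ g hg => ?_
      rw [List.mem_singleton.1 hg]; trivial
    · intro g hg; simp at hg
  unfold loadCell
  simp only
  split_ifs
  · exact h1 _ _ _
  · exact h1 _ _ _
  · exact h2 _ _
  · intro g hg; simp at hg

theorem classical_load (I J H : ℕ) : ClassicalCircuit (P.load I J H) :=
  classicalCircuit_flatMap fun k _ => classical_loadCell I J H k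

theorem act_load (hP : P.Valid) {w : ℕ → ℕ} {m : Mem} {y : Finset ℕ}
    (hm : P.Ready w m) (hw : ∀ i < 4 * P.n ^ 2, w i < P.N)
    (hy : ∀ q < P.n ^ 2 * P.K, m (P.b + q) = if q ∈ y then 1 else 0) (I J H : ℕ) :
    actCircuit (P.load I J H) m = patch m P.o (2 * P.s ^ 2) (P.loadWord m y I J H) := by
  have := actCircuit_flatMap (R := 2 * P.s ^ 2) (G := P.loadCell I J H)
    (μ := fun k => patch m P.o k (P.loadWord m y I J H))
    fun k _ => act_loadCell hP hm hw hy I J H k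
  rwa [patch_zero] at this

/-! ### The phase -/

/-- One sixth of the output of the subroutine, modulo `N`. -/
def sixth (P : Params) (m : Mem) : ℕ :=
  (m (2 * P.s ^ 2) / 6 % P.N + (P.N - m (2 * P.s ^ 2 + 1) / 6 % P.N)) % P.N

/-- The phases of the binary digits multiply to the phase of the whole number. The memory `m'` of
the subroutine is arbitrary: the statement is needed on wrong outputs too. -/
theorem circ_phases (hP : P.Valid) {w : ℕ → ℕ} {m m' : Mem} {L : ℕ} (hm : P.Ready w m)
    (hL : 2 * P.s ^ 2 + 2 ≤ L) :
    circ P.phases (Finsupp.single (patch m P.o L m') 1) =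
      ph (P.sixth m' / P.N) • Finsupp.single (patch m P.o L m') 1 := by
  obtain ⟨-, -, -, -, hK, hN, h6, hS, ha, hb, ho⟩ := hP
  have hN0 : 0 < P.N := by omega
  set μ := patch m P.o L m' with hμ
  have hlow : ∀ i < P.o, μ i = m i := fun i hi => by rw [hμ, patch_of_not (by omega)]
  have h1 : μ (P.o + 2 * P.s ^ 2) = m' (2 * P.s ^ 2) := by
    rw [hμ, Nat.add_comm, patch_add (by omega)]
  have h2 : μ (P.o + 2 * P.s ^ 2 + 1) = m' (2 * P.s ^ 2 + 1) := by
    rw [hμ, Nat.add_assoc, Nat.add_comm, patch_add (by omega)]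
  have hcl : ClassicalCircuit P.phasePrep := by
    intro g hg
    simp only [phasePrep, List.mem_cons, List.not_mem_nil, or_false] at hg
    rcases hg with rfl | rfl <;> trivial
  have e3 : μ (P.a + P.K + 3) = 0 := by rw [hlow _ (by omega), hm.work _ (by omega) (by omega)]
  have e6 : μ (P.a + P.K) = 6 := by rw [hlow _ (by omega), hm.six]
  have hprep : actCircuit P.phasePrep μ = Function.update μ (P.a + P.K + 3) (P.sixth m') := by
    simp only [phasePrep, actCircuit_cons, actCircuit_nil, Gate.act, Operand.eval, e3, zero_add,
      hN0, if_true, Function.update_self, Function.update_idem, Nat.mod_lt _ hN0,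
      Function.update_of_ne (show P.a + P.K ≠ P.a + P.K + 3 by omega),
      Function.update_of_ne (show P.o + 2 * P.s ^ 2 ≠ P.a + P.K + 3 by omega),
      Function.update_of_ne (show P.o + 2 * P.s ^ 2 + 1 ≠ P.a + P.K + 3 by omega), h1, h2, e6]
    rfl
  have hlt : P.sixth m' < P.N := Nat.mod_lt _ hN0
  rw [phases, circ_append, circ_append, circ_single hcl, hprep]
  have hsteps := circ_flatMap_diag (R := P.K) (G := P.phaseStep)
    (m := Function.update μ (P.a + P.K + 3) (P.sixth m'))
    (θ := fun j => ((P.sixth m' / 2 ^ j % 2 : ℕ) : ℝ) / 2 ^ (P.K - j)) (by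
      intro j hj
      rw [phaseStep, circ_conj_phase (by intro g hg; rw [List.mem_singleton.1 hg]; trivial)]
      congr 4
      have f1 : Function.update μ (P.a + P.K + 3) (P.sixth m') (P.a + P.K + 4) = 0 := by
        rw [Function.update_of_ne (by omega), hlow _ (by omega), hm.work _ (by omega) (by omega)]
      simp only [actCircuit_cons, actCircuit_nil, Gate.act, Operand.eval, f1, zero_add, hN0,
        if_true, Function.update_self,
        Function.update_of_ne (show P.a + P.K + 3 ≠ P.a + P.K + 4 by omega),
        Function.update_of_ne (show P.a + j ≠ P.a + P.K + 4 by omega),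
        Function.update_of_ne (show P.a + j ≠ P.a + P.K + 3 by omega)]
      rw [hlow _ (by omega), hm.pow j hj, Nat.mod_eq_of_lt (lt_of_le_of_lt (Nat.div_le_self _ _) hlt)])
  rw [hsteps, map_smul, ← hprep, circ_inv_single hcl]
  congr 2
  have : ((P.sixth m' : ℕ) : ℝ) = ∑ l ∈ Finset.range P.K, ((P.sixth m' / 2 ^ l % 2 : ℕ) : ℝ) * 2 ^ l := by
    have h := sum_bits (P.sixth m') P.K
    rw [← hN, Nat.mod_eq_of_lt hlt] at h
    conv_lhs => rw [← h]
    push_cast; rfl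
  rw [this, hN, Finset.sum_div]
  refine Finset.sum_congr rfl fun j hj => ?_
  have hj := Finset.mem_range.1 hj
  have : (2 : ℝ) ^ P.K = 2 ^ (P.K - j) * 2 ^ j := by rw [← pow_add]; congr 1; omega
  push_cast
  rw [this, mul_div_mul_right _ _ (by positivity)]

/-! ### The output -/

theorem act_out (hP : P.Valid) {w v : ℕ → ℕ} {m : Mem} (hm : P.Ready w m)
    (hv : ∀ e, v e < P.N) :
    actCircuit P.out (bitsOf P.b P.K (P.n ^ 2 * P.K) m v) =
      patch (bitsOf P.b P.K (P.n ^ 2 * P.K) m v) (4 * P.n ^ 2) (2 * P.n ^ 2) fun k =>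
        if k % 2 = 0 then (v (k / 2) + P.S) % P.N - P.S else P.S - (v (k / 2) + P.S) % P.N := by
  have hV := hP
  obtain ⟨-, -, -, -, hK, hN, h6, hS, ha, hb, ho⟩ := hP
  have hN0 : 0 < P.N := by omega
  set m₀ := bitsOf P.b P.K (P.n ^ 2 * P.K) m v with hm₀
  have hR : P.Ready w m₀ := hm.congr hV fun i hi => by rw [hm₀, bitsOf, if_neg (by omega)]
  set f : Mem := fun k => if k % 2 = 0 then (v (k / 2) + P.S) % P.N - P.S
    else P.S - (v (k / 2) + P.S) % P.N with hf
  have main := actCircuit_flatMap (R := 2 * P.n ^ 2) (G := P.outStep)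
    (μ := fun k => patch m₀ (4 * P.n ^ 2) k f) ?_
  · rwa [patch_zero] at main
  intro k hk
  set μ := patch m₀ (4 * P.n ^ 2) k f with hμ
  have hother : ∀ i, 6 * P.n ^ 2 ≤ i → μ i = m₀ i := fun i hi => by
    rw [hμ, patch_of_not (by omega)]
  have hcl : ClassicalCircuit (P.outPrep k) := by
    rw [outPrep, classicalCircuit_append]
    refine ⟨classicalCircuit_flatMap fun l _ g hg => ?_, fun g hg => ?_⟩
    · rw [List.mem_singleton.1 hg]; trivial
    · rw [List.mem_singleton.1 hg]; trivial
  have hQ : ∀ j < P.K, k / 2 * P.K + j < P.n ^ 2 * P.K := by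
    intro j hj
    have : (k / 2 + 1) * P.K ≤ P.n ^ 2 * P.K := Nat.mul_le_mul_right _ (by omega)
    rw [Nat.add_mul] at this; omega
  have e3 : μ (P.a + P.K + 3) = 0 := by
    rw [hother _ (by omega), hR.work _ (by omega) (by omega)]
  have hsum : ∑ j ∈ Finset.range P.K, μ (P.b + k / 2 * P.K + j) * μ (P.a + j) = v (k / 2) := by
    have h := sum_bits (v (k / 2)) P.K
    rw [← hN, Nat.mod_eq_of_lt (hv _)] at h
    conv_rhs => rw [← h]
    refine Finset.sum_congr rfl fun j hj => ?_
    have hj := Finset.mem_range.1 hj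
    have := hQ j hj
    rw [hother _ (by omega), hother _ (by omega), hR.pow j hj, hm₀, bitsOf, if_pos (by omega),
      show P.b + k / 2 * P.K + j - P.b = P.K * (k / 2) + j by rw [mul_comm P.K]; omega,
      Nat.mul_add_div hK, Nat.div_eq_of_lt hj, Nat.mul_add_mod, Nat.mod_eq_of_lt hj, Nat.add_zero]
  have hprep : ∀ μ', (∀ i, 6 * P.n ^ 2 ≤ i → μ' i = μ i) → actCircuit (P.outPrep k) μ' =
      Function.update μ' (P.a + P.K + 3) ((v (k / 2) + P.S) % P.N) := by
    intro μ' hμ'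
    have hsum' : ∑ j ∈ Finset.range P.K, μ' (P.b + k / 2 * P.K + j) * μ' (P.a + j) =
        v (k / 2) := by
      rw [← hsum]
      exact Finset.sum_congr rfl fun j _ => by rw [hμ' _ (by omega), hμ' _ (by omega)]
    have e3' : μ' (P.a + P.K + 3) = 0 := by rw [hμ' _ (by omega), e3]
    rw [outPrep, actCircuit_append, act_accumulate (fun l hl => by omega) (fun l hl => by omega)
        (by rw [hsum', e3', zero_add]; exact hv _), hsum', e3', zero_add]
    simp only [actCircuit_cons, actCircuit_nil, Gate.act, Operand.eval, Function.update_self,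
      Function.update_idem, hv, if_true]
    rw [Function.update_of_ne (by omega), hμ' _ (by omega), hother _ (by omega), hR.shift]
  have hmod := Nat.mod_lt (v (k / 2) + P.S) hN0
  have h0 : μ (4 * P.n ^ 2 + k) = 0 := by
    rw [hμ, patch_of_not (by omega)]; exact hR.output _ (by omega) (by omega)
  -- The preparation neither reads nor writes the output cell. Writing the output can therefore be
  -- moved in front of it, after which the preparation and its inverse cancel.
  have hmid : actCircuit (if k % 2 = 0
      then [.add (4 * P.n ^ 2 + k) P.N (.monus (P.a + P.K + 3) (P.a + P.K + 1))]
      else [.add (4 * P.n ^ 2 + k) P.N (.monus (P.a + P.K + 1) (P.a + P.K + 3))])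
      (actCircuit (P.outPrep k) μ) =
      actCircuit (P.outPrep k) (Function.update μ (4 * P.n ^ 2 + k) (f k)) := by
    rw [hprep μ fun _ _ => rfl, hprep (Function.update μ (4 * P.n ^ 2 + k) (f k)) fun i hi => by
      rw [Function.update_of_ne (by omega)]]
    have g1 : Function.update μ (P.a + P.K + 3) ((v (k / 2) + P.S) % P.N) (P.a + P.K + 1) = P.S := by
      rw [Function.update_of_ne (by omega), hother _ (by omega), hR.shift]
    have g2 : Function.update μ (P.a + P.K + 3) ((v (k / 2) + P.S) % P.N) (4 * P.n ^ 2 + k) = 0 := by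
      rw [Function.update_of_ne (by omega), h0]
    have n1 : P.a + P.K + 1 ≠ 4 * P.n ^ 2 + k := by omega
    have n3 : P.a + P.K + 3 ≠ 4 * P.n ^ 2 + k := by omega
    rw [hf, Function.update_comm n3.symm]
    split_ifs with hpar
    · simp only [actCircuit_cons, actCircuit_nil, Gate.act, Operand.eval, g2, zero_add, hN0,
        if_true, hpar, Function.update_of_ne n1, Function.update_of_ne n3, g1,
        Function.update_self]
      rw [Nat.mod_eq_of_lt (show (v (k / 2) + P.S) % P.N - P.S < P.N by omega)]
    · simp only [actCircuit_cons, actCircuit_nil, Gate.act, Operand.eval, g2, zero_add, hN0,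
        if_true, hpar, if_false, Function.update_of_ne n1, Function.update_of_ne n3, g1,
        Function.update_self]
      rw [Nat.mod_eq_of_lt (show P.S - (v (k / 2) + P.S) % P.N < P.N by omega)]
  rw [outStep, actCircuit_append, actCircuit_append, hmid, actCircuit_invCircuit hcl, patch_succ]

theorem classical_out : ClassicalCircuit P.out := by
  refine classicalCircuit_flatMap fun k _ => ?_
  have hcl : ClassicalCircuit (P.outPrep k) := by
    rw [outPrep, classicalCircuit_append]
    refine ⟨classicalCircuit_flatMap fun l _ g hg => ?_, fun g hg => ?_⟩
    · rw [List.mem_singleton.1 hg]; trivial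
    · rw [List.mem_singleton.1 hg]; trivial
  rw [outStep, classicalCircuit_append, classicalCircuit_append]
  refine ⟨⟨hcl, ?_⟩, hcl.inv⟩
  split_ifs <;> (intro g hg; rw [List.mem_singleton.1 hg]; trivial)

theorem classical_setup : ClassicalCircuit P.setup := by
  rw [setup, classicalCircuit_append, classicalCircuit_append]
  refine ⟨⟨fun g hg => ?_, classicalCircuit_flatMap fun l _ g hg => ?_⟩, fun g hg => ?_⟩
  · rw [List.mem_singleton.1 hg]; trivial
  · simp only [List.mem_cons, List.not_mem_nil, or_false, or_self] at hg
    rw [hg]; trivial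
  · simp only [List.mem_cons, List.not_mem_nil, or_false] at hg
    rcases hg with rfl | rfl <;> trivial

end Params


/-! ## Correctness of the circuit for the matrix product -/

theorem prob_mono (ψ : QState) {S S' : Set Mem} (h : S ⊆ S') : prob ψ S ≤ prob ψ S' := by
  classical
  refine Finset.sum_le_sum fun m _ => ?_
  by_cases hm : m ∈ S
  · simp [hm, h hm]
  · rw [if_neg hm]; split_ifs <;> positivity

/-- A matrix, continued by zeros. -/
def extend {n : ℕ} (A : Matrix (Fin n) (Fin n) ℤ) (i j : ℕ) : ℤ :=
  if h : i < n ∧ j < n then A ⟨i, h.1⟩ ⟨j, h.2⟩ else 0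

theorem entry_add {n : ℕ} (A : Matrix (Fin n) (Fin n) ℤ) {i j : ℕ} (hi : i < n) (hj : j < n) :
    entry A (i * n + j) = extend A i j := by
  have h0 : 0 < n := by omega
  have h1 : (i * n + j) / n = i := by
    rw [mul_comm, Nat.mul_add_div h0, Nat.div_eq_of_lt hj, Nat.add_zero]
  have h2 : (i * n + j) % n = j := by rw [mul_comm, Nat.mul_add_mod, Nat.mod_eq_of_lt hj]
  simp only [entry, extend, h1, h2, hi, hj, and_self, dif_pos]

theorem extend_bounded {n c : ℕ} {A : Matrix (Fin n) (Fin n) ℤ} (hA : EntriesBounded c A)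
    (i j : ℕ) : |extend A i j| ≤ (n : ℤ) ^ c := by
  unfold extend
  split_ifs
  · exact hA _ _
  · rw [abs_zero]; positivity

theorem intWord_zero (k : ℕ) : intWord 0 k = 0 := by simp [intWord]

theorem intWord_mod_two (z : ℤ) (k : ℕ) : intWord z (k % 2) = intWord z k := by simp [intWord]

theorem intWord_le {z : ℤ} {V : ℕ} (h : |z| ≤ V) (k : ℕ) : intWord z k ≤ V := by
  have := abs_le.1 h
  unfold intWord
  split_ifs <;> omega

theorem matWord_add {n : ℕ} (A : Matrix (Fin n) (Fin n) ℤ) {i j r : ℕ} (hi : i < n) (hj : j < n)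
    (hr : r < 2) : matWord A (2 * (i * n + j) + r) = intWord (extend A i j) r := by
  rw [matWord, show (2 * (i * n + j) + r) / 2 = i * n + j by omega, entry_add A hi hj,
    ← intWord_mod_two, Nat.mul_add_mod, intWord_mod_two]

theorem matWord_eq {n k : ℕ} (A : Matrix (Fin n) (Fin n) ℤ) (hk : k < 2 * n ^ 2) :
    matWord A k = intWord (extend A (k / 2 / n) (k / 2 % n)) k := by
  have h1 : k / 2 < n * n := by rw [pow_two] at hk; omega
  have h0 : 0 < n := by by_contra h; simp [show n = 0 by omega] at h1
  have h2 : k / 2 / n < n := Nat.div_lt_of_lt_mul h1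
  have h3 : k / 2 % n < n := Nat.mod_lt _ h0
  have h4 : k = 2 * (k / 2 / n * n + k / 2 % n) + k % 2 := by
    rw [mul_comm (k / 2 / n), Nat.div_add_mod]; omega
  conv_lhs => rw [h4]
  rw [matWord_add A h2 h3 (by omega), intWord_mod_two]

theorem intWord_triEntry (m : ℕ) (α β γ : ℕ → ℕ → ℤ) (p q k : ℕ) :
    intWord (triEntry m α β γ p q) k = triEntry m (fun i j => intWord (α i j) k)
      (fun i j => intWord (β i j) k) (fun i j => intWord (γ i j) k) p q := by
  unfold triEntry
  split_ifs <;> first | rfl | exact intWord_zero k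

theorem abs_triEntry_le {m : ℕ} {α β γ : ℕ → ℕ → ℤ} {V : ℤ} (h0 : 0 ≤ V)
    (hα : ∀ i j, |α i j| ≤ V) (hβ : ∀ i j, |β i j| ≤ V) (hγ : ∀ i j, |γ i j| ≤ V) (p q : ℕ) :
    |triEntry m α β γ p q| ≤ V := by
  unfold triEntry
  split_ifs
  exacts [hα _ _, hβ _ _, hγ _ _, by rwa [abs_zero]]

theorem matWord_le {n V : ℕ} {A : Matrix (Fin n) (Fin n) ℤ} (hA : ∀ i j, |A i j| ≤ V) (k : ℕ) :
    matWord A k ≤ V := by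
  refine intWord_le ?_ k
  unfold entry
  split_ifs
  · exact hA _ _
  · simp

theorem matMul_inputWords_left {c n k : ℕ} (x : (matMul c).Inst n) (hk : k < 2 * n ^ 2) :
    (matMul c).inputWords n x k = matWord x.1.1 k :=
  (if_pos (show k < 4 * n ^ 2 by omega)).trans (if_pos hk)

theorem matMul_inputWords_right {c n k : ℕ} (x : (matMul c).Inst n) (hk : k < 2 * n ^ 2) :
    (matMul c).inputWords n x (2 * n ^ 2 + k) = matWord x.1.2 k :=
  (if_pos (show 2 * n ^ 2 + k < 4 * n ^ 2 by omega)).trans ((if_neg (by omega)).trans (by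
    rw [Nat.add_sub_cancel_left]))

theorem traceCube_inputWords_of_lt {c n k : ℕ} (x : (traceCube c).Inst n) (hk : k < 2 * n ^ 2) :
    (traceCube c).inputWords n x k = matWord x.1 k := if_pos hk

theorem traceCube_inputWords_of_le {c n k : ℕ} (x : (traceCube c).Inst n) (hk : 2 * n ^ 2 ≤ k) :
    (traceCube c).inputWords n x k = 0 := if_neg (not_lt.2 hk)

namespace Params

variable {P : Params}

/-- The product of the upper right blocks, with the Fourier dual `y` of the product. -/
def dual (P : Params) (y : Finset ℕ) (i j : ℕ) : ℤ :=
  if i < P.n ∧ j < P.n then revValue P.K (i * P.n + j) y else 0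

/-- The input matrix of the subroutine. -/
def query (P : Params) (A B : Matrix (Fin P.n) (Fin P.n) ℤ) (y : Finset ℕ) (I J H : ℕ) :
    Matrix (Fin P.s) (Fin P.s) ℤ :=
  triMatrix P.s P.m (fun i j => extend A (I * P.m + i) (J * P.m + j))
    (fun i j => extend B (J * P.m + i) (H * P.m + j))
    (fun i j => P.dual y (I * P.m + i) (H * P.m + j))

/-- One sixth of the trace of the third power of the query. -/
def gain (P : Params) (A B : Matrix (Fin P.n) (Fin P.n) ℤ) (y : Finset ℕ) (I J H : ℕ) : ℤ :=
  ∑ a ∈ Finset.range P.m, ∑ b ∈ Finset.range P.m, ∑ c ∈ Finset.range P.m,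
    extend A (I * P.m + a) (J * P.m + b) * extend B (J * P.m + b) (H * P.m + c) *
      P.dual y (I * P.m + a) (H * P.m + c)

theorem trace_query (hP : P.Valid) (A B : Matrix (Fin P.n) (Fin P.n) ℤ) (y : Finset ℕ)
    (I J H : ℕ) : (P.query A B y I J H ^ 3).trace = 6 * P.gain A B y I J H :=
  trace_triMatrix hP.hm _ _ _

theorem dual_nonneg (P : Params) (y : Finset ℕ) (i j : ℕ) : 0 ≤ P.dual y i j := by
  unfold dual; split_ifs <;> positivity

theorem dual_lt (hP : P.Valid) (y : Finset ℕ) (i j : ℕ) : P.dual y i j < P.N := by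
  have := hP.h6
  unfold dual
  split_ifs
  · rw [hP.hN]; exact_mod_cast revValue_lt _ _ _
  · omega

theorem query_bounded (hP : P.Valid) {c c' : ℕ} {A B : Matrix (Fin P.n) (Fin P.n) ℤ}
    (hA : EntriesBounded c A) (hB : EntriesBounded c B) (hc : P.n ^ c ≤ P.s ^ c')
    (hN : P.N ≤ P.s ^ c') (y : Finset ℕ) (I J H : ℕ) :
    EntriesBounded c' (P.query A B y I J H) := by
  intro i j
  have hc' : (P.n : ℤ) ^ c ≤ (P.s : ℤ) ^ c' := by exact_mod_cast hc
  have hN' : (P.N : ℤ) ≤ (P.s : ℤ) ^ c' := by exact_mod_cast hN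
  rw [query, triMatrix, Matrix.of_apply]
  refine abs_triEntry_le (by positivity) (fun _ _ => (extend_bounded hA _ _).trans hc')
    (fun _ _ => (extend_bounded hB _ _).trans hc') (fun _ _ => ?_) _ _
  rw [abs_of_nonneg (dual_nonneg _ _ _ _)]
  exact (dual_lt hP _ _ _).le.trans hN'

/-- Taking positive or negative parts commutes with the selection of a block, and zero has both
parts zero; so the words can be compared block by block. -/
theorem loadWord_eq {c : ℕ} (x : (matMul c).Inst P.n) {m : Mem} {y : Finset ℕ}
    (hm : P.Ready ((matMul c).inputWords P.n x) m) (I J H : ℕ) {k : ℕ} (hk : k < 2 * P.s ^ 2) :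
    P.loadWord m y I J H k = matWord (P.query x.1.1 x.1.2 y I J H) k := by
  have hA : ∀ i j, P.entryWord m 0 (k % 2) i j = intWord (extend x.1.1 i j) k := by
    intro i j
    unfold entryWord
    split_ifs with hij
    · have hlt := index_lt hij.1 hij.2
      rw [hm.input _ (by omega), ← intWord_mod_two, ← matWord_add _ hij.1 hij.2 (by omega)]
      rw [matMul_inputWords_left _ (by omega), Nat.zero_add]
    · rw [extend, dif_neg hij, intWord_zero]
  have hB : ∀ i j, P.entryWord m (2 * P.n ^ 2) (k % 2) i j = intWord (extend x.1.2 i j) k := by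
    intro i j
    unfold entryWord
    split_ifs with hij
    · have hlt := index_lt hij.1 hij.2
      rw [hm.input _ (by omega), ← intWord_mod_two, ← matWord_add _ hij.1 hij.2 (by omega)]
      rw [Nat.add_assoc, matMul_inputWords_right _ (by omega)]
    · rw [extend, dif_neg hij, intWord_zero]
  have hD : ∀ i j, P.qubitWord y (k % 2) i j = intWord (P.dual y i j) k := by
    intro i j
    unfold qubitWord dual
    by_cases hij : i < P.n ∧ j < P.n
    · rw [if_pos hij]
      by_cases hr : k % 2 = 0 <;> simp [intWord, hij, hr]
    · rw [if_neg hij, if_neg (by tauto), intWord_zero]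
  have h1 : k / 2 < P.s * P.s := by rw [pow_two] at hk; omega
  have h0 : 0 < P.s := by by_contra h; simp [show P.s = 0 by omega] at h1
  have h2 : k / 2 / P.s < P.s := Nat.div_lt_of_lt_mul h1
  have h3 : k / 2 % P.s < P.s := Nat.mod_lt _ h0
  rw [matWord_eq _ hk, extend, dif_pos ⟨h2, h3⟩, query, triMatrix, Matrix.of_apply, intWord_triEntry]
  simp only [loadWord, hA, hB, hD]

/-- The five pieces cover each index range up to `5 * m ≥ n`, and all three factors are continued by
zero. The 125 block sums thus add up to the sum over all index triples, that is, to the pairing of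
`A * B` with the dual variable. -/
theorem sum_gain (hP : P.Valid) (A B : Matrix (Fin P.n) (Fin P.n) ℤ) (y : Finset ℕ) :
    ∑ k ∈ Finset.range 125, P.gain A B y (k / 5 / 5) (k / 5 % 5) (k % 5) =
      ∑ e ∈ Finset.range (P.n ^ 2), entry (A * B) e * revValue P.K e y := by
  set f : ℕ → ℕ → ℕ → ℤ := fun p q r => extend A p q * extend B q r * P.dual y p r with hf
  have h1 : ∑ k ∈ Finset.range 125, P.gain A B y (k / 5 / 5) (k / 5 % 5) (k % 5) =
      ∑ I ∈ Finset.range 5, ∑ J ∈ Finset.range 5, ∑ H ∈ Finset.range 5, P.gain A B y I J H := by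
    rw [show 125 = 25 * 5 from rfl,
      sum_range_mul 25 5 fun k H => P.gain A B y (k / 5) (k % 5) H, show 25 = 5 * 5 from rfl,
      sum_range_mul 5 5 fun I J => ∑ H ∈ Finset.range 5, P.gain A B y I J H]
  have h2 : ∀ g : ℕ → ℤ, (∀ p, P.n ≤ p → g p = 0) →
      ∑ I ∈ Finset.range 5, ∑ a ∈ Finset.range P.m, g (I * P.m + a) = ∑ p ∈ Finset.range P.n, g p := by
    intro g hg
    rw [← sum_range_mul 5 P.m fun I a => g (I * P.m + a)]
    have : ∀ q, g (q / P.m * P.m + q % P.m) = g q := fun q => by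
      rw [mul_comm, Nat.div_add_mod]
    simp only [this]
    refine (Finset.sum_subset ?_ ?_).symm
    · intro p hp; have := hP.hnm; simp only [Finset.mem_range] at hp ⊢; omega
    · intro p _ hp; exact hg p (by simpa using hp)
  have h3 : ∑ I ∈ Finset.range 5, ∑ J ∈ Finset.range 5, ∑ H ∈ Finset.range 5,
      P.gain A B y I J H = ∑ p ∈ Finset.range P.n, ∑ q ∈ Finset.range P.n,
        ∑ r ∈ Finset.range P.n, f p q r := by
    have e0 : ∀ p q r, P.n ≤ p ∨ P.n ≤ q ∨ P.n ≤ r → f p q r = 0 := by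
      intro p q r h
      simp only [hf, extend]
      rcases h with h | h | h
      · rw [dif_neg (by omega)]; simp
      · rw [dif_neg (by omega)]; simp
      · rw [dif_neg (c := q < P.n ∧ r < P.n) (by omega)]; simp
    rw [← h2 (fun p => ∑ q ∈ Finset.range P.n, ∑ r ∈ Finset.range P.n, f p q r) fun p hp =>
      Finset.sum_eq_zero fun q _ => Finset.sum_eq_zero fun r _ => e0 _ _ _ (Or.inl hp)]
    refine Finset.sum_congr rfl fun I _ => ?_
    have e1 : ∀ a, ∑ q ∈ Finset.range P.n, ∑ r ∈ Finset.range P.n, f (I * P.m + a) q r =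
        ∑ J ∈ Finset.range 5, ∑ b ∈ Finset.range P.m, ∑ H ∈ Finset.range 5,
          ∑ c ∈ Finset.range P.m, f (I * P.m + a) (J * P.m + b) (H * P.m + c) := by
      intro a
      rw [← h2 (fun q => ∑ r ∈ Finset.range P.n, f (I * P.m + a) q r) fun q hq =>
        Finset.sum_eq_zero fun r _ => e0 _ _ _ (Or.inr (Or.inl hq))]
      refine Finset.sum_congr rfl fun J _ => Finset.sum_congr rfl fun b _ => ?_
      rw [← h2 (fun r => f (I * P.m + a) (J * P.m + b) r) fun r hr => e0 _ _ _ (Or.inr (Or.inr hr))]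
    simp only [e1]
    rw [Finset.sum_comm (s := Finset.range P.m) (t := Finset.range 5)]
    refine Finset.sum_congr rfl fun J _ => ?_
    simp only [gain]
    rw [Finset.sum_comm (s := Finset.range 5)]
    refine Finset.sum_congr rfl fun a _ => ?_
    rw [Finset.sum_comm (s := Finset.range 5)]
  rw [h1, h3, pow_two]
  have h4 : ∀ e ∈ Finset.range (P.n * P.n), entry (A * B) e * (revValue P.K e y : ℤ) =
      extend (A * B) (e / P.n) (e % P.n) * P.dual y (e / P.n) (e % P.n) := by
    intro e he
    have he := Finset.mem_range.1 he
    have h0 : 0 < P.n := by by_contra h; simp [show P.n = 0 by omega] at he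
    have h2 : e / P.n < P.n := Nat.div_lt_of_lt_mul he
    have h3 : e % P.n < P.n := Nat.mod_lt _ h0
    rw [dual, if_pos ⟨h2, h3⟩, ← entry_add _ h2 h3, mul_comm (e / P.n), Nat.div_add_mod]
  rw [Finset.sum_congr rfl h4, sum_range_mul P.n P.n fun p r => extend (A * B) p r * P.dual y p r]
  refine Finset.sum_congr rfl fun p hp => ?_
  rw [Finset.sum_comm]
  refine Finset.sum_congr rfl fun r hr => ?_
  have hp := Finset.mem_range.1 hp
  have hr := Finset.mem_range.1 hr
  rw [extend, dif_pos ⟨hp, hr⟩, Matrix.mul_apply, Finset.sum_mul, Finset.sum_range]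
  refine Finset.sum_congr rfl fun q _ => ?_
  simp [hf, extend, hp, hr]

/-- Positive and negative part of `6 * g` are both divisible by six, so the division is exact in
each word, and the difference modulo `N` is `g`. -/
theorem ph_sixth (hP : P.Valid) {g : ℤ} {m : Mem} (h0 : m (2 * P.s ^ 2) = intWord (6 * g) 0)
    (h1 : m (2 * P.s ^ 2 + 1) = intWord (6 * g) 1) : ph (P.sixth m / P.N) = ph (g / P.N) := by
  have h6 := hP.h6
  have hN : P.N ≠ 0 := by omega
  have e0 : m (2 * P.s ^ 2) / 6 = g.toNat := by rw [h0]; simp [intWord]; omega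
  have e1 : m (2 * P.s ^ 2 + 1) / 6 = (-g).toNat := by rw [h1]; simp [intWord]; omega
  have hlt := Nat.mod_lt (-g).toNat (show 0 < P.N by omega)
  have key : (P.N : ℤ) ∣ (P.sixth m : ℤ) - g := by
    have hg : g = (g.toNat : ℤ) - ((-g).toNat : ℤ) := by omega
    rw [sixth, e0, e1]
    generalize g.toNat = u at hg ⊢
    generalize (-g).toNat = v at hg hlt ⊢
    rw [← Int.modEq_iff_dvd, hg]
    push_cast [Nat.cast_sub hlt.le]
    refine Int.ModEq.symm ((Int.mod_modEq _ _).trans ?_)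
    have m1 : ((u : ℤ) % P.N) ≡ u [ZMOD P.N] := Int.mod_modEq _ _
    have m2 : ((v : ℤ) % P.N) ≡ v [ZMOD P.N] := Int.mod_modEq _ _
    have m3 : (P.N : ℤ) ≡ 0 [ZMOD P.N] := by simp [Int.ModEq]
    have := m1.add (m3.sub m2)
    rwa [zero_sub, ← sub_eq_add_neg] at this
  have := ph_div_eq hN key
  rwa [Int.cast_natCast] at this

end Params


/-! ### Success probability of the whole circuit -/

namespace Params

variable {P : Params}

theorem inputWords_traceCube_small {c' V L : ℕ} (x : (traceCube c').Inst P.s)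
    (hV : P.s ^ c' ≤ V) (hL : 2 * P.s ^ 2 ≤ L) :
    Small V L ((traceCube c').inputWords P.s x) := by
  constructor
  · intro i
    by_cases hi : i < 2 * P.s ^ 2
    · rw [traceCube_inputWords_of_lt x hi]
      refine matWord_le (fun a b => (x.2.2 a b).trans ?_) i
      exact_mod_cast hV
    · rw [traceCube_inputWords_of_le x (by omega)]; omega
  · intro i hi
    exact traceCube_inputWords_of_le x (by omega)

/-- Up to distance `250 * √ε`, the state after the queries is the Fourier transform of the residues
of `A * B`. The inverse transform preserves the distance, and the output part maps the basis state
of the residues to one that shows the product. -/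
theorem prob_circuit (hP : P.Valid) {c c' W V L : ℕ} {C : List Gate} {ε : ℝ}
    (hC : ∀ g ∈ C, g.Bounded W) (hWV : W ≤ V) (hV : V % 2 = 1) (hL : W + V < L)
    (hsL : 2 * P.s ^ 2 + 2 ≤ L) (hsV : P.s ^ c' ≤ V) (hNV : P.N ≤ P.s ^ c')
    (hcN : P.n ^ c < P.N) (hS : P.n * (P.n ^ c * P.n ^ c) ≤ P.S) (hSN : 2 * P.S < P.N)
    (hε0 : 0 ≤ ε) (hε1 : 250 * √ε ≤ 1)
    (hε : ∀ x : (traceCube c').Inst P.s, 1 - ε ≤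
      prob (circ C (Finsupp.single ((traceCube c').inputWords P.s x) 1)) ((traceCube c').correct P.s x))
    (x : (matMul c).Inst P.n) :
    (1 - 250 * √ε) ^ 2 ≤
      prob (circ (P.circuit C) (Finsupp.single ((matMul c).inputWords P.n x) 1))
        ((matMul c).correct P.n x) := by
  classical
  obtain ⟨hn, hm, hm0, hnm, hK, hN, h6, -, ha, hb, ho⟩ := id hP
  set w := (matMul c).inputWords P.n x with hw
  set Q := P.n ^ 2 * P.K with hQ
  have hwN : ∀ i < 4 * P.n ^ 2, w i < P.N := by
    intro i hi
    refine lt_of_le_of_lt ?_ hcN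
    have hb1 : ∀ i j, |x.1.1 i j| ≤ (P.n ^ c : ℕ) := fun i j => by
      have := x.2.1 i j; exact_mod_cast this
    have hb2 : ∀ i j, |x.1.2 i j| ≤ (P.n ^ c : ℕ) := fun i j => by
      have := x.2.2 i j; exact_mod_cast this
    by_cases h : i < 2 * P.n ^ 2
    · rw [hw, matMul_inputWords_left x h]; exact matWord_le hb1 i
    · rw [hw, show i = 2 * P.n ^ 2 + (i - 2 * P.n ^ 2) by omega,
        matMul_inputWords_right x (by omega)]
      exact matWord_le hb2 _
  obtain ⟨hR1, hz1⟩ := setup_ready hP (w := w) fun i hi => if_neg (not_lt.2 hi)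
  set m₁ := actCircuit P.setup w with hm₁
  set v : ℕ → ℕ := fun e => (entry (x.1.1 * x.1.2) e % P.N).toNat with hv
  have hvN : ∀ e, v e < P.N := by
    intro e
    have h1 := Int.emod_lt_of_pos (entry (x.1.1 * x.1.2) e) (show (0 : ℤ) < P.N by omega)
    have h2 := Int.emod_nonneg (entry (x.1.1 * x.1.2) e) (show (P.N : ℤ) ≠ 0 by omega)
    simp only [hv]; omega
  set Y := (Finset.range Q).powerset with hY
  set b : Finset ℕ → Mem := setBits P.b 0 Q m₁ with hbdef
  set r : ℂ := ((Real.sqrt 2 : ℂ)⁻¹) ^ Q with hr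
  have hbits : ∀ u : ℕ → ℕ, circ P.fourierPart (Finsupp.single (bitsOf P.b P.K Q m₁ u) 1) =
      ∑ y ∈ Y, Finsupp.single (b y)
        (r * ph ((∑ e ∈ Finset.range (P.n ^ 2), u e * revValue P.K e y : ℕ) / P.N)) := by
    intro u
    rw [fourierPart, circ_fourier (by omega) ?_ (by omega) ?_]
    · refine Finset.sum_congr rfl fun y hy => ?_
      rw [setBits_bitsOf, ph_fourierAngle_bitsOf hK (Finset.mem_powerset.1 hy), hN]
      push_cast; rfl
    · rw [bitsOf, if_neg (by omega)]; exact hR1.work _ (by omega) (by omega)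
    · intro i h1 h2
      rw [bitsOf, if_pos ⟨h1, h2⟩]
      omega
  -- All qubits are zero at first, so the transform is the uniform superposition.
  have hstart : circ P.fourierPart (Finsupp.single m₁ 1) = ∑ y ∈ Y, Finsupp.single (b y) r := by
    have h := hbits fun _ => 0
    have h0 : bitsOf P.b P.K Q m₁ (fun _ => 0) = m₁ := by
      funext i
      unfold bitsOf
      split_ifs with hi
      · rw [hz1 i hi.1, Nat.zero_div, Nat.zero_mod]
      · rfl
    rw [h0] at h
    rw [h]
    refine Finset.sum_congr rfl fun y _ => by simp
  have hRb : ∀ y, P.Ready w (b y) := fun y => hR1.congr hP fun i hi => by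
    rw [hbdef, setBits, if_neg (by omega)]
  set ω : ℕ → Finset ℕ → ℂ := fun k y =>
    ph ((P.gain x.1.1 x.1.2 y (k / 5 / 5) (k / 5 % 5) (k % 5) : ℤ) / P.N) with hω
  have horacle : ∀ k, ∀ a : Finset ℕ → ℂ,
      nsq (circ (P.oracle C k) (∑ y ∈ Y, Finsupp.single (b y) (a y)) -
      ∑ y ∈ Y, Finsupp.single (b y) (a y * ω k y)) ≤ 4 * ε * ∑ y ∈ Y, ‖a y‖ ^ 2 := by
    intro k a
    generalize hI : k / 5 / 5 = I
    generalize hJ : k / 5 % 5 = J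
    generalize hH : k % 5 = H
    set q : Finset ℕ → (traceCube c').Inst P.s := fun y =>
      ⟨P.query x.1.1 x.1.2 y I J H, triMatrix_isSymm _ _ _ _ _,
        query_bounded hP x.2.1 x.2.2 (hcN.le.trans hNV) hNV y I J H⟩ with hq
    set u : Finset ℕ → Mem := fun y => (traceCube c').inputWords P.s (q y) with hu
    have hsm : ∀ y, Small V L (u y) := fun y =>
      inputWords_traceCube_small (q y) hsV (by omega)
    have hload : ∀ y, actCircuit (P.load I J H) (b y) = patch (b y) P.o L (u y) := by
      intro y
      rw [act_load hP (hRb y) hwN (y := y) (by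
        intro q hq
        rw [hbdef, setBits, if_pos (by omega), Nat.add_sub_cancel_left])]
      funext i
      by_cases h1 : P.o ≤ i ∧ i < P.o + 2 * P.s ^ 2
      · obtain ⟨j, rfl⟩ : ∃ j, i = j + P.o := ⟨i - P.o, by omega⟩
        rw [patch_add (by omega), patch_add (by omega), loadWord_eq x (hRb y) I J H (by omega)]
        exact (traceCube_inputWords_of_lt (q y) (by omega)).symm
      · rw [patch_of_not h1]
        by_cases h2 : P.o ≤ i ∧ i < P.o + L
        · obtain ⟨j, rfl⟩ : ∃ j, i = j + P.o := ⟨i - P.o, by omega⟩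
          rw [patch_add (by omega), (hRb y).high _ (by omega)]
          exact (traceCube_inputWords_of_le (q y) (by omega)).symm
        · rw [patch_of_not h2]
    have hshift := fun y => circ_shift_single (o := P.o) (b := b y) hWV hV hL hC (hsm y)
    refine nsq_conj_sub_le (g := fun y m => patch (b y) P.o L m)
      (ψ := fun y => circ C (Finsupp.single (u y) 1)) (φ := fun _ m => ph (P.sixth m / P.N))
      ?_ ?_ ?_ ?_ ?_ ?_ a
    · intro y _
      rw [hI, hJ, hH, circ_append, circ_single (classical_load I J H), hload]
      exact (hshift y).1
    · intro y hy y' hy' m hm m' hm' h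
      -- The qubits lie before the memory of the subroutine, which therefore cannot hide a
      -- difference between `y` and `y'`.
      have hyy : y = y' := by
        refine setBits_injOn P.b Q m₁ (Finset.mem_coe.2 hy) (Finset.mem_coe.2 hy') ?_
        funext i
        by_cases hi : i < P.o
        · have := congrFun h i
          rwa [patch_of_not (by omega), patch_of_not (by omega)] at this
        · rw [setBits, if_neg (by omega), setBits, if_neg (by omega)]
      subst hyy
      exact ⟨rfl, Small.patch_inj ((hshift y).2 m hm) ((hshift y).2 m' hm') h⟩
    · intro y _ m _
      exact circ_phases hP (hRb y) hsL
    · intro y _ m _; exact norm_ph _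
    · intro y _; exact norm_ph _
    · intro y _
      have h1 := prob_add_prob_compl (circ C (Finsupp.single (u y) 1))
        ((traceCube c').correct P.s (q y))
      rw [nsq_circ, nsq_single, norm_one, one_pow] at h1
      have h2 := hε (q y)
      -- The phase depends only on the two output words, so a wrong phase requires a wrong output,
      -- which has probability at most `ε`.
      refine (prob_mono _ (S' := ((traceCube c').correct P.s (q y))ᶜ) ?_).trans (by linarith)
      intro m hm hmc
      apply hm
      simp only [hω, hI, hJ, hH]
      have ho : ∀ j, (traceCube c').output P.s (q y) j =
          intWord (6 * P.gain x.1.1 x.1.2 y I J H) j := by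
        intro j
        rw [← trace_query hP]; rfl
      refine ph_sixth hP ?_ ?_
      · rw [← ho]; exact hmc 0 (by simp [traceCube])
      · rw [← ho]; exact hmc 1 (by simp [traceCube])
  have htotal := nsq_iterate_sub_le (Y := Y) (R := 125) (G := P.oracle C) (b := b) (ω := ω) (ε := ε)
    (fun k _ y _ => norm_ph _) (fun _ => r) (sum_fourier_coeff Q).le hε0 fun k _ => horacle k
  -- The ideal phases multiply to the phase of the pairing of `A * B` with `y`. Replacing the
  -- entries by their residues `v` does not change it, and gives precisely the Fourier coefficients
  -- of `v`.
  have htarget : ∑ y ∈ Y, Finsupp.single (b y) (r * ∏ k ∈ Finset.range 125, ω k y) =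
      circ P.fourierPart (Finsupp.single (bitsOf P.b P.K Q m₁ v) 1) := by
    rw [hbits]
    refine Finset.sum_congr rfl fun y _ => ?_
    congr 2
    simp only [hω]
    rw [← ph_sum, ← Finset.sum_div, ← Int.cast_sum, sum_gain hP, ← Int.cast_natCast]
    refine ph_div_eq (by omega) ?_
    push_cast
    rw [← Finset.sum_sub_distrib]
    refine Finset.dvd_sum fun e _ => ?_
    rw [← sub_mul]
    refine Dvd.dvd.mul_right ?_ _
    have h2 := Int.emod_nonneg (entry (x.1.1 * x.1.2) e) (show (P.N : ℤ) ≠ 0 by omega)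
    simp only [hv]
    rw [Int.toNat_of_nonneg h2]
    exact Int.dvd_self_sub_emod
  rw [htarget] at htotal
  -- The constant comes from `125 ^ 2 * (4 * ε) = (250 * √ε) ^ 2`.
  have hfinal : nsq (circ (P.circuit C) (Finsupp.single w 1) -
      Finsupp.single (actCircuit P.out (bitsOf P.b P.K Q m₁ v)) 1) ≤ (250 * √ε) ^ 2 := by
    rw [← circ_single classical_out, circuit, circ_append, circ_append, circ_append, circ_append,
      circ_single classical_setup, hstart, ← map_sub, nsq_circ,
      ← circ_invCircuit P.fourierPart (Finsupp.single (bitsOf P.b P.K Q m₁ v) 1), ← map_sub,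
      nsq_circ, mul_pow, Real.sq_sqrt hε0]
    refine htotal.trans (le_of_eq ?_)
    norm_num; ring
  refine le_prob_of_close ?_ hε1 (by positivity) hfinal
  intro k hk
  have hk : k < 2 * P.n ^ 2 := hk
  rw [act_out hP hR1 hvN]
  show patch _ (4 * P.n ^ 2) _ _ (4 * P.n ^ 2 + k) = intWord (entry (x.1.1 * x.1.2) (k / 2)) k
  rw [Nat.add_comm, patch_add hk]
  have hent : |entry (x.1.1 * x.1.2) (k / 2)| ≤ (P.S : ℤ) := by
    unfold entry
    split_ifs
    · rw [Matrix.mul_apply]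
      refine (Finset.abs_sum_le_sum_abs _ _).trans ?_
      refine (Finset.sum_le_card_nsmul _ _ ((P.n : ℤ) ^ c * (P.n : ℤ) ^ c) fun i _ => ?_).trans ?_
      · rw [abs_mul]
        exact mul_le_mul (x.2.1 _ _) (x.2.2 _ _) (abs_nonneg _) (by positivity)
      · rw [Finset.card_univ, Fintype.card_fin, nsmul_eq_mul]
        exact_mod_cast hS
    · simp
  -- An entry has magnitude at most `S`, so after the shift it lies between `0` and `2 * S < N` and
  -- equals its residue.
  have hval : (v (k / 2) + P.S) % P.N = (entry (x.1.1 * x.1.2) (k / 2) + P.S).toNat := by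
    have habs := abs_le.1 hent
    have h2 := Int.emod_nonneg (entry (x.1.1 * x.1.2) (k / 2)) (show (P.N : ℤ) ≠ 0 by omega)
    zify
    simp only [hv]
    rw [Int.toNat_of_nonneg h2, Int.toNat_of_nonneg (by omega), Int.emod_add_emod,
      Int.emod_eq_of_lt (by omega) (by omega)]
  have habs := abs_le.1 hent
  rw [hval]
  unfold intWord
  split_ifs <;> omega

end Params


/-! ## Writing the circuit for the matrix product -/

instance : Add WExpr := ⟨.add⟩
instance : Sub WExpr := ⟨.sub⟩
instance : Mul WExpr := ⟨.mul⟩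
instance : Div WExpr := ⟨.div⟩
instance (k : ℕ) : OfNat WExpr k := ⟨.lit k⟩

namespace WExpr

variable {h : Store} {v : ℕ → ℕ}

@[simp] theorem eval_add (x y : WExpr) : (x + y).eval h v = x.eval h v + y.eval h v := rfl
@[simp] theorem eval_sub (x y : WExpr) : (x - y).eval h v = x.eval h v - y.eval h v := rfl
@[simp] theorem eval_mul (x y : WExpr) : (x * y).eval h v = x.eval h v * y.eval h v := rfl
@[simp] theorem eval_div (x y : WExpr) : (x / y).eval h v = x.eval h v / y.eval h v := rfl
@[simp] theorem eval_lit (k : ℕ) : (lit k).eval h v = k := rfl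
@[simp] theorem eval_ofNat (k : ℕ) : WExpr.eval h v (no_index (OfNat.ofNat k)) = OfNat.ofNat k := rfl
@[simp] theorem eval_var (i : ℕ) : (var i).eval h v = v i := rfl
@[simp] theorem eval_hi (a : ℕ) (i : WExpr) : (hi a i).eval h v = h a (i.eval h v) := rfl

def mod (x y : WExpr) : WExpr := x - y * (x / y)

@[simp] theorem eval_mod (x y : WExpr) : (mod x y).eval h v = x.eval h v % y.eval h v := by
  simp only [mod, eval_sub, eval_mul, eval_div]
  exact (Nat.mod_eq_sub_mul_div).symm

def min (x y : WExpr) : WExpr := x - (x - y)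

@[simp] theorem eval_min (x y : WExpr) : (min x y).eval h v = Min.min (x.eval h v) (y.eval h v) := by
  simp only [min, eval_sub]; omega

def max (x y : WExpr) : WExpr := x + (y - x)

@[simp] theorem eval_max (x y : WExpr) : (max x y).eval h v = Max.max (x.eval h v) (y.eval h v) := by
  simp only [max, eval_sub, eval_add]; omega

/-- The truth value of an equation. -/
def eq (x y : WExpr) : WExpr := 1 - ((x - y) + (y - x))

@[simp] theorem eval_eq (x y : WExpr) :
    (eq x y).eval h v = if x.eval h v = y.eval h v then 1 else 0 := by
  simp only [eq, eval_sub, eval_add, eval_ofNat]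
  split_ifs <;> omega

def pow (x : WExpr) : ℕ → WExpr
  | 0 => 1
  | k + 1 => pow x k * x

@[simp] theorem eval_pow (x : WExpr) (k : ℕ) : (pow x k).eval h v = x.eval h v ^ k := by
  induction k with
  | zero => rfl
  | succ k ih => rw [pow, eval_mul, ih, pow_succ]

end WExpr

/-- The circuit that is written. -/
def Writer.gates (h : Store) (d : ℕ) (v : ℕ → ℕ) (p : Writer) : List Gate :=
  (p.run h d v).map RawGate.gate

namespace Writer

variable {h : Store} {d : ℕ} {v : ℕ → ℕ}

@[simp] theorem gates_nop : nop.gates h d v = [] := rfl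

@[simp] theorem gates_emit (op t N x y : WExpr) : (emit op t N x y).gates h d v =
    [Gate.decode (op.eval h v) (t.eval h v) (N.eval h v) (x.eval h v) (y.eval h v)] := rfl

@[simp] theorem gates_seq (p q : Writer) : (seq p q).gates h d v = p.gates h d v ++ q.gates h d v := by
  simp [gates, run]

@[simp] theorem gates_loop (e : WExpr) (p : Writer) : (loop e p).gates h d v =
    (List.range (e.eval h v)).flatMap fun i => p.gates h (d + 1) (Function.update v d i) := by
  simp [gates, run, List.map_flatMap]

@[simp] theorem gates_bind (e : WExpr) (p : Writer) : (bind e p).gates h d v =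
    p.gates h (d + 1) (Function.update v d (e.eval h v)) := rfl

@[simp] theorem gates_bits (e : WExpr) (p : Writer) : (bits e p).gates h d v = p.gates h (d + 2)
    (Function.update (Function.update v d (e.eval h v).size) (d + 1) (2 ^ (e.eval h v).size)) := rfl

@[simp] theorem gates_ite (e : WExpr) (p q : Writer) : (ite e p q).gates h d v =
    if e.eval h v ≠ 0 then p.gates h d v else q.gates h d v := by
  simp only [gates, run]; split_ifs <;> rfl

@[simp] theorem gates_conj (p q : Writer) : (conj p q).gates h d v =
    p.gates h d v ++ q.gates h d v ++ invCircuit (p.gates h d v) := by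
  simp only [gates, run, invCircuit, List.map_append, List.map_reverse, List.map_map]
  congr 3
  funext r
  exact RawGate.gate_inv r

theorem gates_relocate (o : WExpr) (O : ℕ)
    (ho : ∀ i, o.eval h (Function.update v d i) = O) :
    (relocate d o).gates h d v = (circuitOf h).map (Gate.shift O) := run_relocate h d v o O ho

end Writer

namespace Params

open WExpr (var)

/-! The variables `0`, …, `7` hold the components `n`, `s`, `K`, `N`, `a`, `b`, `o`, `m`. -/

structure Vars (P : Params) (v : ℕ → ℕ) : Prop where
  n : v 0 = P.n
  s : v 1 = P.s
  K : v 2 = P.K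
  N : v 3 = P.N
  a : v 4 = P.a
  b : v 5 = P.b
  o : v 6 = P.o
  m : v 7 = P.m

theorem Vars.update {P : Params} {v : ℕ → ℕ} (hv : P.Vars v) {d : ℕ} (hd : 8 ≤ d) (x : ℕ) :
    P.Vars (Function.update v d x) := by
  obtain ⟨h0, h1, h2, h3, h4, h5, h6, h7⟩ := hv
  constructor <;> rw [Function.update_of_ne (by omega)] <;> assumption

def writeSetup (S : WExpr) : Writer :=
  .seq (.seq (.emit 0 (var 4) (var 3) 1 0) (.loop (var 2 - 1)
    (.seq (.emit 1 (var 4 + var 8 + 1) (var 3) (var 4 + var 8) 0)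
      (.emit 1 (var 4 + var 8 + 1) (var 3) (var 4 + var 8) 0))))
    (.seq (.emit 0 (var 4 + var 2) (var 3) 6 0) (.emit 0 (var 4 + var 2 + 1) (var 3) S 0))

def writeFourier : Writer :=
  .loop (var 0 * var 0 * var 2) (.bind (var 0 * var 0 * var 2 - 1 - var 8) (.bind (WExpr.mod (var 9) (var 2))
    (.seq (.emit 13 (var 5 + var 9) 0 0 0) (.loop (var 10)
      (.conj (.emit 3 (var 4 + var 2 + 2) (var 3) (var 5 + (var 9 - var 10) + var 11) (var 5 + var 9))
        (.emit 14 (var 4 + var 2 + 2) 0 (var 10 - var 11 + 1) 0))))))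

/-- Variables during loading: `9`, `10`, `11` are the block numbers, `12` is the word to be loaded,
`13` to `16` are its row, its column and their minimum and maximum, and `17` to `20` are the
candidate row and column indices in the large matrices. Variable `21` counts qubits. -/
def writeEntry (base : WExpr) (i j : ℕ) : Writer :=
  .ite ((var 0 - var i) * (var 0 - var j))
    (.emit 1 (var 6 + var 12) (var 3) (base + 2 * (var i * var 0 + var j) + WExpr.mod (var 12) 2) 0) .nop

def writeQubits (i j : ℕ) : Writer :=
  .ite ((var 0 - var i) * (var 0 - var j) * WExpr.eq (WExpr.mod (var 12) 2) 0)
    (.loop (var 2) (.emit 3 (var 6 + var 12) (var 3) (var 5 + (var i * var 0 + var j) * var 2 + var 21)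
      (var 4 + (var 2 - 1 - var 21)))) .nop

def writeLoad : Writer :=
  .loop (2 * (var 1 * var 1)) (.bind (var 12 / 2 / var 1) (.bind (WExpr.mod (var 12 / 2) (var 1))
    (.bind (WExpr.min (var 13) (var 14)) (.bind (WExpr.max (var 13) (var 14))
      (.bind (var 9 * var 7 + WExpr.mod (var 15) (var 7)) (.bind (var 10 * var 7 + WExpr.mod (var 15) (var 7))
        (.bind (var 10 * var 7 + WExpr.mod (var 16) (var 7)) (.bind (var 11 * var 7 + WExpr.mod (var 16) (var 7))
          (.ite (WExpr.eq (var 15 / var 7) 0 * WExpr.eq (var 16 / var 7) 1) (writeEntry 0 17 19)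
            (.ite (WExpr.eq (var 15 / var 7) 1 * WExpr.eq (var 16 / var 7) 2)
              (writeEntry (2 * (var 0 * var 0)) 18 20)
              (.ite (WExpr.eq (var 15 / var 7) 0 * WExpr.eq (var 16 / var 7) 2) (writeQubits 17 20) .nop)))))))))))

def writePhases : Writer :=
  .conj (.seq (.emit 4 (var 4 + var 2 + 3) (var 3) (var 6 + 2 * (var 1 * var 1)) (var 4 + var 2))
      (.emit 10 (var 4 + var 2 + 3) (var 3) (var 6 + 2 * (var 1 * var 1) + 1) (var 4 + var 2)))
    (.loop (var 2) (.conj (.emit 4 (var 4 + var 2 + 4) (var 3) (var 4 + var 2 + 3) (var 4 + var 12))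
      (.emit 14 (var 4 + var 2 + 4) 0 (var 2 - var 12) 0)))

def writeOracles : Writer :=
  .loop 125 (.bind (var 8 / 5 / 5) (.bind (WExpr.mod (var 8 / 5) 5) (.bind (WExpr.mod (var 8) 5)
    (.conj (.seq writeLoad (relocate 12 (var 6))) writePhases))))

def writeOut : Writer :=
  .loop (2 * (var 0 * var 0)) (.conj
    (.seq (.loop (var 2) (.emit 3 (var 4 + var 2 + 3) (var 3) (var 5 + var 8 / 2 * var 2 + var 9)
      (var 4 + var 9))) (.emit 1 (var 4 + var 2 + 3) (var 3) (var 4 + var 2 + 1) 0))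
    (.ite (WExpr.eq (WExpr.mod (var 8) 2) 0)
      (.emit 2 (4 * (var 0 * var 0) + var 8) (var 3) (var 4 + var 2 + 3) (var 4 + var 2 + 1))
      (.emit 2 (4 * (var 0 * var 0) + var 8) (var 3) (var 4 + var 2 + 1) (var 4 + var 2 + 3))))

def writeBody (S : WExpr) : Writer :=
  .seq (.seq (writeSetup S) (.conj writeFourier writeOracles)) writeOut

/-- Write the circuit for the product of matrices with entries of magnitude at most `n ^ c`. -/
def writer (c : ℕ) : Writer :=
  .bind (var 0 + (3 - var 0)) (.bits (WExpr.pow (var 1) (2 * c + 3)) (.bind (6 * (var 0 * var 0))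
    (.bind (var 4 + var 2 + 5) (.bind (var 5 + var 0 * var 0 * var 2) (.bind (var 1 / 3)
      (writeBody (WExpr.pow (var 1) (2 * c + 1))))))))

/-! ### The writing program produces the intended circuit -/

variable {P : Params} {h : Store} {v : ℕ → ℕ}

theorem gates_writeSetup (hv : P.Vars v) {S : WExpr} (hS : S.eval h v = P.S) :
    (writeSetup S).gates h 8 v = P.setup := by
  obtain ⟨h0, h1, h2, h3, h4, h5, h6, h7⟩ := hv
  simp [writeSetup, setup, h2, h3, h4, hS, Gate.decode]

theorem gates_writeFourier (hv : P.Vars v) : writeFourier.gates h 8 v = P.fourierPart := by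
  obtain ⟨h0, h1, h2, h3, h4, h5, h6, h7⟩ := hv
  simp [writeFourier, fourierPart, fourier, fourierStep, h0, h2, h3, h4, h5, Gate.decode,
    pow_two]

theorem gates_writeEntry (hv : P.Vars v) (base : WExpr) (i j : ℕ) :
    (writeEntry base i j).gates h 21 v = P.loadEntry (v 12) (base.eval h v) (v i) (v j) := by
  obtain ⟨h0, h1, h2, h3, h4, h5, h6, h7⟩ := hv
  simp [writeEntry, loadEntry, h0, h3, h6, Gate.decode, Nat.sub_eq_zero_iff_le]

theorem gates_writeQubits (hv : P.Vars v) {i j : ℕ} (hi : i < 21) (hj : j < 21) :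
    (writeQubits i j).gates h 21 v = P.loadQubits (v 12) (v i) (v j) := by
  obtain ⟨h0, h1, h2, h3, h4, h5, h6, h7⟩ := hv
  simp [writeQubits, loadQubits, h0, h2, h3, h4, h5, h6, Gate.decode, Nat.sub_eq_zero_iff_le,
    hi.ne, hj.ne]
  congr 1
  exact propext (by tauto)

theorem ite_eq_mul_eq (a b c d : WExpr) {α : Type*} (x y : α) :
    (if (WExpr.eq a b * WExpr.eq c d).eval h v ≠ 0 then x else y) =
      if a.eval h v = b.eval h v ∧ c.eval h v = d.eval h v then x else y := by
  congr 1
  by_cases h1 : a.eval h v = b.eval h v <;> by_cases h2 : c.eval h v = d.eval h v <;> simp [h1, h2]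

theorem gates_writeLoad (hv : P.Vars v) :
    writeLoad.gates h 12 v = P.load (v 9) (v 10) (v 11) := by
  simp only [writeLoad, load, Writer.gates_loop]
  congr 1
  · funext k
    simp only [Writer.gates_bind, Writer.gates_ite, ite_eq_mul_eq]
    rw [gates_writeEntry (P := P), gates_writeEntry (P := P), gates_writeQubits (P := P)]
    · simp [hv.n, hv.s, hv.m, pow_two, loadCell, -Nat.div_eq_zero_iff]
    all_goals (constructor <;> simp [hv.n, hv.s, hv.K, hv.N, hv.a, hv.b, hv.o, hv.m])
  · simp [hv.s, pow_two]

theorem gates_writePhases (hv : P.Vars v) : writePhases.gates h 12 v = P.phases := by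
  obtain ⟨h0, h1, h2, h3, h4, h5, h6, h7⟩ := hv
  simp [writePhases, phases, phasePrep, h1, h2, h3, h4, h6, Gate.decode, pow_two]
  rfl

theorem gates_writeOracles (hv : P.Vars v) : writeOracles.gates h 8 v =
    (List.range 125).flatMap (P.oracle (circuitOf h)) := by
  simp only [writeOracles, Writer.gates_loop]
  congr 1
  funext k
  simp only [Writer.gates_bind, Writer.gates_conj, Writer.gates_seq]
  have hv' : P.Vars (Function.update (Function.update (Function.update (Function.update v 8 k) 9
      (k / 5 / 5)) 10 (k / 5 % 5)) 11 (k % 5)) :=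
    (((hv.update le_rfl k).update (by norm_num) _).update (by norm_num) _).update (by norm_num) _
  simp
  rw [gates_writeLoad hv', gates_writePhases hv', Writer.gates_relocate _ P.o (by simp [hv.o])]
  simp [oracle]

theorem gates_writeOut (hv : P.Vars v) : writeOut.gates h 8 v = P.out := by
  obtain ⟨h0, h1, h2, h3, h4, h5, h6, h7⟩ := hv
  simp only [writeOut, out, Writer.gates_loop]
  congr 1
  · funext k
    simp [outStep, outPrep, h0, h2, h3, h4, h5, Gate.decode, pow_two]
  · simp [h0, pow_two]

theorem gates_writeBody (hv : P.Vars v) {S : WExpr} (hS : S.eval h v = P.S) :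
    (writeBody S).gates h 8 v = P.circuit (circuitOf h) := by
  simp only [writeBody, circuit, Writer.gates_seq, Writer.gates_conj, gates_writeSetup hv hS,
    gates_writeFourier hv, gates_writeOracles hv, gates_writeOut hv]

/-! ### Cost of the writing program -/

theorem cost_loop_le {h : Store} {d : ℕ} {v : ℕ → ℕ} {e : WExpr} {p : Writer} {C : ℕ}
    (hp : ∀ i < e.eval h v, p.cost h (d + 1) (Function.update v d i) ≤ C) :
    (Writer.loop e p).cost h d v ≤ 2 + e.eval h v * (C + 2) := by
  rw [Writer.cost]
  refine Nat.add_le_add_left ((Finset.sum_le_card_nsmul _ _ (C + 2) fun i hi => ?_).trans ?_) _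
  · exact Nat.add_le_add_right (hp i (Finset.mem_range.1 hi)) 2
  · simp

/-- Undoing takes eight steps per gate, and there are at most as many gates as steps; hence `9 = 1 +
8`. -/
theorem cost_conj_le {h : Store} {d : ℕ} {v : ℕ → ℕ} (p q : Writer) :
    (Writer.conj p q).cost h d v ≤ 9 * p.cost h d v + q.cost h d v + 4 := by
  have := p.length_run_le_cost h d v
  simp only [Writer.cost]; omega

theorem cost_writeSetup (hv : P.Vars v) (S : WExpr) : (writeSetup S).cost h 8 v ≤ 20 + 14 * P.K := by
  have : (Writer.loop (var 2 - 1)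
    (.seq (.emit 1 (var 4 + var 8 + 1) (var 3) (var 4 + var 8) 0)
      (.emit 1 (var 4 + var 8 + 1) (var 3) (var 4 + var 8) 0))).cost h 8 v ≤ 2 + (P.K - 1) * 14 := by
    refine (cost_loop_le (C := 12) fun i _ => by simp [Writer.cost]).trans (by simp [hv.K])
  simp only [writeSetup, Writer.cost] at this ⊢
  omega

/-- Each of the `n ^ 2 * K` qubits has fewer than `K` controlled phases. This is the source of the
square of the logarithm in the final bound. -/
theorem cost_writeFourier (hv : P.Vars v) :
    writeFourier.cost h 8 v ≤ 2 + P.n ^ 2 * P.K * (12 + 26 * P.K) := by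
  refine (cost_loop_le (C := 10 + 26 * P.K) fun i hi => ?_).trans (le_of_eq ?_)
  · have hK : 0 < P.K := by
      by_contra hK
      simp [hv.K, show P.K = 0 by omega] at hi
    rw [Writer.cost, Writer.cost, Writer.cost, Writer.cost]
    refine (Nat.add_le_add_left (Nat.add_le_add_left (Nat.add_le_add_left
      (cost_loop_le (C := 24) fun j _ => by simp [Writer.cost, Writer.run]) _) _) _).trans ?_
    have := (Nat.mod_lt (P.n * P.n * P.K - 1 - i) hK).le
    simp [hv.K, hv.n]
    omega
  · simp [hv.K, hv.n]; ring

theorem cost_writeEntry (base : WExpr) (i j d : ℕ) : (writeEntry base i j).cost h d v ≤ 7 := by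
  simp only [writeEntry, Writer.cost]
  split_ifs <;> omega

theorem cost_writeQubits (hv : v 2 = P.K) (i j d : ℕ) :
    (writeQubits i j).cost h d v ≤ 3 + 8 * P.K := by
  have := cost_loop_le (h := h) (d := d) (v := v) (e := var 2)
    (p := .emit 3 (var 6 + var 12) (var 3) (var 5 + (var i * var 0 + var j) * var 2 + var 21)
      (var 4 + (var 2 - 1 - var 21))) (C := 6) fun i _ => by simp [Writer.cost]
  simp only [WExpr.eval_var, hv] at this
  rw [writeQubits, Writer.cost]
  split_ifs
  · omega
  · simp only [Writer.cost]; omega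

theorem cost_writeLoad (hv : P.Vars v) :
    writeLoad.cost h 12 v ≤ 2 + 2 * P.s ^ 2 * (24 + 8 * P.K) := by
  refine (cost_loop_le (C := 22 + 8 * P.K) fun i _ => ?_).trans (le_of_eq ?_)
  · have hq : ∀ v' : ℕ → ℕ, v' 2 = P.K → (writeQubits 17 20).cost h 21 v' ≤ 3 + 8 * P.K := by
      intro v' hv'
      exact cost_writeQubits hv' _ _ _
    simp only [Writer.cost.eq_5, Writer.cost.eq_7]
    have h1 := fun v' : ℕ → ℕ => cost_writeEntry (h := h) (v := v') 0 17 19 21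
    have h2 := fun v' : ℕ → ℕ => cost_writeEntry (h := h) (v := v') (2 * (var 0 * var 0)) 18 20 21
    refine (Nat.add_le_add_left (Nat.add_le_add_left (Nat.add_le_add_left (Nat.add_le_add_left
      (Nat.add_le_add_left (Nat.add_le_add_left (Nat.add_le_add_left (Nat.add_le_add_left
      (show _ ≤ 14 + 8 * P.K from ?_) _) _) _) _) _) _) _) _).trans (by omega)
    split_ifs
    · exact (Nat.add_le_add_right (h1 _) 1).trans (by omega)
    · exact (Nat.add_le_add_right (Nat.add_le_add_right (h2 _) 1) 1).trans (by omega)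
    · exact (Nat.add_le_add_right (Nat.add_le_add_right (Nat.add_le_add_right
        (hq _ (by simp [hv.K])) 1) 1) 1).trans (by omega)
    · simp only [Writer.cost]; omega
  · simp [hv.s]; ring

theorem cost_writePhases (hv : P.Vars v) : writePhases.cost h 12 v ≤ 34 + 26 * P.K := by
  have := cost_loop_le (h := h) (d := 12) (v := v) (e := var 2)
    (p := .conj (.emit 4 (var 4 + var 2 + 4) (var 3) (var 4 + var 2 + 3) (var 4 + var 12))
      (.emit 14 (var 4 + var 2 + 4) 0 (var 2 - var 12) 0)) (C := 24)
      fun i _ => by simp [Writer.cost, Writer.run]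
  simp only [WExpr.eval_var, hv.K] at this
  rw [writePhases, Writer.cost]
  simp only [Writer.cost, Writer.run, List.length_append, List.length_singleton] at this ⊢
  omega

theorem cost_writeOracles (hv : P.Vars v) : writeOracles.cost h 8 v ≤
    2 + 125 * (9 * (2 + 2 * P.s ^ 2 * (24 + 8 * P.K) + (2 + 9 * (circuitOf h).length)) +
      (34 + 26 * P.K) + 9) := by
  refine cost_loop_le fun i _ => ?_
  have hb : ∀ v', P.Vars v' →
      (Writer.conj (.seq writeLoad (relocate 12 (var 6))) writePhases).cost h 12 v' ≤
        9 * (2 + 2 * P.s ^ 2 * (24 + 8 * P.K) + (2 + 9 * (circuitOf h).length)) +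
          (34 + 26 * P.K) + 4 := by
    intro v' hv'
    have h1 := cost_writeLoad (h := h) hv'
    have h2 := cost_writePhases (h := h) hv'
    have h3 := cost_relocate h 12 v' (var 6)
    refine (cost_conj_le _ _).trans ?_
    rw [Writer.cost.eq_3]
    omega
  simp only [Writer.cost.eq_5]
  exact (Nat.add_le_add_left (Nat.add_le_add_left (Nat.add_le_add_left
    (hb _ ((((hv.update le_rfl i).update (by norm_num) _).update (by norm_num) _).update
      (by norm_num) _)) _) _) _).trans (by omega)

theorem cost_writeOut (hv : P.Vars v) :
    writeOut.cost h 8 v ≤ 2 + 2 * P.n ^ 2 * (9 * (8 + 8 * P.K) + 13) := by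
  refine (cost_loop_le (C := 9 * (8 + 8 * P.K) + 11) fun i _ => ?_).trans (le_of_eq ?_)
  · refine (cost_conj_le _ _).trans ?_
    have := cost_loop_le (h := h) (d := 9) (v := Function.update v 8 i) (e := var 2)
      (p := .emit 3 (var 4 + var 2 + 3) (var 3) (var 5 + var 8 / 2 * var 2 + var 9)
      (var 4 + var 9)) (C := 6) fun i _ => by simp [Writer.cost]
    simp only [WExpr.eval_var, (hv.update le_rfl i).K] at this
    simp only [Writer.cost, ite_self] at this ⊢
    omega
  · simp [hv.n]; ring

theorem cost_writeBody (hP : P.Valid) (hv : P.Vars v) (S : WExpr) :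
    (writeBody S).cost h 8 v ≤ 100000 * ((circuitOf h).length + P.s ^ 2 * P.K ^ 2) := by
  have h1 := cost_writeSetup (h := h) hv S
  have h2 := cost_writeFourier (h := h) hv
  have h3 := cost_writeOracles (h := h) hv
  have h4 := cost_writeOut (h := h) hv
  have h5 := cost_conj_le (h := h) (d := 8) (v := v) writeFourier writeOracles
  have h6 : (writeBody S).cost h 8 v = (writeSetup S).cost h 8 v +
    (Writer.conj writeFourier writeOracles).cost h 8 v + writeOut.cost h 8 v := rfl
  have hK := hP.hK
  have hs : 1 ≤ P.s ^ 2 := Nat.one_le_pow _ _ (by have := hP.hm; have := hP.hm0; omega)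
  have hn : P.n ^ 2 ≤ P.s ^ 2 := Nat.pow_le_pow_left hP.hn 2
  have z1 : P.K ≤ P.s ^ 2 * P.K ^ 2 := by nlinarith
  have z2 : P.s ^ 2 ≤ P.s ^ 2 * P.K ^ 2 := Nat.le_mul_of_pos_right _ (by positivity)
  have z3 : P.s ^ 2 * P.K ≤ P.s ^ 2 * P.K ^ 2 := Nat.mul_le_mul_left _ (by nlinarith)
  have z4 : P.n ^ 2 * P.K ≤ P.s ^ 2 * P.K ^ 2 := (Nat.mul_le_mul_right _ hn).trans z3
  have z5 : P.n ^ 2 * P.K ^ 2 ≤ P.s ^ 2 * P.K ^ 2 := Nat.mul_le_mul_right _ hn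
  have z6 : 1 ≤ P.s ^ 2 * P.K ^ 2 := hs.trans z2
  generalize (circuitOf h).length = G at *
  rw [h6]
  have e2 : P.n ^ 2 * P.K * (12 + 26 * P.K) = 12 * (P.n ^ 2 * P.K) + 26 * (P.n ^ 2 * P.K ^ 2) := by ring
  have e3 : 2 * P.s ^ 2 * (24 + 8 * P.K) = 48 * P.s ^ 2 + 16 * (P.s ^ 2 * P.K) := by ring
  have e4 : 2 * P.n ^ 2 * (9 * (8 + 8 * P.K) + 13) = 170 * P.n ^ 2 + 144 * (P.n ^ 2 * P.K) := by ring
  rw [e2] at h2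
  rw [e3] at h3
  rw [e4] at h4
  omega

end Params


open Filter Asymptotics

/-! ## The reduction of the matrix product to traces of third powers -/

theorem bounded_circuitOf {B n κ : ℕ} {A : Com} {s : ℕ} {τ : Store} (hB : (n + 2) ^ κ ≤ B)
    (hn : n ≤ B) (h : Exec ((n + 2) ^ κ) A (initStore n fun _ => 0) s τ) :
    ∀ g ∈ circuitOf τ, g.Bounded B := by
  have hb := Exec.le_bound hB h fun a i => by
    simp only [initStore]
    split_ifs <;> omega
  intro g hg
  obtain ⟨i, -, rfl⟩ := List.mem_map.1 hg
  exact Gate.bounded_decode (hb _ _) (hb _ _) (hb _ _) (hb _ _)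

/-- The parameters of the circuit for matrices of size `n` with entries up to `n ^ c`. -/
def params (c n : ℕ) : Params :=
  let s := n + (3 - n)
  let K := (s ^ (2 * c + 3)).size
  { n := n, s := s, m := s / 3, K := K, N := 2 ^ K, S := s ^ (2 * c + 1), a := 6 * n ^ 2,
    b := 6 * n ^ 2 + K + 5, o := 6 * n ^ 2 + K + 5 + n ^ 2 * K }

theorem params_pow_lt (c n : ℕ) : (params c n).s ^ (2 * c + 3) < (params c n).N :=
  Nat.lt_size_self _

theorem three_le_params_s (c n : ℕ) : 3 ≤ (params c n).s := by
  show 3 ≤ n + (3 - n); omega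

theorem params_S (c n : ℕ) : 2 * (params c n).S < (params c n).N := by
  refine lt_of_le_of_lt ?_ (params_pow_lt c n)
  have h3 := three_le_params_s c n
  show 2 * (params c n).s ^ (2 * c + 1) ≤ _
  rw [show 2 * c + 3 = 2 + (2 * c + 1) by ring, pow_add _ 2]
  exact Nat.mul_le_mul_right _ (by nlinarith)

/-- Entries of the dual block go up to `N - 1`, so this bound, at most `s ^ (2 * c + 4)`, dictates
the exponent required of the subroutine. -/
theorem params_N_le (c n : ℕ) : (params c n).N ≤ 2 * (params c n).s ^ (2 * c + 3) := by
  have h3 := three_le_params_s c n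
  have hpos : 0 < (params c n).s ^ (2 * c + 3) := by positivity
  have h1 : 0 < ((params c n).s ^ (2 * c + 3)).size := Nat.size_pos.2 hpos
  have h2 : 2 ^ (((params c n).s ^ (2 * c + 3)).size - 1) ≤ (params c n).s ^ (2 * c + 3) :=
    Nat.lt_size.1 (by omega)
  show 2 ^ ((params c n).s ^ (2 * c + 3)).size ≤ _
  rw [show ((params c n).s ^ (2 * c + 3)).size = ((params c n).s ^ (2 * c + 3)).size - 1 + 1 by omega,
    pow_succ]
  omega

theorem params_valid (c n : ℕ) : (params c n).Valid := by
  have h3 := three_le_params_s c n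
  have hlt := params_pow_lt c n
  have hS := params_S c n
  have h27 : 3 ^ 3 ≤ (params c n).s ^ (2 * c + 3) :=
    (Nat.pow_le_pow_left h3 3).trans (Nat.pow_le_pow_right (by omega) (by omega))
  constructor
  · show n ≤ n + (3 - n); omega
  · show 3 * ((params c n).s / 3) ≤ _; omega
  · show 0 < (params c n).s / 3; omega
  -- The worst case is `n = 5` with blocks of size one; it is the reason for five pieces.
  · show n ≤ 5 * ((n + (3 - n)) / 3); omega
  · exact Nat.size_pos.2 (by show 0 < (params c n).s ^ (2 * c + 3); omega)
  · rfl
  · omega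
  · omega
  · rfl
  · rfl
  · rfl

theorem isBigO_params_K (c : ℕ) :
    (fun n => ((params c n).K : ℝ)) =O[atTop] fun n : ℕ => Real.log n := by
  refine IsBigO.of_bound (1 + 1 / Real.log 2 * (2 * c + 3)) ?_
  filter_upwards [eventually_ge_atTop 3] with n hn
  have hlog2 : 0 < Real.log 2 := Real.log_pos (by norm_num)
  have hs : (params c n).s = n := by show n + (3 - n) = n; omega
  have h1 : Real.log 2 * ((params c n).K : ℝ) ≤ Real.log 2 + (2 * c + 3) * Real.log n := by
    have h := params_N_le c n
    rw [hs] at h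
    have h' : (2 : ℝ) ^ (params c n).K ≤ 2 * (n : ℝ) ^ (2 * c + 3) := by exact_mod_cast h
    have h2 := Real.log_le_log (by positivity) h'
    rw [Real.log_pow, Real.log_mul (by norm_num) (by positivity), Real.log_pow] at h2
    push_cast at h2
    linarith
  have h2 : 1 ≤ Real.log n := by
    rw [← Real.log_exp 1]
    refine Real.log_le_log (Real.exp_pos 1) ?_
    have := Real.exp_one_lt_d9
    have : (3 : ℝ) ≤ n := by exact_mod_cast hn
    linarith
  rw [Real.norm_of_nonneg (by positivity), Real.norm_of_nonneg (by linarith)]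
  have h3 : ((params c n).K : ℝ) ≤ 1 + 1 / Real.log 2 * ((2 * c + 3) * Real.log n) := by
    have : ((params c n).K : ℝ) = 1 / Real.log 2 * (Real.log 2 * ((params c n).K : ℝ)) := by field_simp
    rw [this]
    calc _ ≤ 1 / Real.log 2 * (Real.log 2 + (2 * c + 3) * Real.log n) := by gcongr
      _ = _ := by field_simp
  nlinarith

namespace Params

theorem gates_writer (c n : ℕ) (h : Store) :
    (writer c).gates h 1 (startVar n) = (params c n).circuit (circuitOf h) := by
  simp only [writer, Writer.gates_bind, Writer.gates_bits]
  apply gates_writeBody (P := params c n)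
  · constructor <;> simp [startVar, params, pow_two]
  · simp [startVar, params]

theorem cost_writer (c n : ℕ) (h : Store) : (writer c).cost h 1 (startVar n) ≤
    100011 * ((circuitOf h).length + (params c n).s ^ 2 * (params c n).K ^ 2) := by
  simp only [writer, Writer.cost.eq_5, Writer.cost.eq_6]
  have hP := params_valid c n
  have h3 := three_le_params_s c n
  have hK := hP.hK
  have hb : ∀ v', (params c n).Vars v' → (writeBody (WExpr.pow (.var 1) (2 * c + 1))).cost h 8 v' ≤
      100000 * ((circuitOf h).length + (params c n).s ^ 2 * (params c n).K ^ 2) :=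
    fun v' hv' => cost_writeBody hP hv' _
  have hs : (WExpr.eval h (Function.update (startVar n) 1
      (WExpr.eval h (startVar n) (.var 0 + (3 - .var 0)))) (WExpr.pow (.var 1) (2 * c + 3))).size =
      (params c n).K := by simp [startVar, params]
  have z1 : 1 ≤ (params c n).s ^ 2 * (params c n).K ^ 2 := Nat.one_le_iff_ne_zero.2 (by positivity)
  have z2 : (params c n).K ≤ (params c n).s ^ 2 * (params c n).K ^ 2 := by
    have : 1 ≤ (params c n).s ^ 2 := Nat.one_le_iff_ne_zero.2 (by positivity)
    nlinarith
  refine (Nat.add_le_add_left (Nat.add_le_add (by rw [hs]) (Nat.add_le_add_left (Nat.add_le_add_left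
    (Nat.add_le_add_left (Nat.add_le_add_left (hb _ ?_) _) _) _) _)) _).trans (by omega)
  constructor <;> simp [startVar, params, pow_two]

end Params

/-- The subroutine is used for size `s = max n 3`, which is `n` for all but finitely many `n`, so
its time enters as `T n` itself and not at another argument. -/
theorem quantumTime_matMul {c : ℕ} {T : ℕ → ℝ} {ε : ℝ} (hT : ∀ n, 0 ≤ T n) (hε0 : 0 ≤ ε)
    (hε1 : 250 * √ε ≤ 1) (h : QuantumTime (1 - ε) (traceCube (2 * c + 4)) T) :
    QuantumTime ((1 - 250 * √ε) ^ 2) (matMul c) fun n => T n + (n : ℝ) ^ 2 * Real.log n ^ 2 := by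
  obtain ⟨A, κ, t, ht, hA⟩ := h
  choose u S hE hlen hprob using fun n => hA (params c n).s
  refine quantumTime_of_writer A κ (.var 0 + (3 - .var 0)) (fun n => (params c n).s)
    (fun n => by simp [startVar, params]) (fun n => by show n + (3 - n) ≤ n + 3; omega)
    (Params.writer c) u (fun n => 200030 * (t (params c n).s + (params c n).s ^ 2 * (params c n).K ^ 2))
    S (fun n => ⟨u n, le_rfl, hE n⟩) (fun n => ?_) ?_ (fun n x => ?_)
  · have h1 := Params.cost_writer c n (S n)
    have h2 := hlen n
    have hP := params_valid c n
    have hK := hP.hK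
    have h3 := three_le_params_s c n
    have z1 : 1 ≤ (params c n).s ^ 2 * (params c n).K ^ 2 := Nat.one_le_iff_ne_zero.2 (by positivity)
    omega
  · have hs : ∀ᶠ n in atTop, (params c n).s = n := by
      filter_upwards [eventually_ge_atTop 3] with n hn
      show n + (3 - n) = n; omega
    have h1 : (fun n => (t (params c n).s : ℝ)) =O[atTop]
        fun n => T n + (n : ℝ) ^ 2 * Real.log n ^ 2 := by
      have h2 : (fun n => (t (params c n).s : ℝ)) =ᶠ[atTop] fun n => (t n : ℝ) := by
        filter_upwards [hs] with n hn
        rw [hn]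
      refine h2.trans_isBigO (ht.trans (IsBigO.of_norm_le fun n => ?_))
      rw [Real.norm_of_nonneg (hT n)]
      have : 0 ≤ (n : ℝ) ^ 2 * Real.log n ^ 2 := by positivity
      linarith
    have h2 : (fun n => ((params c n).s : ℝ) ^ 2 * ((params c n).K : ℝ) ^ 2) =O[atTop]
        fun n => T n + (n : ℝ) ^ 2 * Real.log n ^ 2 := by
      have h3 : (fun n => ((params c n).s : ℝ)) =ᶠ[atTop] fun n : ℕ => (n : ℝ) := by
        filter_upwards [hs] with n hn
        rw [hn]
      refine ((h3.isBigO.pow 2).mul ((isBigO_params_K c).pow 2)).trans (IsBigO.of_norm_le fun n => ?_)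
      have : 0 ≤ (n : ℝ) ^ 2 * Real.log n ^ 2 := by positivity
      rw [Real.norm_of_nonneg this]
      have := hT n
      linarith
    have h3 := (h1.add h2).const_mul_left 200030
    simpa using h3
  · have hP := params_valid c n
    have hn := hP.hn
    have hlt := params_pow_lt c n
    have h3 := three_le_params_s c n
    have hs0 : 0 < (params c n).s := by omega
    set s := (params c n).s with hs
    set W := (s + 2) ^ (κ + 1) with hW
    have hWs : s ≤ W := by
      rw [hW, pow_succ]
      have := Nat.one_le_iff_ne_zero.2 (pow_ne_zero κ (show s + 2 ≠ 0 by omega))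
      nlinarith
    -- Odd, and large enough for the gate parameters as well as for the words of a query.
    set V := 2 * (W + s ^ (2 * c + 4)) + 1 with hV
    have hnc : n ^ c ≤ s ^ c := Nat.pow_le_pow_left hn c
    have hg := Params.gates_writer c n (S n)
    rw [Writer.gates] at hg
    rw [hg]
    refine Params.prob_circuit (P := params c n) hP (W := W) (V := V)
      (L := W + V + 2 * (params c n).s ^ 2 + 2) (c' := 2 * c + 4)
      (bounded_circuitOf (Nat.pow_le_pow_right (by omega) (by omega)) hWs (hE n))
      (by omega) (by omega) (by omega) (by omega) ?_ ?_ ?_ ?_ (params_S c n) hε0 hε1 (fun y => ?_) x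
    · show s ^ (2 * c + 4) ≤ V; omega
    · refine (params_N_le c n).trans ?_
      rw [pow_succ _ (2 * c + 3), mul_comm]
      gcongr; omega
    · refine lt_of_le_of_lt (hnc.trans ?_) hlt
      exact Nat.pow_le_pow_right hs0 (by omega)
    · show n * (n ^ c * n ^ c) ≤ s ^ (2 * c + 1)
      rw [show 2 * c + 1 = 1 + (c + c) by ring, pow_add, pow_add, pow_one]
      gcongr; exact hn
    · have := hprob n y
      rwa [runCircuit_eq_circ] at this


/-! ## Programs with labels -/

/-- Assign, and go to `p` if the condition `c` holds, and to `q` otherwise. -/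
structure Instr where
  a : ℕ
  i : Expr
  e : Expr
  c : Expr
  p : ℕ
  q : ℕ

/-- The assignment that is carried out does not change the store. -/
def Instr.branch (c : Expr) (p q : ℕ) : Instr := ⟨0, .lit 0, .read 0 (.lit 0), c, p, q⟩

def Com.length : Com → ℕ
  | .skip => 1
  | .assign _ _ _ => 1
  | .seq c₁ c₂ => c₁.length + c₂.length
  | .cond _ c₁ c₂ => 1 + (c₁.length + c₂.length)
  | .loop _ c => 1 + c.length

/-- The instructions of a program; the first one has the number `f`, and in the end there is a
jump to `q`. -/
def Com.code : Com → ℕ → ℕ → List Instr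
  | .skip, _, q => [.branch (.lit 0) q q]
  | .assign a i e, _, q => [⟨a, i, e, .lit 0, q, q⟩]
  | .seq c₁ c₂, f, q => c₁.code f (f + c₁.length) ++ c₂.code (f + c₁.length) q
  | .cond e c₁ c₂, f, q => .branch e (f + 1) (f + 1 + c₁.length) ::
      (c₁.code (f + 1) q ++ c₂.code (f + 1 + c₁.length) q)
  | .loop e c, f, q => .branch e (f + 1) q :: c.code (f + 1) f

theorem Com.length_code (c : Com) : ∀ f q, (c.code f q).length = c.length := by
  induction c with
  | skip => intro f q; rfl
  | assign => intro f q; rfl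
  | seq c₁ c₂ h₁ h₂ => intro f q; simp [Com.code, Com.length, h₁, h₂]
  | cond e c₁ c₂ h₁ h₂ => intro f q; simp [Com.code, Com.length, h₁, h₂]; omega
  | loop e c h => intro f q; simp [Com.code, Com.length, h]; omega

/-- One step of a program with labels. -/
def Step (B : ℕ) (code : List Instr) (k : ℕ) (σ : Store) (k' : ℕ) (σ' : Store) : Prop :=
  ∃ I, code[k]? = some I ∧ I.i.eval σ ≤ B ∧ I.e.eval σ ≤ B ∧
    k' = (if I.c.eval σ ≠ 0 then I.p else I.q) ∧ σ' = σ.write I.a (I.i.eval σ) (I.e.eval σ)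

def Steps (B : ℕ) (code : List Instr) : ℕ → ℕ → Store → ℕ → Store → Prop
  | 0, k, σ, k', σ' => k = k' ∧ σ = σ'
  | t + 1, k, σ, k', σ' => ∃ k₁ σ₁, Step B code k σ k₁ σ₁ ∧ Steps B code t k₁ σ₁ k' σ'

theorem Steps.trans {B : ℕ} {code : List Instr} {t : ℕ} : ∀ {s k k' k'' : ℕ} {σ σ' σ'' : Store},
    Steps B code s k σ k' σ' → Steps B code t k' σ' k'' σ'' → Steps B code (s + t) k σ k'' σ''
  | 0, _, _, _, _, _, _, ⟨h1, h2⟩, h => by subst h1 h2; rwa [Nat.zero_add]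
  | s + 1, _, _, _, _, _, _, ⟨k₁, σ₁, h1, h2⟩, h => by
    rw [Nat.add_right_comm]
    exact ⟨k₁, σ₁, h1, h2.trans h⟩

/-- A pure jump rewrites the word at index `0` of array `0` with itself, so this word has to respect
the bound. -/
theorem step_branch {B : ℕ} {code : List Instr} {k p q : ℕ} {c : Expr} {σ : Store}
    (hσ : σ 0 0 ≤ B) (hk : code[k]? = some (.branch c p q)) :
    Step B code k σ (if c.eval σ ≠ 0 then p else q) σ := by
  refine ⟨_, hk, Nat.zero_le _, hσ, rfl, ?_⟩
  funext a i
  rw [Store.write_apply]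
  split_ifs with h
  · simp only [Instr.branch, Expr.eval] at h ⊢
    rw [h.1, h.2]
  · rfl

/-- The labelled program needs exactly as many steps as the structured program. -/
theorem Exec.steps {B : ℕ} {c : Com} {σ τ : Store} {t : ℕ} (h : Exec B c σ t τ) :
    (∀ a i, σ a i ≤ B) → ∀ {code : List Instr} {f q : ℕ},
      (∀ j < c.length, code[f + j]? = (c.code f q)[j]?) → Steps B code t f σ q τ := by
  induction h with
  | skip σ =>
    intro hσ code f q hc
    have := step_branch (hσ 0 0) (hc 0 Nat.one_pos)
    rw [ite_self] at this
    exact ⟨_, _, this, rfl, rfl⟩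
  | assign σ a i e hi he =>
    intro hσ code f q hc
    exact ⟨_, _, ⟨_, hc 0 Nat.one_pos, hi, he, rfl, rfl⟩, by simp, rfl⟩
  | @seq c₁ c₂ σ₁ σ₂ σ₃ s t h₁ h₂ ih₁ ih₂ =>
    intro hσ code f q hc
    refine (ih₁ hσ (q := f + c₁.length) fun j hj => ?_).trans
      (ih₂ (h₁.le_bound le_rfl hσ) fun j hj => ?_)
    · rw [hc j (by simp only [Com.length]; omega), Com.code, List.getElem?_append_left]
      rwa [Com.length_code]
    · rw [Nat.add_assoc, hc _ (by simp only [Com.length]; omega), Com.code,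
        List.getElem?_append_right (by rw [Com.length_code]; omega), Com.length_code,
        Nat.add_sub_cancel_left]
  | @condTrue e c₁ c₂ σ τ t he h ih =>
    intro hσ code f q hc
    have h1 := step_branch (hσ 0 0) (hc 0 (by simp only [Com.length]; omega))
    rw [if_pos he] at h1
    refine ⟨_, _, h1, ih hσ fun j hj => ?_⟩
    rw [Nat.add_assoc, hc _ (by simp only [Com.length]; omega), Com.code, Nat.add_comm 1 j,
      List.getElem?_cons_succ, List.getElem?_append_left (by rwa [Com.length_code])]
  | @condFalse e c₁ c₂ σ τ t he h ih =>
    intro hσ code f q hc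
    have h1 := step_branch (hσ 0 0) (hc 0 (by simp only [Com.length]; omega))
    rw [if_neg (not_not.2 he)] at h1
    refine ⟨_, _, h1, ih hσ fun j hj => ?_⟩
    rw [show f + 1 + c₁.length + j = f + (c₁.length + j + 1) by omega,
      hc _ (by simp only [Com.length]; omega), Com.code, List.getElem?_cons_succ,
      List.getElem?_append_right (by rw [Com.length_code]; omega), Com.length_code,
      Nat.add_sub_cancel_left]
  | @loopStop e c σ he =>
    intro hσ code f q hc
    have h1 := step_branch (hσ 0 0) (hc 0 (by simp only [Com.length]; omega))
    rw [if_neg (not_not.2 he)] at h1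
    exact ⟨_, _, h1, rfl, rfl⟩
  | @loopStep e c σ₁ σ₂ σ₃ s t he h₁ h₂ ih₁ ih₂ =>
    intro hσ code f q hc
    have h1 := step_branch (hσ 0 0) (hc 0 (by simp only [Com.length]; omega))
    rw [if_pos he] at h1
    refine ⟨_, _, h1, (ih₁ hσ (q := f) fun j hj => ?_).trans
      (ih₂ (h₁.le_bound le_rfl hσ) hc)⟩
    rw [Nat.add_assoc, hc _ (by simp only [Com.length]; omega), Com.code, Nat.add_comm 1 j,
      List.getElem?_cons_succ]

/-! ## One step as a sequence of assignments -/

structure Assign where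
  a : ℕ
  i : Expr
  e : Expr

def Assign.run (A : Assign) (σ : Store) : Store := σ.write A.a (A.i.eval σ) (A.e.eval σ)

/-- All stores, from the first one to the last one, have the property `p`. -/
def Visits (p : Store → Prop) : List Assign → Store → Store → Prop
  | [], σ, τ => σ = τ ∧ p σ
  | A :: L, σ, τ => p σ ∧ Visits p L (A.run σ) τ

theorem Visits.append {p : Store → Prop} {M : List Assign} {τ υ : Store} :
    ∀ {L : List Assign} {σ : Store}, Visits p L σ τ → Visits p M τ υ → Visits p (L ++ M) σ υ
  | [], _, ⟨h, _⟩, h' => by subst h; exact h'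
  | _ :: _, _, ⟨h1, h2⟩, h' => ⟨h1, h2.append h'⟩

/-- The store with the instruction counter `k` and its next value `k'`. -/
def control (k k' : ℕ) (σ : Store) : Store :=
  overlay 2 (fun a i => if i = 0 then (if a = 0 then k else k') else 0) σ

def counterIs (k : ℕ) : Expr :=
  .sub (.lit 1) (.add (.sub (.read 0 (.lit 0)) (.lit k)) (.sub (.lit k) (.read 0 (.lit 0))))

/-- Carry out the instruction if it is the one with the number in the instruction counter. -/
def Instr.assigns (I : Instr) (k : ℕ) : List Assign :=
  [⟨1, .lit 0, .ite (counterIs k) (.ite (I.c.shift 2) (.lit I.p) (.lit I.q)) (.read 1 (.lit 0))⟩,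
    ⟨I.a + 2, .mul (counterIs k) (I.i.shift 2), .ite (counterIs k) (I.e.shift 2)
      (.read (I.a + 2) (.lit 0))⟩]

/-- The instruction counter changes only at the end of the pass, so at most one instruction takes
effect; all others write back a word that they have just read. A counter that matches no instruction
leaves the represented store as it is, which is how a halted program idles. -/
def stepAssigns : List Instr → ℕ → List Assign
  | [], _ => [⟨0, .lit 0, .read 1 (.lit 0)⟩]
  | I :: L, k => I.assigns k ++ stepAssigns L (k + 1)

section

variable {k k' l : ℕ} {σ : Store}

theorem eval_counterIs : (counterIs l).eval (control k k' σ) = if k = l then 1 else 0 := by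
  have : control k k' σ 0 0 = k := rfl
  simp only [counterIs, Expr.eval, this]
  split_ifs <;> omega

theorem control_write_one (x : ℕ) : (control k k' σ).write 1 0 x = control k x σ := by
  funext a i
  rw [Store.write_apply]
  simp only [control, overlay]
  by_cases hi : i = 0 <;> split_ifs <;> first | rfl | omega | simp [hi]

theorem control_write_zero (x : ℕ) : (control k k' σ).write 0 0 x = control x k' σ := by
  funext a i
  rw [Store.write_apply]
  simp only [control, overlay]
  by_cases hi : i = 0 <;> split_ifs <;> first | rfl | omega | simp [hi]

theorem control_write (a i x : ℕ) :
    (control k k' σ).write (a + 2) i x = control k k' (σ.write a i x) := overlay_write _ _ _ _ _ _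

theorem eval_shift_control (e : Expr) : (e.shift 2).eval (control k k' σ) = e.eval σ :=
  Expr.eval_shift _ _ _ _

theorem Store.write_self (σ : Store) (a i : ℕ) : σ.write a i (σ a i) = σ := by
  simp [Store.write]

theorem visits_assigns_of_ne {p : Store → Prop} (I : Instr) (h : p (control k k' σ)) (hk : k ≠ l) :
    Visits p (I.assigns l) (control k k' σ) (control k k' σ) := by
  have h1 : Assign.run ⟨1, .lit 0, .ite (counterIs l) (.ite (I.c.shift 2) (.lit I.p) (.lit I.q))
      (.read 1 (.lit 0))⟩ (control k k' σ) = control k k' σ := by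
    simp only [Assign.run, Expr.eval_ite, eval_counterIs, hk, if_false]
    exact Store.write_self _ _ _
  have h2 : Assign.run ⟨I.a + 2, .mul (counterIs l) (I.i.shift 2), .ite (counterIs l) (I.e.shift 2)
      (.read (I.a + 2) (.lit 0))⟩ (control k k' σ) = control k k' σ := by
    simp only [Assign.run, Expr.eval_ite, Expr.eval, eval_counterIs, hk, if_false, Nat.zero_mul]
    exact Store.write_self _ _ _
  simp only [Instr.assigns, Visits, h1, h2]
  exact ⟨h, h, trivial, h⟩

/-- The jump target is determined before the assignment, since the condition refers to the old
store. -/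
theorem visits_assigns_self {p : Store → Prop} (I : Instr) (h : p (control k k' σ))
    (h' : p (control k (if I.c.eval σ ≠ 0 then I.p else I.q) σ))
    (h'' : p (control k (if I.c.eval σ ≠ 0 then I.p else I.q)
      (σ.write I.a (I.i.eval σ) (I.e.eval σ)))) :
    Visits p (I.assigns k) (control k k' σ) (control k (if I.c.eval σ ≠ 0 then I.p else I.q)
      (σ.write I.a (I.i.eval σ) (I.e.eval σ))) := by
  have h1 : Assign.run ⟨1, .lit 0, .ite (counterIs k) (.ite (I.c.shift 2) (.lit I.p) (.lit I.q))
      (.read 1 (.lit 0))⟩ (control k k' σ) =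
      control k (if I.c.eval σ ≠ 0 then I.p else I.q) σ := by
    simp only [Assign.run, Expr.eval_ite, eval_counterIs, if_true, Expr.eval, eval_shift_control,
      control_write_one]
    simp
  have h2 : ∀ x, Assign.run ⟨I.a + 2, .mul (counterIs k) (I.i.shift 2), .ite (counterIs k)
      (I.e.shift 2) (.read (I.a + 2) (.lit 0))⟩ (control k x σ) =
      control k x (σ.write I.a (I.i.eval σ) (I.e.eval σ)) := by
    intro x
    simp only [Assign.run, Expr.eval_ite, Expr.eval, eval_counterIs, if_true, Nat.one_mul,
      eval_shift_control, control_write]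
    simp
  simp only [Instr.assigns, Visits, h1, h2]
  exact ⟨h, h', trivial, h''⟩

theorem visits_stepAssigns_of_not {p : Store → Prop} : ∀ (L : List Instr) (l : ℕ),
    p (control k k' σ) → p (control k' k' σ) → (∀ j < L.length, k ≠ l + j) →
    Visits p (stepAssigns L l) (control k k' σ) (control k' k' σ)
  | [], _, h, h', _ => ⟨h, control_write_zero _, by
      rw [show Assign.run ⟨0, .lit 0, .read 1 (.lit 0)⟩ (control k k' σ) = control k' k' σ from
        control_write_zero _]; exact h'⟩
  | I :: L, l, h, h', hk => (visits_assigns_of_ne I h (hk 0 (by simp))).append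
      (visits_stepAssigns_of_not L (l + 1) h h' fun j hj => by
        have := hk (j + 1) (by simpa using hj); omega)

theorem visits_stepAssigns {p : Store → Prop} {I : Instr} : ∀ (L : List Instr) (l j : ℕ),
    k = l + j → L[j]? = some I → p (control k k' σ) →
    p (control k (if I.c.eval σ ≠ 0 then I.p else I.q) σ) →
    p (control k (if I.c.eval σ ≠ 0 then I.p else I.q)
      (σ.write I.a (I.i.eval σ) (I.e.eval σ))) →
    p (control (if I.c.eval σ ≠ 0 then I.p else I.q) (if I.c.eval σ ≠ 0 then I.p else I.q)
      (σ.write I.a (I.i.eval σ) (I.e.eval σ))) →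
    Visits p (stepAssigns L l) (control k k' σ)
      (control (if I.c.eval σ ≠ 0 then I.p else I.q) (if I.c.eval σ ≠ 0 then I.p else I.q)
        (σ.write I.a (I.i.eval σ) (I.e.eval σ)))
  | [], _, _, _, h, _, _, _, _ => by simp at h
  | J :: L, l, 0, hk, h, h0, h1, h2, h3 => by
    obtain rfl : J = I := by simpa using h
    obtain rfl : k = l := hk
    exact (visits_assigns_self J h0 h1 h2).append
      (visits_stepAssigns_of_not L (k + 1) h2 h3 fun j _ => by omega)
  | J :: L, l, j + 1, hk, h, h0, h1, h2, h3 =>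
    (visits_assigns_of_ne J h0 (by omega)).append
      (visits_stepAssigns L (l + 1) j (by omega) (by simpa using h) h0 h1 h2 h3)

end


/-! ## Circuits for assignments -/

def Expr.nodes : Expr → ℕ
  | .lit _ => 1
  | .read _ i => i.nodes + 1
  | .add x y => x.nodes + y.nodes + 1
  | .sub x y => x.nodes + y.nodes + 1
  | .mul x y => x.nodes + y.nodes + 1
  | .div x y => x.nodes + y.nodes + 1

/-- All values of subexpressions are below `N`. -/
def Expr.Below (N : ℕ) (σ : Store) : Expr → Prop
  | .lit k => k < N
  | .read a i => i.Below N σ ∧ σ a (i.eval σ) < N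
  | .add x y => x.Below N σ ∧ y.Below N σ ∧ x.eval σ + y.eval σ < N
  | .sub x y => x.Below N σ ∧ y.Below N σ
  | .mul x y => x.Below N σ ∧ y.Below N σ ∧ x.eval σ * y.eval σ < N
  | .div x y => x.Below N σ ∧ y.Below N σ

theorem Expr.Below.eval_lt {N : ℕ} {σ : Store} : ∀ {e : Expr}, e.Below N σ → e.eval σ < N
  | .lit _, h => h
  | .read _ _, h => h.2
  | .add _ _, h => h.2.2
  | .sub _ _, h => lt_of_le_of_lt (Nat.sub_le _ _) h.1.eval_lt
  | .mul _ _, h => h.2.2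
  | .div _ _, h => lt_of_le_of_lt (Nat.div_le_self _ _) h.1.eval_lt

theorem Expr.Below.mono {N N' : ℕ} (hN : N ≤ N') {σ : Store} : ∀ {e : Expr}, e.Below N σ → e.Below N' σ
  | .lit _, h => lt_of_lt_of_le h hN
  | .read _ _, h => ⟨h.1.mono hN, lt_of_lt_of_le h.2 hN⟩
  | .add _ _, h => ⟨h.1.mono hN, h.2.1.mono hN, lt_of_lt_of_le h.2.2 hN⟩
  | .sub _ _, h => ⟨h.1.mono hN, h.2.mono hN⟩
  | .mul _ _, h => ⟨h.1.mono hN, h.2.1.mono hN, lt_of_lt_of_le h.2.2 hN⟩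
  | .div _ _, h => ⟨h.1.mono hN, h.2.mono hN⟩

theorem Expr.exists_below (e : Expr) (k : ℕ) : ∃ κ, ∀ (n : ℕ) (σ : Store),
    (∀ a i, σ a i ≤ (n + 2) ^ k) → e.Below ((n + 2) ^ κ) σ := by
  have hlt : ∀ n a, (n + 2) ^ a < (n + 2) ^ (a + 1) := fun n a =>
    Nat.pow_lt_pow_right (by omega) (by omega)
  induction e with
  | lit w => exact ⟨w + 1, fun n σ _ => lt_of_le_of_lt (le_pow_self n w) (hlt n w)⟩
  | read a i ih =>
    obtain ⟨κ, h⟩ := ih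
    exact ⟨κ + (k + 1), fun n σ hσ => ⟨(h n σ hσ).mono (pow_mono n (by omega)),
      lt_of_le_of_lt (hσ _ _) ((hlt n k).trans_le (pow_mono n (by omega)))⟩⟩
  | add x y ihx ihy =>
    obtain ⟨a, ha⟩ := ihx
    obtain ⟨b, hb⟩ := ihy
    exact ⟨a + b + 1, fun n σ hσ => ⟨(ha n σ hσ).mono (pow_mono n (by omega)),
      (hb n σ hσ).mono (pow_mono n (by omega)),
      lt_of_lt_of_le (Nat.add_lt_add (ha n σ hσ).eval_lt (hb n σ hσ).eval_lt)
        (pow_add_pow_le n a b)⟩⟩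
  | mul x y ihx ihy =>
    obtain ⟨a, ha⟩ := ihx
    obtain ⟨b, hb⟩ := ihy
    exact ⟨a + b, fun n σ hσ => ⟨(ha n σ hσ).mono (pow_mono n (by omega)),
      (hb n σ hσ).mono (pow_mono n (by omega)), by
        rw [pow_add]
        exact Nat.mul_lt_mul'' (ha n σ hσ).eval_lt (hb n σ hσ).eval_lt⟩⟩
  | sub x y ihx ihy =>
    obtain ⟨a, ha⟩ := ihx
    obtain ⟨b, hb⟩ := ihy
    exact ⟨a + b, fun n σ hσ => ⟨(ha n σ hσ).mono (pow_mono n (by omega)),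
      (hb n σ hσ).mono (pow_mono n (by omega))⟩⟩
  | div x y ihx ihy =>
    obtain ⟨a, ha⟩ := ihx
    obtain ⟨b, hb⟩ := ihy
    exact ⟨a + b, fun n σ hσ => ⟨(ha n σ hσ).mono (pow_mono n (by omega)),
      (hb n σ hσ).mono (pow_mono n (by omega))⟩⟩

/-- Compute the value of an expression in cell `h`, with work cells behind it; array number `a`
occupies the `N` cells from `Q + a * N` on. -/
def Expr.circuit (N Q : ℕ) : Expr → ℕ → List Gate
  | .lit k, h => [.add h N (.const k)]
  | .read a i, h => i.circuit N Q (h + 1) ++ [.add h N (.load (Q + a * N) (h + 1))]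
  | .add x y, h => (x.circuit N Q (h + 1) ++ y.circuit N Q (h + 1 + x.nodes)) ++
      [.add h N (.copy (h + 1)), .add h N (.copy (h + 1 + x.nodes))]
  | .sub x y, h => (x.circuit N Q (h + 1) ++ y.circuit N Q (h + 1 + x.nodes)) ++
      [.add h N (.monus (h + 1) (h + 1 + x.nodes))]
  | .mul x y, h => (x.circuit N Q (h + 1) ++ y.circuit N Q (h + 1 + x.nodes)) ++
      [.add h N (.mul (h + 1) (h + 1 + x.nodes))]
  | .div x y, h => (x.circuit N Q (h + 1) ++ y.circuit N Q (h + 1 + x.nodes)) ++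
      [.add h N (.div (h + 1) (h + 1 + x.nodes))]

/-- The memory from cell `Q` on represents the store. -/
def Represents (N Q : ℕ) (m : Mem) (σ : Store) : Prop := ∀ a, ∀ i < N, m (Q + a * N + i) = σ a i

/-- `m'` differs from `m` only in the cells `h, …, h + k - 1`. -/
def AgreeOff (h k : ℕ) (m m' : Mem) : Prop := ∀ i, i < h ∨ h + k ≤ i → m' i = m i

theorem Expr.nodes_pos (e : Expr) : 0 < e.nodes := by cases e <;> simp [Expr.nodes]

theorem Expr.classical_circuit (N Q : ℕ) (e : Expr) : ∀ h, ClassicalCircuit (e.circuit N Q h) := by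
  have h1 : ∀ g : Gate, g.IsClassical → ClassicalCircuit [g] := fun g hg g' hg' => by
    rwa [List.mem_singleton.1 hg']
  have h2 : ∀ g g' : Gate, g.IsClassical → g'.IsClassical → ClassicalCircuit [g, g'] :=
    fun g g' hg hg' => (classicalCircuit_append (C := [g]) (D := [g'])).2 ⟨h1 g hg, h1 g' hg'⟩
  induction e with
  | lit k => exact fun h => h1 _ trivial
  | read a i ih => exact fun h => classicalCircuit_append.2 ⟨ih _, h1 _ trivial⟩
  | add x y ihx ihy =>
    exact fun h => classicalCircuit_append.2
      ⟨classicalCircuit_append.2 ⟨ihx _, ihy _⟩, h2 _ _ trivial trivial⟩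
  | sub x y ihx ihy =>
    exact fun h => classicalCircuit_append.2
      ⟨classicalCircuit_append.2 ⟨ihx _, ihy _⟩, h1 _ trivial⟩
  | mul x y ihx ihy =>
    exact fun h => classicalCircuit_append.2
      ⟨classicalCircuit_append.2 ⟨ihx _, ihy _⟩, h1 _ trivial⟩
  | div x y ihx ihy =>
    exact fun h => classicalCircuit_append.2
      ⟨classicalCircuit_append.2 ⟨ihx _, ihy _⟩, h1 _ trivial⟩

/-- Each node of the expression has its own clear work cell, so addition modulo `N` just stores its
value. Intermediate values are left behind; they are never needed clear again. -/
theorem Expr.act_circuit {N Q : ℕ} {σ : Store} (e : Expr) : ∀ {h : ℕ} {m : Mem},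
    e.Below N σ → Represents N Q m σ → h + e.nodes ≤ Q → (∀ i, h ≤ i → i < h + e.nodes → m i = 0) →
    actCircuit (e.circuit N Q h) m h = e.eval σ ∧
      AgreeOff h e.nodes m (actCircuit (e.circuit N Q h) m) := by
  have binary : ∀ (x y : Expr),
      (∀ {h : ℕ} {m : Mem}, x.Below N σ → Represents N Q m σ → h + x.nodes ≤ Q →
        (∀ i, h ≤ i → i < h + x.nodes → m i = 0) →
        actCircuit (x.circuit N Q h) m h = x.eval σ ∧
        AgreeOff h x.nodes m (actCircuit (x.circuit N Q h) m)) →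
      (∀ {h : ℕ} {m : Mem}, y.Below N σ → Represents N Q m σ → h + y.nodes ≤ Q →
        (∀ i, h ≤ i → i < h + y.nodes → m i = 0) →
        actCircuit (y.circuit N Q h) m h = y.eval σ ∧
        AgreeOff h y.nodes m (actCircuit (y.circuit N Q h) m)) →
      ∀ {h : ℕ} {m : Mem}, x.Below N σ → y.Below N σ → Represents N Q m σ →
        h + (x.nodes + y.nodes + 1) ≤ Q →
        (∀ i, h ≤ i → i < h + (x.nodes + y.nodes + 1) → m i = 0) →
        ∃ μ, actCircuit (x.circuit N Q (h + 1) ++ y.circuit N Q (h + 1 + x.nodes)) m = μ ∧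
          μ h = 0 ∧ μ (h + 1) = x.eval σ ∧ μ (h + 1 + x.nodes) = y.eval σ ∧
          AgreeOff h (x.nodes + y.nodes + 1) m μ := by
    intro x y hx hy h m bx by' hR hQ hz
    have hxp := x.nodes_pos
    obtain ⟨x1, x2⟩ := hx (h := h + 1) (m := m) bx hR (by omega)
      (fun i h1 h2 => hz i (by omega) (by omega))
    obtain ⟨y1, y2⟩ := hy (h := h + 1 + x.nodes) (m := actCircuit (x.circuit N Q (h + 1)) m) by'
      (fun a i hi => by rw [x2 _ (Or.inr (by omega))]; exact hR a i hi) (by omega)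
      (fun i h1 h2 => by rw [x2 _ (Or.inr (by omega))]; exact hz i (by omega) (by omega))
    refine ⟨_, rfl, ?_, ?_, ?_, ?_⟩
    · rw [actCircuit_append, y2 _ (by omega), x2 _ (by omega)]; exact hz _ (by omega) (by omega)
    · rw [actCircuit_append, y2 _ (by omega), x1]
    · rw [actCircuit_append, y1]
    · intro i hi
      rw [actCircuit_append, y2 _ (by omega), x2 _ (by omega)]
  have last : ∀ {h k : ℕ} {m μ : Mem} (v : ℕ), AgreeOff h k m μ → 0 < k →
      AgreeOff h k m (Function.update μ h v) := by
    intro h k m μ v hμ hk i hi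
    rw [Function.update_of_ne (by omega)]
    exact hμ i hi
  induction e with
  | lit k =>
    intro h m hb hR hQ hz
    have h0 := hz h le_rfl (by simp [Expr.nodes])
    have hk : k < N := hb
    simp only [Expr.circuit, actCircuit_cons, actCircuit_nil, Gate.act, Operand.eval, h0, zero_add,
      show 0 < N by omega, if_true, Function.update_self, Nat.mod_eq_of_lt hk]
    exact ⟨rfl, last _ (fun _ _ => rfl) (by simp [Expr.nodes])⟩
  | read a i ih =>
    intro h m hb hR hQ hz
    simp only [Expr.nodes] at hQ hz ⊢
    obtain ⟨x1, x2⟩ := ih (h := h + 1) (m := m) hb.1 hR (by omega)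
      (fun i h1 h2 => hz i (by omega) (by omega))
    have hlt := hb.1.eval_lt
    have h0 : actCircuit (i.circuit N Q (h + 1)) m h = 0 := by
      rw [x2 _ (by omega)]; exact hz _ (by omega) (by omega)
    have e1 : actCircuit (i.circuit N Q (h + 1)) m (Q + a * N + i.eval σ) = σ a (i.eval σ) := by
      rw [x2 _ (Or.inr (by omega))]; exact hR a _ hlt
    simp only [Expr.circuit, actCircuit_append, actCircuit_cons, actCircuit_nil, Gate.act,
      Operand.eval, h0, zero_add, show 0 < N by omega, if_true, Function.update_self,
      Function.update_of_ne (show h + 1 ≠ h by omega), x1,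
      Function.update_of_ne (show Q + a * N + i.eval σ ≠ h by omega), e1,
      Nat.mod_eq_of_lt hb.2]
    exact ⟨rfl, last _ (fun j hj => x2 j (by omega)) (by omega)⟩
  | add x y ihx ihy =>
    intro h m hb hR hQ hz
    obtain ⟨μ, h1, h2, h3, h4, h5⟩ := binary x y ihx ihy hb.1 hb.2.1 hR hQ hz
    have hxp := x.nodes_pos
    have hlt := hb.2.2
    simp only [Expr.circuit, actCircuit_append (_ ++ _), h1, actCircuit_cons, actCircuit_nil,
      Gate.act, Operand.eval, h2, zero_add, show 0 < N by omega, if_true, Function.update_self,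
      Function.update_of_ne (show h + 1 ≠ h by omega), Function.update_idem,
      Function.update_of_ne (show h + 1 + x.nodes ≠ h by omega), h3, h4,
      Nat.mod_eq_of_lt (show x.eval σ < N by omega), show x.eval σ < N by omega,
      Nat.mod_eq_of_lt hlt]
    exact ⟨rfl, last _ h5 (by simp [Expr.nodes])⟩
  | sub x y ihx ihy =>
    intro h m hb hR hQ hz
    obtain ⟨μ, h1, h2, h3, h4, h5⟩ := binary x y ihx ihy hb.1 hb.2 hR hQ hz
    have hxp := x.nodes_pos
    have hlt := hb.1.eval_lt
    simp only [Expr.circuit, actCircuit_append (_ ++ _), h1, actCircuit_cons, actCircuit_nil,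
      Gate.act, Operand.eval, h2, zero_add, show 0 < N by omega, if_true, Function.update_self,
      Function.update_of_ne (show h + 1 ≠ h by omega),
      Function.update_of_ne (show h + 1 + x.nodes ≠ h by omega), h3, h4,
      Nat.mod_eq_of_lt (show x.eval σ - y.eval σ < N by omega)]
    exact ⟨rfl, last _ h5 (by simp [Expr.nodes])⟩
  | mul x y ihx ihy =>
    intro h m hb hR hQ hz
    obtain ⟨μ, h1, h2, h3, h4, h5⟩ := binary x y ihx ihy hb.1 hb.2.1 hR hQ hz
    have hxp := x.nodes_pos
    have hlt := hb.2.2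
    simp only [Expr.circuit, actCircuit_append (_ ++ _), h1, actCircuit_cons, actCircuit_nil,
      Gate.act, Operand.eval, h2, zero_add, show 0 < N by omega, if_true, Function.update_self,
      Function.update_of_ne (show h + 1 ≠ h by omega),
      Function.update_of_ne (show h + 1 + x.nodes ≠ h by omega), h3, h4, Nat.mod_eq_of_lt hlt]
    exact ⟨rfl, last _ h5 (by simp [Expr.nodes])⟩
  | div x y ihx ihy =>
    intro h m hb hR hQ hz
    obtain ⟨μ, h1, h2, h3, h4, h5⟩ := binary x y ihx ihy hb.1 hb.2 hR hQ hz
    have hxp := x.nodes_pos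
    have hlt := hb.1.eval_lt
    have hd := Nat.div_le_self (x.eval σ) (y.eval σ)
    simp only [Expr.circuit, actCircuit_append (_ ++ _), h1, actCircuit_cons, actCircuit_nil,
      Gate.act, Operand.eval, h2, zero_add, show 0 < N by omega, if_true, Function.update_self,
      Function.update_of_ne (show h + 1 ≠ h by omega),
      Function.update_of_ne (show h + 1 + x.nodes ≠ h by omega), h3, h4,
      Nat.mod_eq_of_lt (show x.eval σ / y.eval σ < N by omega)]
    exact ⟨rfl, last _ h5 (by simp [Expr.nodes])⟩


/-! ## Circuits for random-access machines -/

def Assign.nodes (A : Assign) : ℕ := A.e.nodes + A.i.nodes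

/-- Carry out an assignment; the old word is exchanged with the work cell `h`. -/
def Assign.circuit (N Q : ℕ) (A : Assign) (h : ℕ) : List Gate :=
  (A.e.circuit N Q h ++ A.i.circuit N Q (h + A.e.nodes)) ++
    [.swap h (Q + A.a * N) (h + A.e.nodes)]

/-- The memory represents the store, the cells before `H` are those of `m₀`, and the work cells
from `h` on are clear. -/
structure Simulates (N Q H : ℕ) (m₀ : Mem) (h : ℕ) (m : Mem) (σ : Store) : Prop where
  store : Represents N Q m σ
  low : ∀ i < H, m i = m₀ i
  work : ∀ i, h ≤ i → i < Q → m i = 0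

theorem address_injective {N a b i j : ℕ} (hi : i < N) (hj : j < N) (h : a * N + i = b * N + j) :
    a = b ∧ i = j := by
  have h1 := congrArg (· / N) h
  have h2 := congrArg (· % N) h
  simp only [mul_comm _ N, Nat.mul_add_mod, Nat.mod_eq_of_lt hi, Nat.mod_eq_of_lt hj,
    Nat.mul_add_div (show 0 < N by omega), Nat.div_eq_of_lt hi, Nat.div_eq_of_lt hj,
    Nat.add_zero] at h1 h2
  exact ⟨h1, h2⟩

/-- Overwriting is irreversible, so the new word is exchanged with the old one, which remains in the
work cell `h`. -/
theorem Simulates.assign {N Q H h : ℕ} {m₀ m : Mem} {σ : Store} {A : Assign}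
    (S : Simulates N Q H m₀ h m σ) (hH : H ≤ h) (hQ : h + A.nodes ≤ Q) (he : A.e.Below N σ)
    (hi : A.i.Below N σ) :
    Simulates N Q H m₀ (h + A.nodes) (actCircuit (A.circuit N Q h) m) (A.run σ) := by
  unfold Assign.nodes at hQ ⊢
  have hep := A.e.nodes_pos
  have hip := A.i.nodes_pos
  obtain ⟨x1, x2⟩ := A.e.act_circuit (h := h) he S.store (by omega)
    fun i h1 h2 => S.work i h1 (by omega)
  obtain ⟨y1, y2⟩ := A.i.act_circuit (h := h + A.e.nodes) (m := actCircuit (A.e.circuit N Q h) m) hi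
    (fun a i hi => by rw [x2 (Q + a * N + i) (Or.inr (by omega))]; exact S.store a i hi) (by omega)
    (fun i h1 h2 => by rw [x2 i (Or.inr (by omega))]; exact S.work i (by omega) (by omega))
  have hlt := hi.eval_lt
  set μ := actCircuit (A.i.circuit N Q (h + A.e.nodes)) (actCircuit (A.e.circuit N Q h) m) with hμ
  have hoff : ∀ i, i < h ∨ h + (A.e.nodes + A.i.nodes) ≤ i → μ i = m i := fun i hi => by
    rw [y2 _ (by omega), x2 _ (by omega)]
  have hval : μ h = A.e.eval σ := by rw [y2 _ (by omega), x1]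
  have hact : actCircuit (A.circuit N Q h) m =
      μ ∘ Equiv.swap h (Q + A.a * N + A.i.eval σ) := by
    rw [Assign.circuit, actCircuit_append, actCircuit_append, ← hμ, actCircuit_cons, actCircuit_nil,
      Gate.act, y1, if_pos ⟨by omega, by omega⟩]
  rw [hact]
  refine ⟨fun b j hj => ?_, fun i hi' => ?_, fun i h1 h2 => ?_⟩
  · rw [Assign.run, Store.write_apply, Function.comp_apply]
    by_cases hbj : b = A.a ∧ j = A.i.eval σ
    · rw [if_pos hbj, hbj.1, hbj.2, Equiv.swap_apply_right, hval]
    · have hne : Q + b * N + j ≠ Q + A.a * N + A.i.eval σ := fun hc =>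
        hbj (address_injective hj hlt (by omega))
      rw [if_neg hbj, Equiv.swap_apply_of_ne_of_ne (by omega) hne,
        hoff (Q + b * N + j) (Or.inr (by omega))]
      exact S.store b j hj
  · rw [Function.comp_apply, Equiv.swap_apply_of_ne_of_ne (by omega) (by omega), hoff _ (by omega)]
    exact S.low i hi'
  · rw [Function.comp_apply, Equiv.swap_apply_of_ne_of_ne (by omega) (by omega), hoff _ (by omega)]
    exact S.work i (by omega) h2

theorem Assign.classical_circuit (N Q : ℕ) (A : Assign) (h : ℕ) :
    ClassicalCircuit (A.circuit N Q h) :=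
  classicalCircuit_append.2 ⟨classicalCircuit_append.2
    ⟨A.e.classical_circuit _ _ _, A.i.classical_circuit _ _ _⟩, fun g hg => by
      rw [List.mem_singleton.1 hg]; trivial⟩

def totalNodes (L : List Assign) : ℕ := (L.map Assign.nodes).sum

def assignsCircuit (N Q : ℕ) : List Assign → ℕ → List Gate
  | [], _ => []
  | A :: L, h => A.circuit N Q h ++ assignsCircuit N Q L (h + A.nodes)

theorem classical_assignsCircuit (N Q : ℕ) : ∀ (L : List Assign) (h : ℕ),
    ClassicalCircuit (assignsCircuit N Q L h)
  | [], _ => fun g hg => by simp [assignsCircuit] at hg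
  | A :: L, h => classicalCircuit_append.2
      ⟨A.classical_circuit N Q h, classical_assignsCircuit N Q L _⟩

theorem Simulates.assigns {N Q H : ℕ} {m₀ : Mem} {p : Store → Prop} :
    ∀ {L : List Assign} {h : ℕ} {m : Mem} {σ τ : Store},
      (∀ A ∈ L, ∀ σ, p σ → A.e.Below N σ ∧ A.i.Below N σ) →
      Simulates N Q H m₀ h m σ → H ≤ h → h + totalNodes L ≤ Q → Visits p L σ τ →
      Simulates N Q H m₀ (h + totalNodes L) (actCircuit (assignsCircuit N Q L h) m) τ
  | [], _, _, _, _, _, S, _, _, hV => by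
    obtain ⟨rfl, -⟩ := hV
    exact S
  | A :: L, h, m, σ, τ, hp, S, hH, hQ, hV => by
    simp only [totalNodes, List.map_cons, List.sum_cons] at hQ
    obtain ⟨h1, h2⟩ := hp A (by simp) σ hV.1
    have h3 := (S.assign hH (by omega) h1 h2).assigns (p := p) (L := L) (τ := τ)
      (fun B hB => hp B (by simp [hB])) (by omega) (by simp only [totalNodes]; omega) hV.2
    rw [assignsCircuit, actCircuit_append, totalNodes, List.map_cons, List.sum_cons,
      ← Nat.add_assoc]
    exact h3

/-- A run, continued forever after the program has halted. -/
theorem Steps.exists_visits {B B' : ℕ} (hB : B ≤ B') {code : List Instr}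
    (hcode : ∀ I ∈ code, I.p ≤ B' ∧ I.q ≤ B') {t : ℕ} :
    ∀ {k : ℕ} {σ τ : Store}, k ≤ B' → (∀ a i, σ a i ≤ B') → Steps B code t k σ code.length τ →
      ∃ c : ℕ → Store, c 0 = control k k σ ∧ (∀ j ≥ t, c j = control code.length code.length τ) ∧
        ∀ j, Visits (fun σ => ∀ a i, σ a i ≤ B') (stepAssigns code 0) (c j) (c (j + 1)) := by
  have hcontrol : ∀ {k k' : ℕ} {σ : Store}, k ≤ B' → k' ≤ B' → (∀ a i, σ a i ≤ B') →
      ∀ a i, control k k' σ a i ≤ B' := by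
    intro k k' σ hk hk' hσ a i
    simp only [control, overlay]
    by_cases ha : a < 2
    · rw [if_pos ha]
      split_ifs <;> omega
    · rw [if_neg ha]
      exact hσ _ _
  induction t with
  | zero =>
    rintro k σ τ hk hσ ⟨rfl, rfl⟩
    refine ⟨fun _ => control code.length code.length σ, rfl, fun _ _ => rfl, fun j => ?_⟩
    -- No instruction has the number `code.length`, so every further pass is idle.
    exact visits_stepAssigns_of_not code 0 (hcontrol hk hk hσ) (hcontrol hk hk hσ)
      fun j hj => by omega
  | succ t ih =>
    rintro k σ τ hk hσ ⟨k₁, σ₁, ⟨I, hI, hi, he, rfl, rfl⟩, h2⟩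
    have hk₁ : (if I.c.eval σ ≠ 0 then I.p else I.q) ≤ B' := by
      have := hcode I (List.mem_of_getElem? hI)
      split_ifs
      exacts [this.1, this.2]
    have hσ₁ : ∀ a i, σ.write I.a (I.i.eval σ) (I.e.eval σ) a i ≤ B' := by
      intro a i
      rw [Store.write_apply]
      split_ifs
      exacts [he.trans hB, hσ _ _]
    obtain ⟨c, hc0, hct, hc⟩ := ih hk₁ hσ₁ h2
    refine ⟨fun j => Nat.casesOn j (control k k σ) c, rfl, ?_, ?_⟩
    · rintro (_ | j) hj
      · omega
      · exact hct j (by omega)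
    · rintro (_ | j)
      · show Visits _ _ (control k k σ) (c 0)
        rw [hc0]
        exact visits_stepAssigns code 0 k (Nat.zero_add k).symm hI (hcontrol hk hk hσ)
          (hcontrol hk hk₁ hσ) (hcontrol hk hk₁ hσ₁) (hcontrol hk₁ hk₁ hσ₁)
      · exact hc j

/-- The circuit that carries out `t` steps of the program `code` on the input in the first
`2 n ^ 2` cells, and copies two words of the output behind the input. -/
def machineCircuit (L : List Assign) (n N Q t : ℕ) : List Gate :=
  (.add (Q + 2 * N) N (.const n) ::
    (List.range (2 * n ^ 2)).flatMap fun k => [.add (Q + 3 * N + k) N (.copy k)]) ++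
  ((List.range t).flatMap fun j => assignsCircuit N Q L (2 * n ^ 2 + 2 + j * totalNodes L)) ++
  [.add (2 * n ^ 2) N (.copy (Q + 4 * N)), .add (2 * n ^ 2 + 1) N (.copy (Q + 4 * N + 1))]

theorem classical_machineCircuit (L : List Assign) (n N Q t : ℕ) :
    ClassicalCircuit (machineCircuit L n N Q t) := by
  rw [machineCircuit, classicalCircuit_append, classicalCircuit_append]
  refine ⟨⟨fun g hg => ?_, classicalCircuit_flatMap fun j _ => classical_assignsCircuit N Q L _⟩,
    fun g hg => ?_⟩
  · rcases List.mem_cons.1 hg with rfl | hg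
    · trivial
    · obtain ⟨k, -, hk⟩ := List.mem_flatMap.1 hg
      rw [List.mem_singleton.1 hk]; trivial
  · simp only [List.mem_cons, List.not_mem_nil, or_false] at hg
    rcases hg with rfl | rfl <;> trivial

/-- The two control arrays come first, so the arrays `0`, `1` and `2` of the program start at `Q + 2
* N`, `Q + 3 * N` and `Q + 4 * N`. Clear memory already represents instruction counter zero. -/
theorem simulates_start {n N Q H : ℕ} {w : ℕ → ℕ} (hw : ∀ i ≥ 2 * n ^ 2, w i = 0)
    (hwN : ∀ i, w i < N) (hn : n < N) (hnN : 2 * n ^ 2 ≤ N) (hH : 2 * n ^ 2 ≤ H) (hHQ : H ≤ Q) :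
    Simulates N Q H w H (actCircuit (.add (Q + 2 * N) N (.const n) ::
      (List.range (2 * n ^ 2)).flatMap fun k => [.add (Q + 3 * N + k) N (.copy k)]) w)
      (control 0 0 (initStore n w)) := by
  set u := Function.update w (Q + 2 * N) n with hu
  have h1 : actCircuit (.add (Q + 2 * N) N (.const n) ::
      (List.range (2 * n ^ 2)).flatMap fun k => [.add (Q + 3 * N + k) N (.copy k)]) w =
      patch u (Q + 3 * N) (2 * n ^ 2) w := by
    have h0 : Gate.act w (.add (Q + 2 * N) N (.const n)) = patch u (Q + 3 * N) 0 w := by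
      rw [patch_zero, Gate.act, hw _ (by omega), if_pos (by omega)]
      simp only [Operand.eval, zero_add, Nat.mod_eq_of_lt hn, hu]
    rw [actCircuit_cons, h0]
    refine actCircuit_flatMap (μ := fun k => patch u (Q + 3 * N) k w) fun k hk => ?_
    have e1 : patch u (Q + 3 * N) k w (Q + 3 * N + k) = 0 := by
      rw [patch_of_not (by omega), hu, Function.update_of_ne (by omega), hw _ (by omega)]
    have e2 : patch u (Q + 3 * N) k w k = w k := by
      rw [patch_of_not (by omega), hu, Function.update_of_ne (by omega)]
    simp only [actCircuit_cons, actCircuit_nil, Gate.act, e1, Operand.eval, zero_add]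
    rw [if_pos (by omega), Function.update_of_ne (by omega), e2, Nat.mod_eq_of_lt (hwN k),
      patch_succ]
  rw [h1]
  refine ⟨fun a i hi => ?_, fun i hi => ?_, fun i h1 h2 => ?_⟩
  · by_cases ha : a = 3
    · subst ha
      show _ = w i
      by_cases hi' : i < 2 * n ^ 2
      · rw [Nat.add_comm (Q + 3 * N) i, patch_add hi']
      · rw [patch_of_not (by omega), hu, Function.update_of_ne (by omega), hw _ (by omega),
          hw _ (by omega)]
    · have h3 : ¬ (Q + 3 * N ≤ Q + a * N + i ∧ Q + a * N + i < Q + 3 * N + 2 * n ^ 2) := by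
        intro hc
        rcases Nat.lt_or_gt_of_ne ha with h | h
        · have : (a + 1) * N ≤ 3 * N := Nat.mul_le_mul_right N h
          rw [Nat.add_mul] at this; omega
        · have : 4 * N ≤ a * N := Nat.mul_le_mul_right N h
          omega
      rw [patch_of_not h3, hu, Function.update_apply, hw (Q + a * N + i) (by omega)]
      by_cases h2 : a = 2 ∧ i = 0
      · rw [h2.1, h2.2, if_pos (by omega)]; rfl
      · rw [if_neg fun hc => h2 (address_injective hi (by omega : 0 < N) (by omega))]
        simp only [control, overlay]
        split_ifs
        · simp
        · simp
        · simp only [initStore]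
          rw [if_neg (by omega), if_neg (by omega)]
  · rw [patch_of_not (by omega), hu, Function.update_of_ne (by omega)]
  · rw [patch_of_not (by omega), hu, Function.update_of_ne (by omega), hw _ (by omega)]

/-- Every pass has `totalNodes L` fresh work cells of its own, and the store begins behind the cells
of all `t` passes. The two output cells right behind the input are kept clear throughout. -/
theorem act_machineCircuit {L : List Assign} {n N t : ℕ} {w : ℕ → ℕ} {p : Store → Prop}
    {c : ℕ → Store} {υ : Store} {l : ℕ} (hw : ∀ i ≥ 2 * n ^ 2, w i = 0)
    (hwN : ∀ i, w i < N) (hn : n < N) (hnN : 2 * n ^ 2 ≤ N) (hN : 1 < N)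
    (hp : ∀ A ∈ L, ∀ σ, p σ → A.e.Below N σ ∧ A.i.Below N σ)
    (hc0 : c 0 = control 0 0 (initStore n w)) (hc : ∀ j, Visits p L (c j) (c (j + 1)))
    (hct : c t = control l l υ) (hυ : ∀ i, υ 2 i < N) {i : ℕ} (hi : i < 2) :
    actCircuit (machineCircuit L n N (2 * n ^ 2 + 2 + t * totalNodes L) t) w (2 * n ^ 2 + i) = υ 2 i := by
  set Q := 2 * n ^ 2 + 2 + t * totalNodes L with hQ
  have h0 := simulates_start (Q := Q) (H := 2 * n ^ 2 + 2) hw hwN hn hnN (by omega) (by omega)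
  rw [machineCircuit, actCircuit_append, actCircuit_append]
  set m := actCircuit (.add (Q + 2 * N) N (.const n) ::
      (List.range (2 * n ^ 2)).flatMap fun k => [.add (Q + 3 * N + k) N (.copy k)]) w
  have key : ∀ j ≤ t, Simulates N Q (2 * n ^ 2 + 2) w (2 * n ^ 2 + 2 + j * totalNodes L)
      (actCircuit ((List.range j).flatMap fun j => assignsCircuit N Q L
        (2 * n ^ 2 + 2 + j * totalNodes L)) m) (c j) := by
    intro j
    induction j with
    | zero => intro _; rw [hc0, Nat.zero_mul]; exact h0
    | succ j ih =>
      intro hj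
      have hle : (j + 1) * totalNodes L ≤ t * totalNodes L := Nat.mul_le_mul_right _ hj
      rw [Nat.add_mul, Nat.one_mul] at hle
      have := (ih (by omega)).assigns hp (by omega) (by omega) (hc j)
      rw [List.range_succ, List.flatMap_append, actCircuit_append, List.flatMap_singleton,
        Nat.add_mul, Nat.one_mul, ← Nat.add_assoc]
      exact this
  have hS := key t le_rfl
  set μ := actCircuit ((List.range t).flatMap fun j => assignsCircuit N Q L
        (2 * n ^ 2 + 2 + j * totalNodes L)) m
  have hread : ∀ i < 2, μ (Q + 4 * N + i) = υ 2 i := by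
    intro i hi
    rw [hS.store 4 i (by omega), hct]; rfl
  have z0 : μ (2 * n ^ 2) = 0 := by rw [hS.low _ (by omega)]; exact hw _ (by omega)
  have z1 : μ (2 * n ^ 2 + 1) = 0 := by rw [hS.low _ (by omega)]; exact hw _ (by omega)
  have r0 : μ (Q + 4 * N) = υ 2 0 := hread 0 (by omega)
  have r1 : μ (Q + 4 * N + 1) = υ 2 1 := hread 1 (by omega)
  simp only [actCircuit_cons, actCircuit_nil, Gate.act, Operand.eval, z0,
    Function.update_of_ne (show 2 * n ^ 2 + 1 ≠ 2 * n ^ 2 by omega), z1, zero_add,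
    Function.update_of_ne (show Q + 4 * N ≠ 2 * n ^ 2 by omega), r0, show 0 < N by omega, if_true,
    Function.update_of_ne (show Q + 4 * N + 1 ≠ 2 * n ^ 2 + 1 by omega),
    Function.update_of_ne (show Q + 4 * N + 1 ≠ 2 * n ^ 2 by omega), r1,
    Nat.mod_eq_of_lt (hυ _)]
  interval_cases i
  · simp
  · simp


/-! ## Writing the circuit for a random-access machine -/

/-- The variables `1`, `2` and `4` hold the modulus, the address of the store, and the address of
the work cells. -/
def Expr.writer : Expr → ℕ → Writer
  | .lit k, o => .emit 0 (.var 4 + .lit o) (.var 1) (.lit k) 0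
  | .read a i, o => .seq (i.writer (o + 1))
      (.emit 5 (.var 4 + .lit o) (.var 1) (.var 2 + .lit a * .var 1) (.var 4 + .lit (o + 1)))
  | .add x y, o => .seq (.seq (x.writer (o + 1)) (y.writer (o + 1 + x.nodes)))
      (.seq (.emit 1 (.var 4 + .lit o) (.var 1) (.var 4 + .lit (o + 1)) 0)
        (.emit 1 (.var 4 + .lit o) (.var 1) (.var 4 + .lit (o + 1 + x.nodes)) 0))
  | .sub x y, o => .seq (.seq (x.writer (o + 1)) (y.writer (o + 1 + x.nodes)))
      (.emit 2 (.var 4 + .lit o) (.var 1) (.var 4 + .lit (o + 1)) (.var 4 + .lit (o + 1 + x.nodes)))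
  | .mul x y, o => .seq (.seq (x.writer (o + 1)) (y.writer (o + 1 + x.nodes)))
      (.emit 3 (.var 4 + .lit o) (.var 1) (.var 4 + .lit (o + 1)) (.var 4 + .lit (o + 1 + x.nodes)))
  | .div x y, o => .seq (.seq (x.writer (o + 1)) (y.writer (o + 1 + x.nodes)))
      (.emit 4 (.var 4 + .lit o) (.var 1) (.var 4 + .lit (o + 1)) (.var 4 + .lit (o + 1 + x.nodes)))

def Assign.writer (A : Assign) (o : ℕ) : Writer :=
  .seq (.seq (A.e.writer o) (A.i.writer (o + A.e.nodes)))
    (.emit 12 (.var 4 + .lit o) 0 (.var 2 + .lit A.a * .var 1) (.var 4 + .lit (o + A.e.nodes)))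

def assignsWriter : List Assign → ℕ → Writer
  | [], _ => .nop
  | A :: L, o => .seq (A.writer o) (assignsWriter L (o + A.nodes))

/-- The number of passes is read. -/
def machineWriter (L : List Assign) (κ : ℕ) : Writer :=
  .bind (WExpr.pow (.var 0 + 2) κ)
    (.bind (2 * (.var 0 * .var 0) + 2 + .hi 0 0 * .lit (totalNodes L))
      (.seq (.seq (.seq (.emit 0 (.var 2 + 2 * .var 1) (.var 1) (.var 0) 0)
        (.loop (2 * (.var 0 * .var 0)) (.emit 1 (.var 2 + 3 * .var 1 + .var 3) (.var 1) (.var 3) 0)))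
        (.loop (.hi 0 0) (.bind (2 * (.var 0 * .var 0) + 2 + .var 3 * .lit (totalNodes L))
          (assignsWriter L 0))))
        (.seq (.emit 1 (2 * (.var 0 * .var 0)) (.var 1) (.var 2 + 4 * .var 1) 0)
          (.emit 1 (2 * (.var 0 * .var 0) + 1) (.var 1) (.var 2 + 4 * .var 1 + 1) 0))))

variable {h : Store} {d : ℕ} {v : ℕ → ℕ}

theorem Expr.gates_writer (e : Expr) :
    ∀ o, (e.writer o).gates h d v = e.circuit (v 1) (v 2) (v 4 + o) := by
  induction e with
  | lit k => intro o; simp [Expr.writer, Expr.circuit, Gate.decode]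
  | read a i ih => intro o; simp [Expr.writer, Expr.circuit, Gate.decode, ih, Nat.add_assoc]
  | add x y ihx ihy =>
    intro o; simp [Expr.writer, Expr.circuit, Gate.decode, ihx, ihy, Nat.add_assoc]
  | sub x y ihx ihy =>
    intro o; simp [Expr.writer, Expr.circuit, Gate.decode, ihx, ihy, Nat.add_assoc]
  | mul x y ihx ihy =>
    intro o; simp [Expr.writer, Expr.circuit, Gate.decode, ihx, ihy, Nat.add_assoc]
  | div x y ihx ihy =>
    intro o; simp [Expr.writer, Expr.circuit, Gate.decode, ihx, ihy, Nat.add_assoc]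

theorem Assign.gates_writer (A : Assign) (o : ℕ) :
    (A.writer o).gates h d v = A.circuit (v 1) (v 2) (v 4 + o) := by
  simp [Assign.writer, Assign.circuit, Gate.decode, Expr.gates_writer, Nat.add_assoc]

theorem gates_assignsWriter : ∀ (L : List Assign) (o : ℕ),
    (assignsWriter L o).gates h d v = assignsCircuit (v 1) (v 2) L (v 4 + o)
  | [], _ => rfl
  | A :: L, o => by
    rw [assignsWriter, assignsCircuit, Writer.gates_seq, Assign.gates_writer,
      gates_assignsWriter L, Nat.add_assoc]

theorem gates_machineWriter (L : List Assign) (κ n : ℕ) :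
    (machineWriter L κ).gates h 1 (startVar n) =
      machineCircuit L n ((n + 2) ^ κ) (2 * n ^ 2 + 2 + h 0 0 * totalNodes L) (h 0 0) := by
  simp [machineWriter, machineCircuit, gates_assignsWriter, startVar, Gate.decode, pow_two]

theorem Expr.cost_writer (e : Expr) : ∀ o, (e.writer o).cost h d v ≤ 12 * e.nodes := by
  induction e with
  | lit k => intro o; simp [Expr.writer, Expr.nodes, Writer.cost]
  | read a i ih => intro o; have := ih (o + 1); simp only [Expr.writer, Expr.nodes, Writer.cost]; omega
  | add x y ihx ihy =>
    intro o; have := ihx (o + 1); have := ihy (o + 1 + x.nodes)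
    simp only [Expr.writer, Expr.nodes, Writer.cost]; omega
  | sub x y ihx ihy =>
    intro o; have := ihx (o + 1); have := ihy (o + 1 + x.nodes)
    simp only [Expr.writer, Expr.nodes, Writer.cost]; omega
  | mul x y ihx ihy =>
    intro o; have := ihx (o + 1); have := ihy (o + 1 + x.nodes)
    simp only [Expr.writer, Expr.nodes, Writer.cost]; omega
  | div x y ihx ihy =>
    intro o; have := ihx (o + 1); have := ihy (o + 1 + x.nodes)
    simp only [Expr.writer, Expr.nodes, Writer.cost]; omega

theorem cost_assignsWriter : ∀ (L : List Assign) (o : ℕ),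
    (assignsWriter L o).cost h d v ≤ 18 * totalNodes L + 1
  | [], _ => by simp [assignsWriter, Writer.cost]
  | A :: L, o => by
    have h1 := cost_assignsWriter L (o + A.nodes)
    have h2 := A.e.cost_writer (h := h) (d := d) (v := v) o
    have h3 := A.i.cost_writer (h := h) (d := d) (v := v) (o + A.e.nodes)
    have h4 := A.e.nodes_pos
    simp only [assignsWriter, Assign.writer, Assign.nodes, Writer.cost, totalNodes, List.map_cons,
      List.sum_cons] at h1 ⊢
    omega

theorem cost_machineWriter (L : List Assign) (κ n : ℕ) :
    (machineWriter L κ).cost h 1 (startVar n) ≤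
      (18 * totalNodes L + 24) * (h 0 0 + n ^ 2 + 1) := by
  have h1 := fun v : ℕ → ℕ => Params.cost_loop_le (h := h) (d := 3) (v := v)
    (e := 2 * (.var 0 * .var 0)) (p := .emit 1 (.var 2 + 3 * .var 1 + .var 3) (.var 1) (.var 3) 0)
    (C := 6) fun i _ => by simp [Writer.cost]
  have h2 := fun v : ℕ → ℕ => Params.cost_loop_le (h := h) (d := 3) (v := v)
    (e := .hi 0 0) (p := .bind (2 * (.var 0 * .var 0) + 2 + .var 3 * .lit (totalNodes L))
          (assignsWriter L 0)) (C := 18 * totalNodes L + 2) fun i _ => by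
      have := cost_assignsWriter (h := h) (d := 5) (v := Function.update (Function.update v 3 i) 4
        (2 * (v 0 * v 0) + 2 + i * totalNodes L)) L 0
      simp [Writer.cost]
      omega
  simp only [machineWriter, Writer.cost.eq_5, Writer.cost.eq_3, Writer.cost.eq_2]
  refine (Nat.add_le_add_left (Nat.add_le_add_left (Nat.add_le_add_right (Nat.add_le_add
    (Nat.add_le_add_left (h1 _) _) (h2 _)) _) _) _).trans ?_
  simp [startVar]
  nlinarith [Nat.zero_le (totalNodes L * n ^ 2), Nat.zero_le (totalNodes L)]

theorem exists_forall_below (L : List Assign) (k : ℕ) : ∃ κ, ∀ n, ∀ A ∈ L, ∀ σ : Store,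
    (∀ a i, σ a i ≤ (n + 2) ^ k) → A.e.Below ((n + 2) ^ κ) σ ∧ A.i.Below ((n + 2) ^ κ) σ := by
  induction L with
  | nil => exact ⟨0, fun n A hA => by simp at hA⟩
  | cons A L ih =>
    obtain ⟨κ, hκ⟩ := ih
    obtain ⟨κ₁, h1⟩ := A.e.exists_below k
    obtain ⟨κ₂, h2⟩ := A.i.exists_below k
    refine ⟨κ + κ₁ + κ₂, fun n A' hA' σ hσ => ?_⟩
    rcases List.mem_cons.1 hA' with rfl | hA'
    · exact ⟨(h1 n σ hσ).mono (pow_mono n (by omega)), (h2 n σ hσ).mono (pow_mono n (by omega))⟩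
    · exact ⟨(hκ n A' hA' σ hσ).1.mono (pow_mono n (by omega)),
        (hκ n A' hA' σ hσ).2.mono (pow_mono n (by omega))⟩

theorem isBigO_add_sq (C : ℕ) {t : ℕ → ℕ} {T : ℕ → ℝ} (hT : ∀ n, 0 ≤ T n)
    (ht : (fun n => (t n : ℝ)) =O[atTop] T) :
    (fun n => ((C * (t n + n ^ 2 + 1) : ℕ) : ℝ)) =O[atTop] fun n => T n + (n : ℝ) ^ 2 := by
  have h1 : (fun n => (t n : ℝ) + (n : ℝ) ^ 2 + 1) =O[atTop] fun n => T n + (n : ℝ) ^ 2 := by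
    refine ((ht.trans (IsBigO.of_norm_le fun n => ?_)).add (IsBigO.of_norm_le fun n => ?_)).add ?_
    · rw [Real.norm_of_nonneg (hT n)]
      have : 0 ≤ (n : ℝ) ^ 2 := by positivity
      linarith
    · rw [Real.norm_of_nonneg (by positivity)]
      linarith [hT n]
    · refine IsBigO.of_bound 1 ?_
      filter_upwards [eventually_ge_atTop 1] with n hn
      have h1 : (1 : ℝ) ≤ (n : ℝ) ^ 2 := one_le_pow₀ (by exact_mod_cast hn)
      have h2 := hT n
      rw [norm_one, Real.norm_of_nonneg (by linarith)]
      linarith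
  simpa using h1.const_mul_left (C : ℝ)

/-- Time `t` machine steps are `O(t + n ^ 2)` quantum gates. -/
theorem quantumTime_of_classicalTime {c : ℕ} {T : ℕ → ℝ} (hT : ∀ n, 0 ≤ T n)
    (hc : ClassicalTime (traceCube c) T) :
    QuantumTime 1 (traceCube c) fun n => T n + (n : ℝ) ^ 2 := by
  obtain ⟨A, clock, κ, t, ht, hclock, hA⟩ := hc
  set code := A.code 0 A.length with hcode
  set L := stepAssigns code 0 with hL
  -- A constant that bounds all jump targets, hence both control words.
  set W := (code.map fun I => I.p + I.q).sum with hW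
  set k := κ + c + W + 1 with hk
  obtain ⟨κ', hκ'⟩ := exists_forall_below L k
  choose u hu S hS hS0 using hclock
  -- The clock runs while the circuit is written; its result `t n` is the number of unrolled passes.
  -- This is the only use of time-constructibility.
  refine quantumTime_of_writer clock κ (.var 0) (fun n => n) (fun n => rfl) (fun n => by omega)
    (machineWriter L (κ' + k + 3)) u (fun n => (36 * totalNodes L + 52) * (t n + n ^ 2 + 1)) S
    (fun n => ⟨u n, le_rfl, hS n⟩) (fun n => ?_) ?_ (fun n x => ?_)
  · have h1 := cost_machineWriter (h := S n) L (κ' + k + 3) n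
    have h2 := hu n
    rw [hS0] at h1
    nlinarith [Nat.zero_le (n ^ 2)]
  · exact isBigO_add_sq (36 * totalNodes L + 52) hT ht
  · set w := (traceCube c).inputWords n x with hw
    obtain ⟨s, hs, τ, hE, hout⟩ := hA n x
    have hk1 : n ≤ (n + 2) ^ k := by
      have := pow_mono n (show 1 ≤ k by omega)
      rw [pow_one] at this; omega
    have hx : ∀ i, w i ≤ (n + 2) ^ k := by
      intro i
      by_cases hi : i < 2 * n ^ 2
      · rw [hw, traceCube_inputWords_of_lt x hi]
        refine (matWord_le (V := n ^ c) (fun i j => by exact_mod_cast x.2.2 i j) i).trans ?_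
        exact (Nat.pow_le_pow_left (by omega) c).trans (pow_mono n (by omega))
      · rw [hw, traceCube_inputWords_of_le x (by omega)]; exact Nat.zero_le _
    have hinit : ∀ a i, initStore n w a i ≤ (n + 2) ^ k := by
      intro a i
      simp only [initStore]
      split_ifs
      exacts [hk1, hx i, Nat.zero_le _]
    have hlt : (n + 2) ^ k < (n + 2) ^ (κ' + k + 3) :=
      Nat.pow_lt_pow_right (by omega) (by omega)
    have hτ := Exec.le_bound (pow_mono n (show κ ≤ k by omega)) hE hinit
    have hsteps := (hE.mono (pow_mono n (show κ ≤ k by omega))).steps hinit (code := code)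
      (f := 0) (q := A.length) fun j _ => by rw [Nat.zero_add]
    rw [show A.length = code.length by rw [hcode, Com.length_code]] at hsteps
    obtain ⟨C, hC0, hCt, hC⟩ := hsteps.exists_visits le_rfl (fun I hI => by
      have h1 : I.p + I.q ≤ W := List.single_le_sum (by simp) _ (List.mem_map.2 ⟨I, hI, rfl⟩)
      have h2 := (le_pow_self n W).trans (pow_mono n (show W ≤ k by omega))
      omega) (Nat.zero_le _) hinit
    have hg := gates_machineWriter (h := S n) L (κ' + k + 3) n
    rw [Writer.gates, hS0] at hg
    rw [hg, circ_single (classical_machineCircuit _ _ _ _ _), prob_single]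
    intro i hi
    show actCircuit _ w (2 * n ^ 2 + i) = _
    rw [← hout i hi]
    refine act_machineCircuit (c := C) (l := code.length)
      (p := fun σ => ∀ a i, σ a i ≤ (n + 2) ^ k)
      (fun i hi => traceCube_inputWords_of_le x hi)
      (fun i => (hx i).trans_lt hlt) (hk1.trans_lt hlt) ?_ ?_ ?_ hC0 hC (hCt _ hs)
      (fun i => (hτ 2 i).trans_lt hlt) hi
    · refine le_trans ?_ (pow_mono n (show 3 ≤ κ' + k + 3 by omega))
      nlinarith [Nat.zero_le (n ^ 3), Nat.zero_le n]
    · exact Nat.one_lt_pow (by omega) (by omega)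
    · intro A hA σ hσ
      exact ⟨(hκ' n A hA σ hσ).1.mono (pow_mono n (by omega)),
        (hκ' n A hA σ hσ).2.mono (pow_mono n (by omega))⟩


/-! ## Amplification -/

/-- Add to cell `d` the content of `a` if it equals that of `b`, and the content of `c` otherwise;
the cells `s` and `t` are work cells. -/
def majority (N d s t a b c : ℕ) : List Gate :=
  [.add s N (.monus a b), .add s N (.monus b a), .add t N (.div s s), .add d N (.copy a),
    .sub d N (.mul a t), .add d N (.mul c t)]

theorem classical_majority (N d s t a b c : ℕ) : ClassicalCircuit (majority N d s t a b c) := by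
  intro g hg
  simp only [majority, List.mem_cons, List.not_mem_nil, or_false] at hg
  rcases hg with rfl | rfl | rfl | rfl | rfl | rfl <;> trivial

/-- Cell `s` receives the absolute difference of `a` and `b`, and `t` the quotient of `s` by itself.
As division by zero gives zero, `t` is `0` in case of equality and `1` otherwise, and `d` becomes a
- a * t + c * t. -/
theorem act_majority {N d s t a b c : ℕ} {m : Mem} (hN : 1 < N) (hd : m d = 0) (hs : m s = 0)
    (ht : m t = 0) (ha : m a < N) (hb : m b < N) (hc : m c < N) (hds : d ≠ s) (hdt : d ≠ t)
    (hst : s ≠ t) (hda : a ≠ d ∧ a ≠ s ∧ a ≠ t) (hdb : b ≠ d ∧ b ≠ s ∧ b ≠ t)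
    (hdc : c ≠ d ∧ c ≠ s ∧ c ≠ t) :
    ∃ x y, actCircuit (majority N d s t a b c) m =
      Function.update (Function.update (Function.update m s x) t y) d
        (if m a = m b then m a else m c) := by
  set x := m a - m b + (m b - m a) with hx
  have hxN : x < N := by omega
  set y := if m a = m b then 0 else 1 with hy
  have hxy : x / x = y := by
    rw [hy]
    split_ifs with h
    · rw [show x = 0 by omega]
    · exact Nat.div_self (by omega)
  have hyN : y < N := by rw [hy]; split_ifs <;> omega
  refine ⟨x, y, ?_⟩
  have g1 : Gate.act (Gate.act m (.add s N (.monus a b))) (.add s N (.monus b a)) =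
      Function.update m s x := by
    simp [Gate.act, Operand.eval, hs, hda, hdb, Nat.mod_eq_of_lt (show m a - m b < N by omega),
      show 0 < N by omega, show m a - m b < N by omega, ← hx, Nat.mod_eq_of_lt hxN]
  have g2 : Gate.act (Function.update m s x) (.add t N (.div s s)) =
      Function.update (Function.update m s x) t y := by
    simp [Gate.act, Operand.eval, ht, hst, hst.symm, hxy, show 0 < N by omega,
      Nat.mod_eq_of_lt hyN]
  set μ := Function.update (Function.update m s x) t y with hμ
  have μd : μ d = 0 := by simp [hμ, hds, hdt, hd]
  have μa : μ a = m a := by simp [hμ, hda]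
  have μc : μ c = m c := by simp [hμ, hdc]
  have μt : μ t = y := by simp [hμ]
  have g3 : Gate.act μ (.add d N (.copy a)) = Function.update μ d (m a) := by
    simp [Gate.act, Operand.eval, μd, μa, hda, show 0 < N by omega, Nat.mod_eq_of_lt ha]
  have g4 : Gate.act (Function.update μ d (m a)) (.sub d N (.mul a t)) =
      Function.update μ d (if m a = m b then m a else 0) := by
    simp only [Gate.act, Operand.eval, Function.update_self, Function.update_idem, if_pos ha,
      Function.update_of_ne hda.1, Function.update_of_ne hdt.symm, μa, μt, hy]
    congr 1
    split_ifs
    · rw [Nat.mul_zero, Nat.zero_mod, Nat.sub_zero, Nat.add_mod_right, Nat.mod_eq_of_lt ha]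
    · rw [Nat.mul_one, Nat.mod_eq_of_lt ha, Nat.add_sub_cancel' ha.le, Nat.mod_self]
  have g5 : Gate.act (Function.update μ d (if m a = m b then m a else 0)) (.add d N (.mul c t)) =
      Function.update μ d (if m a = m b then m a else m c) := by
    simp only [Gate.act, Operand.eval, Function.update_self, Function.update_idem,
      Function.update_of_ne hdc.1, Function.update_of_ne hdt.symm, μc, μt, hy]
    rw [if_pos (show (if m a = m b then m a else 0) < N by split_ifs <;> omega)]
    congr 1
    split_ifs
    · rw [Nat.mul_zero, Nat.add_zero, Nat.mod_eq_of_lt ha]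
    · rw [Nat.mul_one, Nat.zero_add, Nat.mod_eq_of_lt hc]
  simp only [majority, actCircuit_cons, actCircuit_nil, g1, g2, g3, g4, g5]

/-- Run the circuit `C` on a copy of the first `l` cells that starts at the cell `o`. -/
def copyCircuit (l N : ℕ) (C : List Gate) (o : ℕ) : List Gate :=
  ((List.range l).flatMap fun k => [.add (o + k) N (.copy k)]) ++ C.map (Gate.shift o)

theorem circ_copyCircuit {V L W l N o : ℕ} {b w : Mem} (hWV : W ≤ V) (hV : V % 2 = 1)
    (hL : W + V < L) {C : List Gate} (hC : ∀ g ∈ C, g.Bounded W) (hw : Small V l w) (hl : l ≤ L)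
    (hN : V < N) (ho : l ≤ o) (hb : ∀ i < l, b i = w i) (hb0 : ∀ i, o ≤ i → i < o + L → b i = 0)
    (z : ℂ) :
    circ (copyCircuit l N C o) (Finsupp.single b z) =
      ∑ m ∈ (circ C (Finsupp.single w 1)).support,
        Finsupp.single (patch b o L m) (z * circ C (Finsupp.single w 1) m) := by
  have hwL : Small V L w := ⟨hw.1, fun i hi => hw.2 i (by omega)⟩
  have hcl : ClassicalCircuit ((List.range l).flatMap fun k => [.add (o + k) N (.copy k)]) :=
    classicalCircuit_flatMap fun k _ g hg => by rw [List.mem_singleton.1 hg]; trivial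
  have h1 : actCircuit ((List.range l).flatMap fun k => [.add (o + k) N (.copy k)]) b =
      patch b o l w := by
    conv_lhs => rw [← patch_zero b o w]
    refine actCircuit_flatMap (μ := fun k => patch b o k w) fun k hk => ?_
    have e1 : patch b o k w (o + k) = 0 := by
      rw [patch_of_not (by omega), hb0 _ (by omega) (by omega)]
    have e2 : patch b o k w k = w k := by
      rw [patch_of_not (by omega), hb k hk]
    simp only [actCircuit_cons, actCircuit_nil, Gate.act, e1, Operand.eval, zero_add]
    rw [if_pos (by omega), Function.update_of_ne (by omega), e2,
      Nat.mod_eq_of_lt ((hw.1 k).trans_lt hN), patch_succ]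
  have h2 : patch b o l w = patch b o L w := by
    funext i
    by_cases hi : o ≤ i ∧ i < o + L
    · obtain ⟨j, rfl⟩ : ∃ j, i = j + o := ⟨i - o, by omega⟩
      rw [patch_add (L := L) (by omega)]
      by_cases hj : j < l
      · rw [patch_add hj]
      · rw [patch_of_not (by omega), hb0 _ (by omega) (by omega), hw.2 j (by omega)]
    · rw [patch_of_not hi, patch_of_not (by omega)]
  have h3 := (circ_shift_single (o := o) (b := b) hWV hV hL hC hwL).1
  rw [copyCircuit, circ_append, circ_single hcl, h1, h2,
    show Finsupp.single (patch b o L w) z = z • Finsupp.single (patch b o L w) (1 : ℂ) by simp,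
    map_smul, h3, Finset.smul_sum]
  exact Finset.sum_congr rfl fun m _ => by simp

theorem sum_mul_add_mul {ι : Type*} {s : Finset ι} {q x : ι → ℝ} {p : ℝ} (h1 : ∑ i ∈ s, q i = 1)
    (h2 : ∑ i ∈ s, q i * x i = p) (a b : ℝ) : ∑ i ∈ s, q i * (a + b * x i) = a + b * p := by
  rw [← h2, Finset.mul_sum]
  calc _ = (∑ i ∈ s, q i) * a + ∑ i ∈ s, b * (q i * x i) := by
        rw [Finset.sum_mul, ← Finset.sum_add_distrib]
        exact Finset.sum_congr rfl fun i _ => by ring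
    _ = _ := by rw [h1, one_mul]

/-- The probability that at least two of three independent experiments succeed. -/
theorem sum_two_of_three {ι : Type*} {s : Finset ι} {q x : ι → ℝ} {p : ℝ}
    (h1 : ∑ i ∈ s, q i = 1) (h2 : ∑ i ∈ s, q i * x i = p) :
    ∑ i ∈ s, ∑ j ∈ s, ∑ k ∈ s,
      q i * q j * q k * (x i * x j + x i * x k + x j * x k - 2 * x i * x j * x k) =
      3 * p ^ 2 - 2 * p ^ 3 := by
  have e1 : ∀ i j, ∑ k ∈ s,
      q i * q j * q k * (x i * x j + x i * x k + x j * x k - 2 * x i * x j * x k) =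
      q i * (q j * (x i * p + (x i + p - 2 * x i * p) * x j)) := fun i j => by
    have := sum_mul_add_mul h1 h2 (x i * x j) (x i + x j - 2 * x i * x j)
    calc _ = q i * q j * ∑ k ∈ s, q k * (x i * x j + (x i + x j - 2 * x i * x j) * x k) := by
          rw [Finset.mul_sum]; exact Finset.sum_congr rfl fun k _ => by ring
      _ = _ := by rw [this]; ring
  have e2 : ∀ i, ∑ j ∈ s, q i * (q j * (x i * p + (x i + p - 2 * x i * p) * x j)) =
      q i * (p ^ 2 + (2 * p - 2 * p ^ 2) * x i) := fun i => by
    rw [← Finset.mul_sum, sum_mul_add_mul h1 h2]; ring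
  simp only [e1, e2]
  rw [sum_mul_add_mul h1 h2]; ring

/-- Run three copies of the circuit `C` for problems with `l` input words and two output words, and
take the majority of the results. -/
def amplified (l L : ℕ) (C : List Gate) : List Gate :=
  ((List.range 3).flatMap fun j => copyCircuit l L C (l + 6 + j * L)) ++
    (List.range 2).flatMap fun i => majority L (l + i) (l + 2 + 2 * i) (l + 3 + 2 * i)
      (l + 6 + l + i) (l + 6 + L + l + i) (l + 6 + 2 * L + l + i)

-- The copies work in disjoint windows, so amplitudes multiply and the three results are
-- independent. If two copies are right in both words, so is the wordwise majority.
open Classical in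
theorem prob_amplified {V L W l : ℕ} {w : Mem} (hWV : W ≤ V) (hV : V % 2 = 1)
    (hL : W + V < L) {C : List Gate} (hC : ∀ g ∈ C, g.Bounded W) (hw : Small V l w)
    (hl : l + 2 ≤ L) {y : ℕ → ℕ} {p : ℝ}
    (hp : prob (circ C (Finsupp.single w 1)) {m | ∀ i < 2, m (l + i) = y i} = p) :
    3 * p ^ 2 - 2 * p ^ 3 ≤ prob (circ (amplified l L C) (Finsupp.single w 1))
      {m | ∀ i < 2, m (l + i) = y i} := by
  set S : Set Mem := {m | ∀ i < 2, m (l + i) = y i} with hS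
  set ψ := circ C (Finsupp.single w 1) with hψ
  have hwL : Small V L w := ⟨hw.1, fun i hi => hw.2 i (by omega)⟩
  have hsmall := (circ_shift_single (o := 0) (b := w) hWV hV hL hC hwL).2
  rw [← hψ] at hsmall
  set o := l + 6 with ho
  set B : Mem → Mem → Mem → Mem := fun m₀ m₁ m₂ =>
    patch (patch (patch w o L m₀) (o + L) L m₁) (o + 2 * L) L m₂ with hB
  set M := (List.range 2).flatMap fun i => majority L (l + i) (l + 2 + 2 * i) (l + 3 + 2 * i)
      (o + l + i) (o + L + l + i) (o + 2 * L + l + i) with hM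
  have hMc : ClassicalCircuit M := classicalCircuit_flatMap fun i _ => classical_majority _ _ _ _ _ _ _
  have hstate : circ (amplified l L C) (Finsupp.single w 1) =
      ∑ t ∈ ψ.support ×ˢ (ψ.support ×ˢ ψ.support),
        Finsupp.single (actCircuit M (B t.1 t.2.1 t.2.2)) (ψ t.1 * ψ t.2.1 * ψ t.2.2) := by
    have s0 : circ (copyCircuit l L C o) (Finsupp.single w 1) =
        ∑ m₀ ∈ ψ.support, Finsupp.single (patch w o L m₀) (ψ m₀) := by
      rw [circ_copyCircuit hWV hV hL hC hw (by omega) (by omega) (by omega) (fun _ _ => rfl)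
        fun i h1 h2 => hw.2 i (by omega)]
      simp only [one_mul, ← hψ]
    have s1 : ∀ m₀, circ (copyCircuit l L C (o + L)) (Finsupp.single (patch w o L m₀) (ψ m₀)) =
        ∑ m₁ ∈ ψ.support, Finsupp.single (patch (patch w o L m₀) (o + L) L m₁) (ψ m₀ * ψ m₁) :=
      fun m₀ => circ_copyCircuit hWV hV hL hC hw (by omega) (by omega) (by omega)
        (fun i hi => patch_of_not (by omega))
        (fun i h1 h2 => by rw [patch_of_not (by omega), hw.2 i (by omega)]) _
    have s2 : ∀ m₀ m₁, circ (copyCircuit l L C (o + 2 * L))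
        (Finsupp.single (patch (patch w o L m₀) (o + L) L m₁) (ψ m₀ * ψ m₁)) =
        ∑ m₂ ∈ ψ.support, Finsupp.single (B m₀ m₁ m₂) (ψ m₀ * ψ m₁ * ψ m₂) :=
      fun m₀ m₁ => circ_copyCircuit hWV hV hL hC hw (by omega) (by omega) (by omega)
        (fun i hi => by rw [patch_of_not (by omega), patch_of_not (by omega)])
        (fun i h1 h2 => by
          rw [patch_of_not (by omega), patch_of_not (by omega), hw.2 i (by omega)]) _
    have hr : (List.range 3).flatMap (fun j => copyCircuit l L C (l + 6 + j * L)) =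
        copyCircuit l L C o ++ copyCircuit l L C (o + L) ++ copyCircuit l L C (o + 2 * L) := by
      simp [List.range_succ, ho]
    rw [amplified, hr, circ_append, circ_append, circ_append, s0, map_sum, map_sum, map_sum,
      Finset.sum_product]
    refine Finset.sum_congr rfl fun m₀ _ => ?_
    rw [s1, map_sum, map_sum, Finset.sum_product]
    refine Finset.sum_congr rfl fun m₁ _ => ?_
    rw [s2, map_sum]
    exact Finset.sum_congr rfl fun m₂ _ => circ_single hMc _ _
  -- The three windows determine the three branches, and the majority circuit is injective; thus the
  -- squared amplitudes may be added.
  have hinj : Set.InjOn (fun t : Mem × Mem × Mem => actCircuit M (B t.1 t.2.1 t.2.2))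
      (ψ.support ×ˢ (ψ.support ×ˢ ψ.support) : Finset (Mem × Mem × Mem)) := by
    rintro ⟨m₀, m₁, m₂⟩ h ⟨m₀', m₁', m₂'⟩ h' he
    simp only [Finset.coe_product, Set.mem_prod, Finset.mem_coe] at h h'
    have he' := actCircuit_injective hMc he
    have e0 : m₀ = m₀' := by
      refine (hsmall _ h.1).patch_inj (b := w) (o := o) (hsmall _ h'.1) ?_
      funext i
      by_cases hi : o ≤ i ∧ i < o + L
      · have := congrFun he' i
        simp only [hB] at this
        rwa [patch_of_not (m := m₂) (by omega), patch_of_not (m := m₁) (by omega),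
          patch_of_not (m := m₂') (by omega), patch_of_not (m := m₁') (by omega)] at this
      · rw [patch_of_not hi, patch_of_not hi]
    have e1 : m₁ = m₁' := by
      refine (hsmall _ h.2.1).patch_inj (b := patch w o L m₀) (o := o + L) (hsmall _ h'.2.1) ?_
      funext i
      by_cases hi : o + L ≤ i ∧ i < o + L + L
      · have := congrFun he' i
        simp only [hB, ← e0] at this
        rwa [patch_of_not (m := m₂) (by omega), patch_of_not (m := m₂') (by omega)] at this
      · rw [patch_of_not hi, patch_of_not hi]
    have e2 : m₂ = m₂' := by
      refine (hsmall _ h.2.2).patch_inj (hsmall _ h'.2.2) (b := patch (patch w o L m₀) (o + L) L m₁)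
        (o := o + 2 * L) ?_
      simpa only [hB, ← e0, ← e1] using he'
    rw [e0, e1, e2]
  have hact : ∀ m₀ ∈ ψ.support, ∀ m₁ ∈ ψ.support, ∀ m₂ ∈ ψ.support, ∀ i < 2,
      actCircuit M (B m₀ m₁ m₂) (l + i) =
        if m₀ (l + i) = m₁ (l + i) then m₀ (l + i) else m₂ (l + i) := by
    intro m₀ h0 m₁ h1 m₂ h2
    have r0 : ∀ i < 2, B m₀ m₁ m₂ (o + l + i) = m₀ (l + i) := fun i hi => by
      simp only [hB]
      rw [patch_of_not (by omega), patch_of_not (by omega),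
        show o + l + i = l + i + o by omega, patch_add (by omega)]
    have r1 : ∀ i < 2, B m₀ m₁ m₂ (o + L + l + i) = m₁ (l + i) := fun i hi => by
      simp only [hB]
      rw [patch_of_not (by omega), show o + L + l + i = l + i + (o + L) by omega,
        patch_add (by omega)]
    have r2 : ∀ i < 2, B m₀ m₁ m₂ (o + 2 * L + l + i) = m₂ (l + i) := fun i hi => by
      simp only [hB]
      rw [show o + 2 * L + l + i = l + i + (o + 2 * L) by omega, patch_add (by omega)]
    have rz : ∀ i, l ≤ i → i < o → B m₀ m₁ m₂ i = 0 := fun i h1 h2 => by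
      simp only [hB]
      rw [patch_of_not (by omega), patch_of_not (by omega), patch_of_not (by omega), hw.2 i h1]
    have n0 : ∀ i, m₀ i < L := fun i => ((hsmall _ h0).1 i).trans_lt (by omega)
    have n1 : ∀ i, m₁ i < L := fun i => ((hsmall _ h1).1 i).trans_lt (by omega)
    have n2 : ∀ i, m₂ i < L := fun i => ((hsmall _ h2).1 i).trans_lt (by omega)
    generalize B m₀ m₁ m₂ = β at r0 r1 r2 rz
    have hM2 : M = majority L l (l + 2) (l + 3) (o + l) (o + L + l) (o + 2 * L + l) ++
        majority L (l + 1) (l + 4) (l + 5) (o + l + 1) (o + L + l + 1) (o + 2 * L + l + 1) := by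
      simp [hM, List.range_succ]
    have q0 := r0 0 (by omega)
    have q1 := r1 0 (by omega)
    have q2 := r2 0 (by omega)
    simp only [Nat.add_zero] at q0 q1 q2
    obtain ⟨x, z, hxz⟩ := act_majority (N := L) (d := l) (s := l + 2) (t := l + 3) (a := o + l)
      (b := o + L + l) (c := o + 2 * L + l) (m := β) (by omega) (rz _ (by omega) (by omega))
      (rz _ (by omega) (by omega)) (rz _ (by omega) (by omega)) (by rw [q0]; exact n0 _)
      (by rw [q1]; exact n1 _) (by rw [q2]; exact n2 _) (by omega) (by omega) (by omega)
      (by omega) (by omega) (by omega)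
    rw [q0, q1, q2] at hxz
    set β' := actCircuit (majority L l (l + 2) (l + 3) (o + l) (o + L + l) (o + 2 * L + l)) β
    have hoff : ∀ i, i ≠ l → i ≠ l + 2 → i ≠ l + 3 → β' i = β i := fun i e1 e2 e3 => by
      rw [hxz, Function.update_of_ne e1, Function.update_of_ne e3, Function.update_of_ne e2]
    have t0 := r0 1 (by omega)
    have t1 := r1 1 (by omega)
    have t2 := r2 1 (by omega)
    rw [← hoff _ (by omega) (by omega) (by omega)] at t0 t1 t2
    have tz : ∀ i, l < i → i < o → i ≠ l + 2 → i ≠ l + 3 → β' i = 0 := fun i e1 e2 e3 e4 => by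
      rw [hoff _ (by omega) e3 e4, rz _ (by omega) e2]
    obtain ⟨x', z', hxz'⟩ := act_majority (N := L) (d := l + 1) (s := l + 4) (t := l + 5)
      (a := o + l + 1) (b := o + L + l + 1) (c := o + 2 * L + l + 1) (m := β') (by omega)
      (tz _ (by omega) (by omega) (by omega) (by omega))
      (tz _ (by omega) (by omega) (by omega) (by omega))
      (tz _ (by omega) (by omega) (by omega) (by omega)) (by rw [t0]; exact n0 _)
      (by rw [t1]; exact n1 _) (by rw [t2]; exact n2 _) (by omega) (by omega) (by omega)
      (by omega) (by omega) (by omega)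
    rw [t0, t1, t2] at hxz'
    intro i hi
    rw [hM2, actCircuit_append, hxz']
    interval_cases i
    · simp only [Nat.add_zero]
      rw [Function.update_of_ne (by omega), Function.update_of_ne (by omega),
        Function.update_of_ne (by omega), hxz, Function.update_self]
    · rw [Function.update_self]
  have h1 : ∑ m ∈ ψ.support, ‖ψ m‖ ^ 2 = 1 := by
    rw [← nsq_eq_sum ψ (Finset.Subset.refl _), hψ, nsq_circ, nsq_single]; simp
  have h2 : ∑ m ∈ ψ.support, ‖ψ m‖ ^ 2 * (if m ∈ S then 1 else 0) = p := by
    rw [← hp, prob]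
    exact Finset.sum_congr rfl fun m _ => by split_ifs <;> simp
  rw [← sum_two_of_three h1 h2, hstate, prob_sum_single _ _ _ hinj, Finset.sum_product]
  refine Finset.sum_le_sum fun m₀ h0 => ?_
  rw [Finset.sum_product]
  refine Finset.sum_le_sum fun m₁ h1 => Finset.sum_le_sum fun m₂ h2 => ?_
  have hmem : (m₀ ∈ S ∧ m₁ ∈ S) ∨ (m₀ ∈ S ∧ m₂ ∈ S) ∨ (m₁ ∈ S ∧ m₂ ∈ S) →
      actCircuit M (B m₀ m₁ m₂) ∈ S := by
    intro h i hi
    rw [hact m₀ h0 m₁ h1 m₂ h2 i hi]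
    rcases h with ⟨a, b⟩ | ⟨a, b⟩ | ⟨a, b⟩ <;> have a := a i hi <;> have b := b i hi <;>
      split_ifs <;> omega
  have hq : 0 ≤ ‖ψ m₀‖ ^ 2 * ‖ψ m₁‖ ^ 2 * ‖ψ m₂‖ ^ 2 := by positivity
  rw [norm_mul, norm_mul, mul_pow, mul_pow]
  by_cases a0 : m₀ ∈ S <;> by_cases a1 : m₁ ∈ S <;> by_cases a2 : m₂ ∈ S <;>
    simp only [a0, a1, a2, and_true, or_true, and_false, or_self, or_false, forall_const, if_true,
      if_false] at hmem ⊢ <;>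
    first
    | (rw [if_pos hmem]; linarith)
    | (split_ifs <;> linarith)

/-- The addresses are increased by the power of `n + 2` with exponent `k`. -/
def amplifiedWriter (k : ℕ) : Writer :=
  .bind (WExpr.pow (.var 0 + 2) k) (.seq
    (.loop 3 (.bind (2 * (.var 0 * .var 0) + 6 + .var 2 * .var 1)
      (.seq (.loop (2 * (.var 0 * .var 0)) (.emit 1 (.var 3 + .var 4) (.var 1) (.var 4) 0))
        (relocate 4 (.var 3)))))
    (.loop 2 (.bind (2 * (.var 0 * .var 0)) (.bind (.var 3 + 6 + .var 3 + .var 2)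
      (.bind (.var 3 + 6 + .var 1 + .var 3 + .var 2)
      (.bind (.var 3 + 6 + 2 * .var 1 + .var 3 + .var 2)
      (.seq (.seq (.seq (.emit 2 (.var 3 + 2 + 2 * .var 2) (.var 1) (.var 4) (.var 5))
        (.emit 2 (.var 3 + 2 + 2 * .var 2) (.var 1) (.var 5) (.var 4)))
        (.seq (.emit 4 (.var 3 + 3 + 2 * .var 2) (.var 1) (.var 3 + 2 + 2 * .var 2)
          (.var 3 + 2 + 2 * .var 2))
        (.emit 1 (.var 3 + .var 2) (.var 1) (.var 4) 0)))
        (.seq (.emit 9 (.var 3 + .var 2) (.var 1) (.var 4) (.var 3 + 3 + 2 * .var 2))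
        (.emit 3 (.var 3 + .var 2) (.var 1) (.var 6) (.var 3 + 3 + 2 * .var 2))))))))))

theorem gates_amplifiedWriter (h : Store) (n k : ℕ) :
    (amplifiedWriter k).gates h 1 (startVar n) =
      amplified (2 * n ^ 2) ((n + 2) ^ k) (circuitOf h) := by
  simp only [amplifiedWriter, amplified, copyCircuit, Writer.gates_bind, Writer.gates_seq,
    Writer.gates_loop]
  congr 1
  · refine congrArg₂ _ ?_ rfl
    funext j
    rw [Writer.gates_relocate _ (2 * n ^ 2 + 6 + j * (n + 2) ^ k)]
    · simp [startVar, Gate.decode, pow_two]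
    · intro i; simp [startVar, pow_two]
  · refine congrArg₂ _ ?_ rfl
    funext j
    simp [startVar, Gate.decode, majority, pow_two]

theorem cost_amplifiedWriter (h : Store) (n k : ℕ) :
    (amplifiedWriter k).cost h 1 (startVar n) ≤ 200 * ((circuitOf h).length + n ^ 2 + 1) := by
  have h1 := fun v : ℕ → ℕ => Params.cost_loop_le (h := h) (d := 4) (v := v)
    (e := 2 * (.var 0 * .var 0)) (p := .emit 1 (.var 3 + .var 4) (.var 1) (.var 4) 0)
    (C := 6) fun i _ => by simp [Writer.cost]
  have h2 := Params.cost_loop_le (h := h) (d := 2) (v := Function.update (startVar n) 1 ((n + 2) ^ k))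
    (e := 3) (p := .bind (2 * (.var 0 * .var 0) + 6 + .var 2 * .var 1)
      (.seq (.loop (2 * (.var 0 * .var 0)) (.emit 1 (.var 3 + .var 4) (.var 1) (.var 4) 0))
        (relocate 4 (.var 3)))) (C := 5 + 2 * n ^ 2 * 8 + 9 * (circuitOf h).length) fun i _ => by
      rw [Writer.cost, Writer.cost, cost_relocate]
      refine (Nat.add_le_add_left (Nat.add_le_add_right (h1 _) _) _).trans ?_
      simp [startVar, pow_two]
      omega
  have h3 : WExpr.eval h (startVar n) (WExpr.pow (.var 0 + 2) k) = (n + 2) ^ k := by simp [startVar]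
  rw [amplifiedWriter, Writer.cost, Writer.cost, h3]
  refine (Nat.add_le_add_left (Nat.add_le_add h2 (Params.cost_loop_le (C := 40) fun i _ => ?_)) _).trans ?_
  · simp [Writer.cost]
  · simp
    omega

theorem quantumTime_amplified {c : ℕ} {p : ℝ} {T : ℕ → ℝ} (hT : ∀ n, 0 ≤ T n) (hp : 0 ≤ p)
    (h : QuantumTime p (traceCube c) T) :
    QuantumTime (3 * p ^ 2 - 2 * p ^ 3) (traceCube c) fun n => T n + (n : ℝ) ^ 2 := by
  obtain ⟨A, κ, t, ht, hA⟩ := h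
  choose u S hE hlen hprob using hA
  refine quantumTime_of_writer A κ (.var 0) (fun n => n) (fun n => rfl) (fun n => by omega)
    (amplifiedWriter (κ + c + 4)) u (fun n => 403 * (t n + n ^ 2 + 1)) S
    (fun n => ⟨u n, le_rfl, hE n⟩) (fun n => ?_) ?_ (fun n x => ?_)
  · have h1 := cost_amplifiedWriter (S n) n (κ + c + 4)
    have h2 := hlen n
    omega
  · exact isBigO_add_sq 403 hT ht
  · have hg := gates_amplifiedWriter (S n) n (κ + c + 4)
    rw [Writer.gates] at hg
    rw [hg]
    have hpx := hprob n x
    rw [runCircuit_eq_circ] at hpx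
    set W := (n + 2) ^ (κ + c + 1) with hW
    have hWn : n ≤ W := by
      have := pow_mono n (show 1 ≤ κ + c + 1 by omega)
      rw [pow_one] at this; omega
    have hW1 : 1 ≤ W := Nat.one_le_pow _ _ (by omega)
    -- With `V = 2 * W + 1` the window must exceed `3 * W + 1`; the factor `(n + 2) ^ 3 ≥ 8` is
    -- enough.
    have hL : (n + 2) ^ (κ + c + 4) = (n + 2) ^ 3 * W := by rw [hW, ← pow_add]; congr 1; omega
    have h8 : 2 ^ 3 ≤ (n + 2) ^ 3 := Nat.pow_le_pow_left (by omega) 3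
    have hWL : 8 * W ≤ (n + 2) ^ (κ + c + 4) := by rw [hL]; exact Nat.mul_le_mul_right _ h8
    have hnL : 2 * n ^ 2 + 2 ≤ (n + 2) ^ (κ + c + 4) := by
      refine le_trans ?_ (pow_mono n (show 3 ≤ κ + c + 4 by omega))
      nlinarith [Nat.zero_le (n ^ 3), Nat.zero_le n]
    have hC : ∀ g ∈ circuitOf (S n), g.Bounded W :=
      bounded_circuitOf (pow_mono n (by omega)) hWn (hE n)
    have hsm : Small (2 * W + 1) (2 * n ^ 2) ((traceCube c).inputWords n x) := by
      refine ⟨fun i => ?_, fun i hi => traceCube_inputWords_of_le x hi⟩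
      by_cases hi : i < 2 * n ^ 2
      · rw [traceCube_inputWords_of_lt x hi]
        have h1 := matWord_le (V := n ^ c) (fun i j => by exact_mod_cast x.2.2 i j) i
        have h2 := (Nat.pow_le_pow_left (show n ≤ n + 2 by omega) c).trans
          (pow_mono n (show c ≤ κ + c + 1 by omega))
        omega
      · rw [traceCube_inputWords_of_le x (by omega)]; exact Nat.zero_le _
    have h1 := prob_amplified (L := (n + 2) ^ (κ + c + 4)) (show W ≤ 2 * W + 1 by omega) (by omega)
      (by omega) hC hsm hnL (y := (traceCube c).output n x) rfl
    refine le_trans ?_ h1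
    have h2 := prob_add_prob_compl (circ (circuitOf (S n)) (Finsupp.single ((traceCube c).inputWords n x) 1))
      ((traceCube c).correct n x)
    rw [nsq_circ, nsq_single, norm_one, one_pow] at h2
    have h3 := prob_nonneg (circ (circuitOf (S n)) (Finsupp.single ((traceCube c).inputWords n x) 1))
      ((traceCube c).correct n x)ᶜ
    change p ≤ prob _ _ at hpx
    change _ ≤ 3 * (prob _ ((traceCube c).correct n x)) ^ 2 - 2 * (prob _ ((traceCube c).correct n x)) ^ 3
    generalize prob _ ((traceCube c).correct n x) = P at hpx h2 ⊢
    have hP : P ≤ 1 := by linarith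
    -- The actual success probability `P` may exceed `p`; this factorization shows that the
    -- polynomial is monotone between zero and one.
    have : 3 * P ^ 2 - 2 * P ^ 3 - (3 * p ^ 2 - 2 * p ^ 3) =
      (P - p) * (3 * (P * (1 - P)) + 3 * (p * (1 - p)) + (P - p) ^ 2) := by ring
    have h4 : 0 ≤ (P - p) * (3 * (P * (1 - P)) + 3 * (p * (1 - p)) + (P - p) ^ 2) := by
      have a1 : 0 ≤ P * (1 - P) := mul_nonneg (by linarith) (by linarith)
      have a2 : 0 ≤ p * (1 - p) := mul_nonneg (by linarith) (by linarith)
      have a3 : 0 ≤ P - p := by linarith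
      positivity
    linarith

/-! ### Combination of the reductions -/

theorem QuantumTime.mono {P : Problem} {p q : ℝ} {T T' : ℕ → ℝ} (h : QuantumTime p P T)
    (hq : q ≤ p) (hT : T =O[atTop] T') : QuantumTime q P T' := by
  obtain ⟨A, κ, t, ht, hA⟩ := h
  refine ⟨A, κ, t, ht.trans hT, fun n => ?_⟩
  obtain ⟨s, τ, h1, h2, h3⟩ := hA n
  exact ⟨s, τ, h1, h2, fun x => hq.trans (h3 x)⟩

theorem isBigO_of_le_two_mul {T T' : ℕ → ℝ} (h0 : ∀ n, 0 ≤ T n) (h : ∀ n, T n ≤ 2 * T' n) :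
    T =O[atTop] T' :=
  IsBigO.of_bound 2 (Eventually.of_forall fun n => by
    rw [Real.norm_of_nonneg (h0 n)]
    exact (h n).trans (mul_le_mul_of_nonneg_left (le_abs_self _) zero_le_two))

theorem quantumTime_traceCube_almost_one {c : ℕ} {T : ℕ → ℝ} (hT : ∀ n, 0 ≤ T n)
    (h : QuantumTime (2 / 3) (traceCube c) T) :
    QuantumTime (1 - 1 / 10 ^ 8) (traceCube c) fun n => T n + (n : ℝ) ^ 2 := by
  have hT' : ∀ n, 0 ≤ T n + (n : ℝ) ^ 2 := fun n => add_nonneg (hT n) (by positivity)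
  have step : ∀ {p q : ℝ}, QuantumTime p (traceCube c) (fun n => T n + (n : ℝ) ^ 2) → 0 ≤ p →
      q ≤ 3 * p ^ 2 - 2 * p ^ 3 → QuantumTime q (traceCube c) fun n => T n + (n : ℝ) ^ 2 :=
    fun h hp hq => (quantumTime_amplified hT' hp h).mono hq
      (isBigO_of_le_two_mul (fun n => add_nonneg (hT' n) (by positivity))
        fun n => by have := hT n; linarith)
  have h0 : QuantumTime (2 / 3) (traceCube c) fun n => T n + (n : ℝ) ^ 2 :=
    h.mono le_rfl (isBigO_of_le_two_mul hT fun n => by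
      have := hT n
      have : 0 ≤ (n : ℝ) ^ 2 := by positivity
      linarith)
  -- Each number is a lower estimate of `3 * p ^ 2 - 2 * p ^ 3` at the previous one. Seven rounds
  -- suffice, so the time grows by a constant factor only.
  have h1 := step (q := 0.74) h0 (by norm_num) (by norm_num)
  have h2 := step (q := 0.83) h1 (by norm_num) (by norm_num)
  have h3 := step (q := 0.92) h2 (by norm_num) (by norm_num)
  have h4 := step (q := 0.98) h3 (by norm_num) (by norm_num)
  have h5 := step (q := 0.998) h4 (by norm_num) (by norm_num)
  have h6 := step (q := 0.99998) h5 (by norm_num) (by norm_num)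
  exact step h6 (by norm_num) (by norm_num)

theorem isBigO_add_sq_log {T : ℕ → ℝ} (hT : ∀ n, 0 ≤ T n) :
    (fun n => T n + (n : ℝ) ^ 2 + (n : ℝ) ^ 2 * Real.log n ^ 2) =O[atTop]
      fun n => T n + (n : ℝ) ^ 2 * Real.log n ^ 2 := by
  refine IsBigO.of_bound 2 ?_
  filter_upwards [eventually_ge_atTop 3] with n hn
  have h1 : 1 ≤ Real.log n := by
    rw [← Real.log_exp 1]
    refine Real.log_le_log (Real.exp_pos 1) ?_
    have := Real.exp_one_lt_d9
    have : (3 : ℝ) ≤ n := by exact_mod_cast hn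
    linarith
  have h2 : (n : ℝ) ^ 2 ≤ (n : ℝ) ^ 2 * Real.log n ^ 2 :=
    le_mul_of_one_le_right (by positivity) (one_le_pow₀ h1)
  have h3 := hT n
  have h4 : 0 ≤ (n : ℝ) ^ 2 := by positivity
  rw [Real.norm_of_nonneg (by linarith), Real.norm_of_nonneg (by linarith)]
  linarith

end QRAM

theorem theorem1 (c : ℕ) :
    ∃ c' : ℕ, ∀ T : ℕ → ℝ, (∀ n, 0 ≤ T n) →
      (QRAM.ClassicalTime (QRAM.traceCube c') T ∨ QRAM.QuantumTime 1 (QRAM.traceCube c') T →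
        ∃ k : ℕ, QRAM.QuantumTime 1 (QRAM.matMul c)
          (fun n => T n + (n : ℝ) ^ 2 * Real.log n ^ k)) ∧
      (QRAM.QuantumTime (2 / 3) (QRAM.traceCube c') T →
        ∃ k : ℕ, QRAM.QuantumTime (2 / 3) (QRAM.matMul c)
          (fun n => T n + (n : ℝ) ^ 2 * Real.log n ^ k)) := by
  -- The subroutine must accept entries up to `N ≤ s ^ (2 * c + 4)`. Exact and classical algorithms
  -- are the case of error zero.
  refine ⟨2 * c + 4, fun T hT => ⟨fun h => ⟨2, ?_⟩, fun h => ⟨2, ?_⟩⟩⟩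
  · have h1 : QRAM.QuantumTime (1 - 0) (QRAM.traceCube (2 * c + 4))
        fun n => T n + (n : ℝ) ^ 2 := by
      rw [sub_zero]
      rcases h with h | h
      · exact QRAM.quantumTime_of_classicalTime hT h
      · exact h.mono le_rfl (QRAM.isBigO_of_le_two_mul hT fun n => by
          have := hT n
          have : 0 ≤ (n : ℝ) ^ 2 := by positivity
          linarith)
    exact (QRAM.quantumTime_matMul (fun n => add_nonneg (hT n) (by positivity)) le_rfl (by simp)
      h1).mono (by simp) (QRAM.isBigO_add_sq_log hT)
  -- With error `10 ^ (-8)` the deviation is 250 / 10 ^ 4 = 1 / 40, and (39 / 40) ^ 2 exceeds 2 / 3.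
  · have hs : √(1 / 10 ^ 8 : ℝ) = 1 / 10 ^ 4 := by
      rw [Real.sqrt_eq_iff_mul_self_eq (by norm_num) (by norm_num)]; norm_num
    exact (QRAM.quantumTime_matMul (fun n => add_nonneg (hT n) (by positivity)) (by norm_num)
      (by rw [hs]; norm_num) (QRAM.quantumTime_traceCube_almost_one hT h)).mono
      (by rw [hs]; norm_num) (QRAM.isBigO_add_sq_log hT)
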